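/- Let $n\ge 1$, $\lambda,\mu\in\mathbb{C}$, $\delta=\mu-\lambda$, and $\hbar\in\mathbb{R}\setminus\{0\}$, and assume $\delta\neq 1+\frac{\ell}{n+1}$ for all $\ell=0,1,2,\dots$ Let $\mathrm{SL}(n+1,\mathbb{R})$ act on $S^n$ by $p\mapsto gp/\|gp\|$, let $\mathcal{F}_\lambda$ be the space of smooth complex densities of degree $\lambda$ on $S^n$, $\mathcal{D}_{\lambda,\mu}$ the space of linear differential operators $\mathcal{F}_\lambda\to\mathcal{F}_\mu$, and $\mathcal{S}_\delta=\bigoplus_k\mathcal{S}_{k,\delta}$ the space of symbols, i.e. smooth functions on $T^*S^n$, polynomial on the fibres, with values in the densities of degree $\delta$. An affine chart of $S^n$ is the inverse of a map $\mathbb{R}^n\to S^n$, $x\mapsto g(1,x)/\|g(1,x)\|$ with $g\in\mathrm{SL}(n+1,\mathbb{R})$. In such a chart, with $\xi_i$ the coordinates dual to $x^i$, put $$\mathcal{I}\bigl(P^{i_1\dots i_k}(x)\,\xi_{i_1}\cdots\xi_{i_k}\bigr)=(-i\hbar)^k P^{i_1\dots i_k}(x)\,\frac{\partial}{\partial x^{i_1}}\cdots\frac{\partial}{\partial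 x^{i_k}},\qquad \mathcal{E}=\xi_i\frac{\partial}{\partial\xi_i},\qquad \mathrm{D}=\frac{\partial}{\partial x^i}\frac{\partial}{\partial\xi_i}.$$ Call a linear map $\mathcal{Q}:\mathcal{S}_\delta\to\mathcal{D}_{\lambda,\mu}$ normalized if, for every $k$ and $P\in\mathcal{S}_{k,\delta}$, the operator $\mathcal{Q}(P)-\mathcal{I}(P)$ has order less than $k$ in every affine chart. Then there is a normalized linear bijection $\mathcal{Q}_{\lambda,\mu}:\mathcal{S}_\delta\to\mathcal{D}_{\lambda,\mu}$ that commutes with the actions of the group $\mathrm{SL}(n+1,\mathbb{R})$ and of its Lie algebra $\mathrm{sl}(n+1,\mathbb{R})$ (by Lie derivatives), and it is the only normalized linear map $\mathcal{S}_\delta\to\mathcal{D}_{\lambda,\mu}$ that commutes with the action of $\mathrm{sl}(n+1,\mathbb{R})$. In every affine chart it is given by $$\mathcal{Q}_{\lambda,\mu}=\mathcal{I}\circ F\!\left(\left.\begin{array}{c}A_1,A_2\\ B_1,B_2\end{array}\right|Z\right),\qquad F\!\left(\left.\begin{array}{c}A_1,A_2\\ B_1,B_2\end{array}\right|Z\right)=\sum_{m=0}^\infty\frac{(A_1)_m(A_2)_m}{(B_1)_m(B_2)_m}\,\frac{Z^m}{m!},$$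 where $(a)_m=a(a+1)\cdots(a+m-1)$, $$A_1=\mathcal{E}+(n+1)\lambda,\quad A_2=2\mathcal{E}+(n+1)(1-\delta)-1,\quad B_1=\mathcal{E}+\tfrac12(n+1)(1-\delta)-\tfrac12,\quad B_2=\mathcal{E}+\tfrac12(n+1)(1-\delta),$$ $$Z=-\frac{i\hbar\,\mathrm{D}}{4},$$ and the powers of $Z$ stand to the right of the coefficients. On each symbol the sum is finite. The coefficient of $Z^m$ is a rational function of $\mathcal{E}$, taken in lowest terms, which acts on symbols of degree $e$ as multiplication by its value at $e$. If $\delta\neq\frac{n}{n+1}$, all the operators $(B_1)_m$ and $(B_2)_m$ are invertible and the quotient can be read with their inverses. -/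

import Mathlib

open scoped ContDiff MatrixGroups

noncomputable section

namespace ProjQuant

/-! ### Local objects in an affine chart `ℝⁿ` -/

/-- The algebra of smooth complex-valued functions on `ℝⁿ`. -/
def SmoothFun (n : ℕ) : Subalgebra ℂ ((Fin n → ℝ) → ℂ) where
  carrier := {f | ContDiff ℝ ∞ f}
  mul_mem' {a b} ha hb := by
    have h1 : ContDiff ℝ ∞ a := ha
    have h2 : ContDiff ℝ ∞ b := hb
    exact h1.mul h2
  add_mem' {a b} ha hb := by
    have h1 : ContDiff ℝ ∞ a := ha
    have h2 : ContDiff ℝ ∞ b := hb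
    exact h1.add h2
  algebraMap_mem' c := by
    have h : ContDiff ℝ ∞ (fun _ : Fin n → ℝ => c) := contDiff_const
    exact h

theorem contDiff_smoothFun {n : ℕ} (f : SmoothFun n) : ContDiff ℝ ∞ f.1 := f.2

/-- The partial derivative `∂/∂xⁱ` of smooth functions on `ℝⁿ`. -/
def partialD {n : ℕ} (i : Fin n) : Module.End ℂ (SmoothFun n) where
  toFun f := ⟨fun x => fderiv ℝ f.1 x (Pi.single i 1),
    by
    have h : ContDiff ℝ ∞ (fun x => fderiv ℝ f.1 x (Pi.single i 1)) :=
      ((contDiff_smoothFun f).fderiv_right (m := ∞) (by simp)).clm_apply contDiff_const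
    exact h⟩
  map_add' f g := by
    ext x
    have hf : DifferentiableAt ℝ f.1 x := ((contDiff_smoothFun f).differentiable (by simp)) x
    have hg : DifferentiableAt ℝ g.1 x := ((contDiff_smoothFun g).differentiable (by simp)) x
    simp [fderiv_add hf hg]
  map_smul' c f := by
    ext x
    have hf : DifferentiableAt ℝ f.1 x := ((contDiff_smoothFun f).differentiable (by simp)) x
    simp [fderiv_const_smul hf]

/-- The higher partial derivative `∂^s` for a multi-index `s`. -/
def partialMulti {n : ℕ} (s : Fin n →₀ ℕ) : Module.End ℂ (SmoothFun n) :=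
  ((List.finRange n).map fun i => partialD i ^ s i).prod

/-- Symbols over an affine chart: polynomials in the fibre coordinates `ξ₁, …, ξₙ` of `T*ℝⁿ`
whose coefficients are smooth functions of `x`. -/
abbrev LocalSymbol (n : ℕ) : Type := MvPolynomial (Fin n) (SmoothFun n)

/-- The value `P(x, ξ)` of a local symbol at a point of the cotangent bundle. -/
def evalSymbol {n : ℕ} (P : LocalSymbol n) (x ξ : Fin n → ℝ) : ℂ :=
  MvPolynomial.eval₂ ((Pi.evalRingHom (fun _ : Fin n → ℝ => ℂ) x).comp (SmoothFun n).val.toRingHom)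
    (fun i => (ξ i : ℂ)) P

/-- The operator `∂/∂xⁱ` on local symbols: it differentiates the coefficients. -/
def symbolDx {n : ℕ} (i : Fin n) : Module.End ℂ (LocalSymbol n) where
  toFun P := ∑ s ∈ P.support, MvPolynomial.monomial s (partialD i (P.coeff s))
  map_add' P Q := by
    classical
    ext1 s
    simp only [MvPolynomial.coeff_add, MvPolynomial.coeff_sum, MvPolynomial.coeff_monomial,
      Finset.sum_ite_eq', MvPolynomial.mem_support_iff]
    split_ifs <;> simp_all [← map_add]
  map_smul' c P := by
    classical
    ext1 s
    simp only [MvPolynomial.coeff_smul, MvPolynomial.coeff_sum, MvPolynomial.coeff_monomial,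
      Finset.sum_ite_eq', MvPolynomial.mem_support_iff, RingHom.id_apply]
    split_ifs <;> simp_all

/-- The operator `∂/∂ξᵢ` on local symbols. -/
def symbolDxi {n : ℕ} (i : Fin n) : Module.End ℂ (LocalSymbol n) :=
  (MvPolynomial.pderiv (R := SmoothFun n) i).toLinearMap.restrictScalars ℂ

/-- Multiplication of local symbols by a fixed local symbol. -/
def mulSymbol {n : ℕ} (a : LocalSymbol n) : Module.End ℂ (LocalSymbol n) :=
  LinearMap.mulLeft ℂ a

/-- The Euler operator `𝓔 = ξᵢ ∂/∂ξᵢ`. -/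
def eulerOp (n : ℕ) : Module.End ℂ (LocalSymbol n) :=
  ∑ i, mulSymbol (MvPolynomial.X i) * symbolDxi i

/-- The divergence operator `D = ∂/∂xⁱ ∂/∂ξᵢ`. -/
def divOp (n : ℕ) : Module.End ℂ (LocalSymbol n) :=
  ∑ i, symbolDx i * symbolDxi i

/-- The operator obtained from a local symbol by substituting `c ∂/∂xⁱ` for `ξᵢ`, with all
coefficients to the left of the derivatives, applied to the function `f`. -/
def applyOp {n : ℕ} (c : ℂ) (P : LocalSymbol n) (f : SmoothFun n) : SmoothFun n :=
  ∑ s ∈ P.support, c ^ s.degree • (P.coeff s * partialMulti s f)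

theorem applyOp_eq_sum {n : ℕ} (c : ℂ) (P : LocalSymbol n) (f : SmoothFun n)
    (S : Finset (Fin n →₀ ℕ)) (hS : P.support ⊆ S) :
    applyOp c P f = ∑ s ∈ S, c ^ s.degree • (P.coeff s * partialMulti s f) := by
  refine Finset.sum_subset hS fun s _ hs => ?_
  rw [MvPolynomial.notMem_support_iff.mp hs]
  simp

theorem applyOp_add {n : ℕ} (c : ℂ) (P Q : LocalSymbol n) (f : SmoothFun n) :
    applyOp c (P + Q) f = applyOp c P f + applyOp c Q f := by
  classical
  rw [applyOp_eq_sum c (P + Q) f _ MvPolynomial.support_add,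
    applyOp_eq_sum c P f _ Finset.subset_union_left,
    applyOp_eq_sum c Q f _ Finset.subset_union_right, ← Finset.sum_add_distrib]
  simp [add_mul, smul_add]

theorem applyOp_smul {n : ℕ} (c a : ℂ) (P : LocalSymbol n) (f : SmoothFun n) :
    applyOp c (a • P) f = a • applyOp c P f := by
  classical
  rw [applyOp_eq_sum c (a • P) f _ MvPolynomial.support_smul, applyOp, Finset.smul_sum]
  refine Finset.sum_congr rfl fun s _ => ?_
  rw [MvPolynomial.coeff_smul, smul_mul_assoc, smul_comm]

/-- The normal ordering map `𝓘`, which sends `ξᵢ` to `-iħ ∂/∂xⁱ`. -/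
def normalOrder {n : ℕ} (ħ : ℝ) (P : LocalSymbol n) (f : SmoothFun n) : SmoothFun n :=
  applyOp (-(Complex.I * ħ)) P f

/-! ### The sphere `Sⁿ`, the action of `SL(n+1, ℝ)` and the affine charts -/

/-- The unit sphere `Sⁿ` in `ℝⁿ⁺¹`. -/
abbrev Sph (n : ℕ) : Type := Metric.sphere (0 : EuclideanSpace ℝ (Fin (n + 1))) 1

/-- A matrix of determinant one applied to a vector. -/
def act {n : ℕ} (g : SL(n + 1, ℝ)) (v : Fin (n + 1) → ℝ) : Fin (n + 1) → ℝ :=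
  (g : Matrix (Fin (n + 1)) (Fin (n + 1)) ℝ).mulVec v

theorem act_mul {n : ℕ} (g h : SL(n + 1, ℝ)) (v : Fin (n + 1) → ℝ) :
    act (g * h) v = act g (act h v) := by
  simp [act, Matrix.mulVec_mulVec]

theorem act_one {n : ℕ} (v : Fin (n + 1) → ℝ) : act 1 v = v := by
  simp [act]

theorem act_smul {n : ℕ} (g : SL(n + 1, ℝ)) (r : ℝ) (v : Fin (n + 1) → ℝ) :
    act g (r • v) = r • act g v :=
  Matrix.mulVec_smul _ _ _

theorem act_ne_zero {n : ℕ} (g : SL(n + 1, ℝ)) {v : Fin (n + 1) → ℝ} (hv : v ≠ 0) :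
    act g v ≠ 0 := by
  intro h
  apply hv
  rw [← act_one v, ← inv_mul_cancel g, act_mul, h]
  simp [act]

/-- The radial projection of a nonzero vector to the unit sphere. -/
def toSph {n : ℕ} (v : Fin (n + 1) → ℝ) (hv : v ≠ 0) : Sph n :=
  ⟨‖WithLp.toLp 2 v‖⁻¹ • WithLp.toLp 2 v, by
    have h : ‖WithLp.toLp 2 v‖ ≠ 0 := by simp [hv]
    simp [norm_smul, h]⟩

theorem toSph_ne_zero {n : ℕ} (p : Sph n) : (p.1.ofLp : Fin (n + 1) → ℝ) ≠ 0 := by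
  intro h
  have h1 : ‖p.1‖ = 1 := by simpa using p.2
  have h2 : p.1 = 0 := by
    ext i
    simpa using congrFun h i
  simp [h2] at h1

/-- The standard action of `SL(n+1, ℝ)` on `Sⁿ`: `p ↦ g p / ‖g p‖`. -/
def sphAct {n : ℕ} (g : SL(n + 1, ℝ)) (p : Sph n) : Sph n :=
  toSph (act g p.1.ofLp) (act_ne_zero g (toSph_ne_zero p))

theorem cons_one_ne_zero {n : ℕ} (x : Fin n → ℝ) :
    (Fin.cons 1 x : Fin (n + 1) → ℝ) ≠ 0 := by
  intro h
  simpa using congrFun h 0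

/-- The parametrization `ℝⁿ → Sⁿ`, inverse to the affine (central projection) chart attached to
`g`: the translate by `g` of the standard one `x ↦ (1, x) / ‖(1, x)‖`. -/
def chart {n : ℕ} (g : SL(n + 1, ℝ)) (x : Fin n → ℝ) : Sph n :=
  sphAct g (toSph (Fin.cons 1 x) (cons_one_ne_zero x))

/-- The affine coordinates attached to `g`; they invert `chart g` on its image. -/
def coord {n : ℕ} (g : SL(n + 1, ℝ)) (p : Sph n) : Fin n → ℝ :=
  fun i => act g⁻¹ p.1.ofLp i.succ / act g⁻¹ p.1.ofLp 0

/-- The change of affine coordinates from the chart of `g` to the chart of `h`. -/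
def transition {n : ℕ} (g h : SL(n + 1, ℝ)) (x : Fin n → ℝ) : Fin n → ℝ :=
  coord h (chart g x)

/-- The absolute value of the Jacobian determinant of a change of affine coordinates. -/
def jac {n : ℕ} (g h : SL(n + 1, ℝ)) (x : Fin n → ℝ) : ℝ :=
  |(fderiv ℝ (transition g h) x).det|

/-- The pull-back of the covector `η` by the differential at `x` of a change of coordinates. -/
def pullCovector {n : ℕ} (g h : SL(n + 1, ℝ)) (x η : Fin n → ℝ) : Fin n → ℝ :=
  fun j => ∑ i, η i * fderiv ℝ (transition g h) x (Pi.single j 1) i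

theorem toSph_smul {n : ℕ} (v : Fin (n + 1) → ℝ) (hv : v ≠ 0) {r : ℝ} (hr : 0 < r)
    (hrv : r • v ≠ 0) : toSph (r • v) hrv = toSph v hv := by
  apply Subtype.ext
  simp only [toSph, WithLp.toLp_smul, norm_smul, Real.norm_eq_abs, abs_of_pos hr, smul_smul]
  congr 1
  field_simp

theorem sphAct_toSph {n : ℕ} (g : SL(n + 1, ℝ)) (v : Fin (n + 1) → ℝ) (hv : v ≠ 0) :
    sphAct g (toSph v hv) = toSph (act g v) (act_ne_zero g hv) := by
  have h : 0 < ‖WithLp.toLp 2 v‖⁻¹ := by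
    have : WithLp.toLp 2 v ≠ 0 := by simp [hv]
    positivity
  have e : act g (toSph v hv).1.ofLp = ‖WithLp.toLp 2 v‖⁻¹ • act g v := by
    rw [← act_smul]
    rfl
  have hne : ‖WithLp.toLp 2 v‖⁻¹ • act g v ≠ 0 := smul_ne_zero h.ne' (act_ne_zero g hv)
  rw [← toSph_smul (act g v) (act_ne_zero g hv) h hne]
  simp only [sphAct, e]

theorem toSph_self {n : ℕ} (p : Sph n) : toSph p.1.ofLp (toSph_ne_zero p) = p := by
  have h1 : ‖p.1‖ = 1 := by simpa using p.2
  apply Subtype.ext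
  simp [toSph, h1]

theorem sphAct_mul {n : ℕ} (g h : SL(n + 1, ℝ)) (p : Sph n) :
    sphAct (g * h) p = sphAct g (sphAct h p) := by
  conv_rhs => rw [sphAct.eq_def h p, sphAct_toSph]
  simp only [sphAct, act_mul]

theorem sphAct_one {n : ℕ} (p : Sph n) : sphAct 1 p = p := by
  simp only [sphAct, act_one, toSph_self]

/-- The chart of `a * g` is the translate by `a` of the chart of `g`. -/
theorem chart_mul {n : ℕ} (a g : SL(n + 1, ℝ)) (x : Fin n → ℝ) :
    chart (a * g) x = sphAct a (chart g x) :=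
  sphAct_mul _ _ _

theorem chart_mul_eq_iff {n : ℕ} (a g h : SL(n + 1, ℝ)) (x y : Fin n → ℝ) :
    chart (a * g) x = chart (a * h) y ↔ chart g x = chart h y := by
  rw [chart_mul, chart_mul]
  refine ⟨fun e => ?_, fun e => by rw [e]⟩
  have := congrArg (sphAct a⁻¹) e
  rwa [← sphAct_mul, ← sphAct_mul, inv_mul_cancel, sphAct_one, sphAct_one] at this

theorem coord_sphAct {n : ℕ} (a h : SL(n + 1, ℝ)) (p : Sph n) :
    coord (a * h) (sphAct a p) = coord h p := by
  have hne := act_ne_zero a (toSph_ne_zero p)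
  have h0 : ‖WithLp.toLp 2 (act a p.1.ofLp)‖⁻¹ ≠ 0 := by simpa using hne
  have e : act (a * h)⁻¹ (sphAct a p).1.ofLp
      = ‖WithLp.toLp 2 (act a p.1.ofLp)‖⁻¹ • act h⁻¹ p.1.ofLp := by
    have : (sphAct a p).1.ofLp = ‖WithLp.toLp 2 (act a p.1.ofLp)‖⁻¹ • act a p.1.ofLp := rfl
    rw [this, act_smul, ← act_mul]
    simp
  funext i
  simp only [coord, e, Pi.smul_apply, smul_eq_mul]
  exact mul_div_mul_left _ _ h0

theorem transition_mul {n : ℕ} (a g h : SL(n + 1, ℝ)) :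
    transition (a * g) (a * h) = transition g h := by
  funext x
  simp only [transition, chart_mul, coord_sphAct]

/-! ### Densities, symbols and differential operators on `Sⁿ`

Sections of natural bundles over `Sⁿ` are given by their expressions in all the affine charts,
subject to the transformation rule on overlaps. -/

/-- The space `𝓕_λ(Sⁿ)` of smooth densities of degree `λ`: on overlaps,
`f_g |dx|^λ = f_h |dy|^λ`. -/
def Density (n : ℕ) (lam : ℂ) : Submodule ℂ (SL(n + 1, ℝ) → SmoothFun n) where
  carrier := {f | ∀ (g h : SL(n + 1, ℝ)) (x y : Fin n → ℝ), chart g x = chart h y →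
    (f g).1 x = (jac g h x : ℂ) ^ lam * (f h).1 y}
  add_mem' {a b} ha hb := by
    intro g h x y e
    have h1 := ha g h x y e
    have h2 := hb g h x y e
    simp only [Pi.add_apply, Subalgebra.coe_add, h1, h2, mul_add]
  zero_mem' := by
    intro g h x y _
    simp
  smul_mem' c a ha := by
    intro g h x y e
    have h1 := ha g h x y e
    simp only [Pi.smul_apply, Subalgebra.coe_smul, h1, smul_eq_mul]
    ring

theorem evalSymbol_add {n : ℕ} (P Q : LocalSymbol n) (x ξ : Fin n → ℝ) :
    evalSymbol (P + Q) x ξ = evalSymbol P x ξ + evalSymbol Q x ξ :=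
  MvPolynomial.eval₂_add _ _

theorem evalSymbol_smul {n : ℕ} (c : ℂ) (P : LocalSymbol n) (x ξ : Fin n → ℝ) :
    evalSymbol (c • P) x ξ = c * evalSymbol P x ξ := by
  have : c • P = MvPolynomial.C (algebraMap ℂ (SmoothFun n) c) * P := by
    rw [Algebra.smul_def]
    rfl
  rw [this, evalSymbol, MvPolynomial.eval₂_mul, MvPolynomial.eval₂_C]
  rfl

/-- The space `𝓢_δ(Sⁿ)` of symbols: smooth functions on `T*Sⁿ`, polynomial on the fibres, with
values in the densities of degree `δ`. On overlaps, `P_g(x, ξ) |dx|^δ = P_h(y, η) |dy|^δ`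
where `ξ` is the pull-back of `η`. -/
def Symb (n : ℕ) (del : ℂ) : Submodule ℂ (SL(n + 1, ℝ) → LocalSymbol n) where
  carrier := {P | ∀ (g h : SL(n + 1, ℝ)) (x y : Fin n → ℝ), chart g x = chart h y →
    ∀ η : Fin n → ℝ, evalSymbol (P g) x (pullCovector g h x η)
      = (jac g h x : ℂ) ^ del * evalSymbol (P h) y η}
  add_mem' {a b} ha hb := by
    intro g h x y e η
    have h1 := ha g h x y e η
    have h2 := hb g h x y e η
    simp only [Pi.add_apply, evalSymbol_add, h1, h2, mul_add]
  zero_mem' := by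
    intro g h x y _ η
    simp [evalSymbol]
  smul_mem' c a ha := by
    intro g h x y e η
    have h1 := ha g h x y e η
    simp only [Pi.smul_apply, evalSymbol_smul, h1]
    ring

/-- The space `𝓓_{λ,μ}(Sⁿ)` of linear differential operators from `𝓕_λ(Sⁿ)` to `𝓕_μ(Sⁿ)`: linear
maps that are, in each affine chart, polynomials in the `∂/∂xⁱ` with smooth coefficients. -/
def DiffOp (n : ℕ) (lam mu : ℂ) : Submodule ℂ (Density n lam →ₗ[ℂ] Density n mu) where
  carrier := {T | ∀ g : SL(n + 1, ℝ), ∃ p : LocalSymbol n, ∀ f : Density n lam,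
    (T f).1 g = applyOp 1 p (f.1 g)}
  add_mem' {S T} hS hT := by
    intro g
    obtain ⟨p, hp⟩ := hS g
    obtain ⟨q, hq⟩ := hT g
    refine ⟨p + q, fun f => ?_⟩
    rw [applyOp_add, ← hp, ← hq]
    rfl
  zero_mem' := by
    intro g
    refine ⟨0, fun f => ?_⟩
    simp [applyOp]
  smul_mem' c T hT := by
    intro g
    obtain ⟨p, hp⟩ := hT g
    refine ⟨c • p, fun f => ?_⟩
    rw [applyOp_smul, ← hp]
    rfl

/-! ### The action of the group `SL(n+1, ℝ)` -/

/-- The action of `a` on densities. Since `chart (a⁻¹ * g) = a⁻¹ ∘ chart g`, the expression of the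
push-forward of `f` by `a` in the chart of `g` is that of `f` in the chart of `a⁻¹ * g`. -/
def densAct {n : ℕ} {lam : ℂ} (a : SL(n + 1, ℝ)) (f : Density n lam) : Density n lam :=
  ⟨fun g => f.1 (a⁻¹ * g), by
    intro g h x y e
    have := f.2 (a⁻¹ * g) (a⁻¹ * h) x y ((chart_mul_eq_iff _ _ _ _ _).mpr e)
    simpa only [jac, transition_mul] using this⟩

/-- The action of `a` on symbols (push-forward). -/
def symbAct {n : ℕ} {del : ℂ} (a : SL(n + 1, ℝ)) (P : Symb n del) : Symb n del :=
  ⟨fun g => P.1 (a⁻¹ * g), by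
    intro g h x y e η
    have := P.2 (a⁻¹ * g) (a⁻¹ * h) x y ((chart_mul_eq_iff _ _ _ _ _).mpr e) η
    have e2 : pullCovector (a⁻¹ * g) (a⁻¹ * h) x η = pullCovector g h x η := by
      unfold pullCovector
      rw [transition_mul]
    rw [e2] at this
    simpa only [jac, transition_mul] using this⟩

/-- `Q` commutes with the action of `SL(n+1, ℝ)`: `Q(a·P) = a ∘ Q(P) ∘ a⁻¹`. -/
def IsGroupEquivariant {n : ℕ} {lam mu : ℂ} (Q : Symb n (mu - lam) →ₗ[ℂ] DiffOp n lam mu) : Prop :=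
  ∀ (a : SL(n + 1, ℝ)) (P : Symb n (mu - lam)) (f : Density n lam),
    (Q (symbAct a P)).1 (densAct a f) = densAct a ((Q P).1 f)

/-! ### The action of the Lie algebra `sl(n+1, ℝ)` -/

/-- The components of the projective vector field on `ℝⁿ` generated by a matrix `Y`, that is, of
the velocity at `t = 0` of the affine coordinates of `exp(tY)(1, x)`. Over all traceless `Y`, these
vector fields form the span of `∂ᵢ`, `xⁱ∂ⱼ` and `xⁱ ∑ⱼ xʲ∂ⱼ`. -/
def projField {n : ℕ} (Y : Matrix (Fin (n + 1)) (Fin (n + 1)) ℝ) (i : Fin n) : SmoothFun n :=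
  ⟨fun x => (((Y i.succ 0 + ∑ j : Fin n, Y i.succ j.succ * x j)
      - x i * (Y 0 0 + ∑ j : Fin n, Y 0 j.succ * x j) : ℝ) : ℂ), by
    have h : ContDiff ℝ ∞ (fun x : Fin n → ℝ => (Y i.succ 0 + ∑ j : Fin n, Y i.succ j.succ * x j)
        - x i * (Y 0 0 + ∑ j : Fin n, Y 0 j.succ * x j)) := by fun_prop
    exact Complex.ofRealCLM.contDiff.comp h⟩

/-- The divergence of a vector field on `ℝⁿ`. -/
def divField {n : ℕ} (v : Fin n → SmoothFun n) : SmoothFun n := ∑ i, partialD i (v i)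

/-- The Lie derivative of a density of degree `λ` on `ℝⁿ`: `vⁱ ∂ᵢ f + λ (∂ᵢ vⁱ) f`. -/
def lieDens {n : ℕ} (lam : ℂ) (v : Fin n → SmoothFun n) (f : SmoothFun n) : SmoothFun n :=
  ∑ i, v i * partialD i f + lam • (divField v * f)

/-- The Lie derivative of a symbol of degree `δ` on `ℝⁿ`:
`vⁱ ∂P/∂xⁱ - (∂ⱼ vⁱ) ξᵢ ∂P/∂ξⱼ + δ (∂ᵢ vⁱ) P`. -/
def lieSymb {n : ℕ} (del : ℂ) (v : Fin n → SmoothFun n) (P : LocalSymbol n) : LocalSymbol n :=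
  ∑ i, MvPolynomial.C (v i) * symbolDx i P
    - ∑ i, ∑ j, MvPolynomial.C (partialD j (v i)) * MvPolynomial.X i * symbolDxi j P
    + del • (MvPolynomial.C (divField v) * P)

/-- The expression in the chart of `g` of the vector field on `Sⁿ` generated by `X`. -/
def fundField {n : ℕ} (X : Matrix (Fin (n + 1)) (Fin (n + 1)) ℝ) (g : SL(n + 1, ℝ)) :
    Fin n → SmoothFun n :=
  projField (((g⁻¹ : SL(n + 1, ℝ)) : Matrix (Fin (n + 1)) (Fin (n + 1)) ℝ) * X
    * (g : Matrix (Fin (n + 1)) (Fin (n + 1)) ℝ))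

/-- `f'` is the Lie derivative of the density `f` along the vector field generated by `X`. -/
def IsLieDens {n : ℕ} {lam : ℂ} (X : Matrix (Fin (n + 1)) (Fin (n + 1)) ℝ)
    (f f' : Density n lam) : Prop :=
  ∀ g : SL(n + 1, ℝ), f'.1 g = lieDens lam (fundField X g) (f.1 g)

/-- `P'` is the Lie derivative of the symbol `P` along the vector field generated by `X`. -/
def IsLieSymb {n : ℕ} {del : ℂ} (X : Matrix (Fin (n + 1)) (Fin (n + 1)) ℝ)
    (P P' : Symb n del) : Prop :=
  ∀ g : SL(n + 1, ℝ), P'.1 g = lieSymb del (fundField X g) (P.1 g)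

/-- `T'` is the Lie derivative `L_X ∘ T - T ∘ L_X` of the differential operator `T` along the
vector field generated by `X`. Every density `f` has exactly one Lie derivative `f'`. -/
def IsLieOp {n : ℕ} {lam mu : ℂ} (X : Matrix (Fin (n + 1)) (Fin (n + 1)) ℝ)
    (T T' : DiffOp n lam mu) : Prop :=
  ∀ f : Density n lam, ∃ f' : Density n lam,
    IsLieDens X f f' ∧ IsLieDens X (T.1 f) (T'.1 f + T.1 f')

/-- `Q` commutes with the action of the Lie algebra `sl(n+1, ℝ)`: `Q(L_X P) = L_X Q(P)`. Every
symbol `P` has exactly one Lie derivative `P'`. -/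
def IsLieEquivariant {n : ℕ} {lam mu : ℂ} (Q : Symb n (mu - lam) →ₗ[ℂ] DiffOp n lam mu) : Prop :=
  ∀ X : Matrix (Fin (n + 1)) (Fin (n + 1)) ℝ, X.trace = 0 →
    ∀ P : Symb n (mu - lam), ∃ P' : Symb n (mu - lam), IsLieSymb X P P' ∧ IsLieOp X (Q P) (Q P')

/-! ### Quantization maps -/

/-- `Q` preserves principal symbols: if `P` is homogeneous of degree `k` on the fibres then, in
each affine chart, `Q(P)` differs from the normal ordered operator of `P` by an operator of order
less than `k`. -/
def IsNormalized {n : ℕ} {lam mu : ℂ} (ħ : ℝ)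
    (Q : Symb n (mu - lam) →ₗ[ℂ] DiffOp n lam mu) : Prop :=
  ∀ (k : ℕ) (P : Symb n (mu - lam)), (∀ g, (P.1 g).IsHomogeneous k) →
    ∀ g : SL(n + 1, ℝ), ∃ r : LocalSymbol n, (∀ s ∈ r.support, s.degree < k) ∧
      ∀ f : Density n lam, ((Q P).1 f).1 g = normalOrder ħ (P.1 g + r) (f.1 g)

/-! ### Hypergeometric series -/

/-- The rising factorial `(a)_m = a (a + 1) ⋯ (a + m - 1)` in a complex algebra. -/
def rising {A : Type*} [Semiring A] [Algebra ℂ A] (a : A) (m : ℕ) : A :=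
  Polynomial.aeval a (ascPochhammer ℂ m)

/-- The coefficient `(a₁)_m (a₂)_m / ((b₁)_m (b₂)_m m!)` of a `₂F₂` series whose parameters are
rational functions of one variable; common factors cancel. -/
def hypCoeff (a₁ a₂ b₁ b₂ : RatFunc ℂ) (m : ℕ) : RatFunc ℂ :=
  rising a₁ m * rising a₂ m / (rising b₁ m * rising b₂ m) / (m.factorial : RatFunc ℂ)

/-- The operator `c(𝓔)` for a rational function `c`: it multiplies the part of degree `e` of a
symbol by `c(e)`. -/
def ratEuler {n : ℕ} (c : RatFunc ℂ) (P : LocalSymbol n) : LocalSymbol n :=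
  ∑ e ∈ Finset.range (P.totalDegree + 1),
    RatFunc.eval (RingHom.id ℂ) (e : ℂ) c • MvPolynomial.homogeneousComponent e P

/-- The noncommutative series `F(a₁(𝓔), a₂(𝓔); b₁(𝓔), b₂(𝓔) | Z)` applied to a symbol, with the
powers of `Z` on the right. -/
def hypEuler {n : ℕ} (a₁ a₂ b₁ b₂ : RatFunc ℂ) (Z : Module.End ℂ (LocalSymbol n))
    (P : LocalSymbol n) : LocalSymbol n :=
  ∑ᶠ m : ℕ, ratEuler (hypCoeff a₁ a₂ b₁ b₂ m) ((Z ^ m) P)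

/-- The noncommutative series `F(A₁, A₂; B₁, B₂ | Z)` with operator parameters, applied to a
symbol, with the powers of `Z` on the right; it is meant for `B₁`, `B₂` whose rising factorials are
all invertible. -/
def hypOp {n : ℕ} (A₁ A₂ B₁ B₂ Z : Module.End ℂ (LocalSymbol n)) (P : LocalSymbol n) :
    LocalSymbol n :=
  ∑ᶠ m : ℕ, ((m.factorial : ℂ)⁻¹ •
    (rising A₁ m * rising A₂ m * Ring.inverse (rising B₁ m) * Ring.inverse (rising B₂ m) * Z ^ m)) P

/-- The parameter `A₁ = E + (n+1)λ`, where `E` is the Euler operator or a variable. -/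
def parA₁ {A : Type*} [Semiring A] [Algebra ℂ A] (n : ℕ) (lam : ℂ) (E : A) : A :=
  E + algebraMap ℂ A ((n + 1) * lam)

/-- The parameter `A₂ = 2E + (n+1)(1-δ) - 1`. -/
def parA₂ {A : Type*} [Semiring A] [Algebra ℂ A] (n : ℕ) (del : ℂ) (E : A) : A :=
  2 * E + algebraMap ℂ A ((n + 1) * (1 - del) - 1)

/-- The parameter `B₁ = E + (n+1)(1-δ)/2 - 1/2`. -/
def parB₁ {A : Type*} [Semiring A] [Algebra ℂ A] (n : ℕ) (del : ℂ) (E : A) : A :=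
  E + algebraMap ℂ A ((n + 1) * (1 - del) / 2 - 1 / 2)

/-- The parameter `B₂ = E + (n+1)(1-δ)/2`. -/
def parB₂ {A : Type*} [Semiring A] [Algebra ℂ A] (n : ℕ) (del : ℂ) (E : A) : A :=
  E + algebraMap ℂ A ((n + 1) * (1 - del) / 2)

/-- The variable `Z = -iħD/4`. -/
def varZ (n : ℕ) (ħ : ℝ) : Module.End ℂ (LocalSymbol n) :=
  (-(Complex.I * ħ) / 4) • divOp n

end ProjQuant

end

open scoped ContDiff MatrixGroups

noncomputable section

namespace ProjQuant

open MvPolynomial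

variable {n : ℕ}

/-! ### Smooth functions and partial derivatives -/

/-! In an affine chart, normal ordering commutes with affine vector fields and fails to commute with
the quadratic projective ones by a single term. Write `c = -iħ`, let L_Y be the Lie derivative along
`projField Y`, and let `dualOp Y` be ∑ Y₀ⱼ ∂/∂ξⱼ. By `lieDens_applyOp`, the Lie derivative of the
operator of P is the operator of L_Y P + c (𝓔 + (n+1)λ) `dualOp Y` P. On symbols the divergence D
has a defect of the same shape, [D, L_Y] = (2𝓔 + (n+1)(1-δ)) `dualOp Y` (`divOp_lieSymb`), and
`divOp_pow_lieSymb` sums it over the powers of D. Therefore ∑ cᵐ q_m(𝓔) Dᵐ followed by normal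
ordering is equivariant once q_{m+1}(e) (m+1)(2e + (n+1)(1-δ) + m) = q_m(e+1) (e + (n+1)λ).
Nonresonance says that no divisor vanishes, and q₀ = 1 then gives `quantCoeff` (`quantCoeff_succ`,
`quantSymb_lieSymb`).

The local operators must agree on overlaps (`quantLocal_mem_density`). After moving a common point
to the origin of both charts, the change of charts is a linear map times a shear that fixes the
origin. Linear maps respect every ingredient of the formula. Along the shear, infinitesimal
equivariance shows that the value at the origin has zero derivative in time. Group equivariance is
then automatic, because the group only relabels the charts and the formula is the same in all of
them.

Quantization is the identity plus terms of lower degree, so it is injective. It is surjective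
because the leading part of a differential operator is a symbol on the sphere, which can be
quantized and subtracted; compactness of the sphere bounds the order over all charts. Operators are
compared through the densities ℓ(v)ᵏ‖v‖^(-(n+1)λ-k), which detect the part of degree k of a total
symbol (`applyOp_testDensity`).

For uniqueness, let Q' be another such map and T = Q⁻¹Q'. Then T commutes with all L_X, and T - 1
lowers the degree. The Casimir operator acts on symbols of degree e by a scalar κ(e)
(`sum_symbLie_symbLie`), and κ(e) - κ(k) for e < k is a nonzero multiple of (n+1)(1-δ) + e + k - 1.
This is nonzero by nonresonance, so T = 1.

The hypergeometric form is the duplication formula 4ᵐ (B₁)_m (B₂)_m = (A₂)_m (A₂+m)_m. It cancels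
(A₂)_m and absorbs the factor 1/4 in Z. -/

theorem differentiableAt_smoothFun (f : SmoothFun n) (x : Fin n → ℝ) :
    DifferentiableAt ℝ f.1 x := (contDiff_smoothFun f).differentiable (by simp) x

theorem partialD_apply (i : Fin n) (f : SmoothFun n) (x : Fin n → ℝ) :
    (partialD i f).1 x = fderiv ℝ f.1 x (Pi.single i 1) := rfl

theorem partialD_mul (i : Fin n) (f g : SmoothFun n) :
    partialD i (f * g) = partialD i f * g + f * partialD i g := by
  apply Subtype.ext
  funext x
  change fderiv ℝ (f.1 * g.1) x (Pi.single i 1) = fderiv ℝ f.1 x (Pi.single i 1) * g.1 x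
    + f.1 x * fderiv ℝ g.1 x (Pi.single i 1)
  rw [fderiv_mul (differentiableAt_smoothFun f x) (differentiableAt_smoothFun g x)]
  simp
  ring

theorem partialD_algebraMap (i : Fin n) (c : ℂ) :
    partialD i (algebraMap ℂ (SmoothFun n) c) = 0 := by
  apply Subtype.ext
  funext x
  change fderiv ℝ (fun _ : Fin n → ℝ => c) x (Pi.single i 1) = 0
  simp

theorem partialD_comm (i j : Fin n) (f : SmoothFun n) :
    partialD i (partialD j f) = partialD j (partialD i f) := by
  apply Subtype.ext
  funext x
  have hd : DifferentiableAt ℝ (fderiv ℝ f.1) x :=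
    ((contDiff_smoothFun f).fderiv_right (m := ∞) (by simp)).differentiable (by simp) x
  have key : ∀ a b : Fin n, (partialD a (partialD b f)).1 x
      = fderiv ℝ (fderiv ℝ f.1) x (Pi.single a 1) (Pi.single b 1) := by
    intro a b
    change fderiv ℝ (fun z => fderiv ℝ f.1 z (Pi.single b 1)) x (Pi.single a 1) = _
    rw [fderiv_clm_apply hd (differentiableAt_const _)]
    simp
  rw [key, key]
  have hs : IsSymmSndFDerivAt ℝ f.1 x :=
    ((contDiff_smoothFun f).contDiffAt).isSymmSndFDerivAt (by
      rw [minSmoothness_of_isRCLikeNormedField]; exact WithTop.coe_le_coe.mpr (le_top : (2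
        : ℕ∞) ≤ ⊤))
  exact hs _ _

theorem commute_partialD (i j : Fin n) : Commute (partialD i) (partialD j) := by
  apply LinearMap.ext
  intro f
  exact partialD_comm i j f

theorem partialMulti_zero : partialMulti (0 : Fin n →₀ ℕ) = 1 := by
  simp [partialMulti]

theorem partialMulti_add_single (s : Fin n →₀ ℕ) (k : Fin n) :
    partialMulti (s + Finsupp.single k 1) = partialMulti s * partialD k := by
  -- The product is ordered, so the induction runs over an arbitrary list without repetitions; the
  -- extra factor is moved to the right end by commutation.
  have key : ∀ l : List (Fin n), l.Nodup →
      (l.map fun i => partialD i ^ (s + Finsupp.single k 1 : Fin n →₀ ℕ) i).prod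
        = (l.map fun i => partialD i ^ s i).prod * (if k ∈ l then partialD k else 1) := by
    intro l
    induction l with
    | nil => simp
    | cons a l ih =>
      intro hl
      rw [List.nodup_cons] at hl
      rw [List.map_cons, List.prod_cons, ih hl.2, List.map_cons, List.prod_cons]
      by_cases hk : k = a
      · subst hk
        have hc : Commute ((l.map fun i => partialD i ^ s i).prod) (partialD k) := by
          refine (Commute.list_prod_left _ _ fun y hy => ?_)
          obtain ⟨i, -, rfl⟩ := List.mem_map.mp hy
          exact (commute_partialD i k).pow_left _
        simp only [hl.1, if_false, mul_one, List.mem_cons, true_or, if_true, Finsupp.add_apply,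
          Finsupp.single_eq_same, pow_succ]
        rw [mul_assoc, mul_assoc, hc.eq]
      · simp [hk, mul_assoc]
  have := key (List.finRange n) (List.nodup_finRange n)
  simpa [partialMulti] using this

/-! ### Operators on local symbols -/

theorem coeff_symbolDx (i : Fin n) (P : LocalSymbol n) (s : Fin n →₀ ℕ) :
    (symbolDx i P).coeff s = partialD i (P.coeff s) := by
  classical
  change MvPolynomial.coeff s (∑ s ∈ P.support, MvPolynomial.monomial s (partialD i (P.coeff s)))
      = _
  simp only [MvPolynomial.coeff_sum, MvPolynomial.coeff_monomial,
      Finset.sum_ite_eq', MvPolynomial.mem_support_iff]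
  split_ifs with h
  · rfl
  · simp only [ne_eq, not_not] at h
    simp [h]

theorem symbolDx_C (i : Fin n) (f : SmoothFun n) : symbolDx i (C f) = C (partialD i f) := by
  classical
  ext1 s
  rw [coeff_symbolDx, coeff_C, coeff_C]
  split_ifs <;> simp

theorem symbolDx_C_mul (i : Fin n) (f : SmoothFun n) (P : LocalSymbol n) :
    symbolDx i (C f * P) = C (partialD i f) * P + C f * symbolDx i P := by
  ext1 s
  simp [coeff_symbolDx, coeff_C_mul, partialD_mul]

theorem symbolDx_mul_X (i k : Fin n) (P : LocalSymbol n) :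
    symbolDx i (P * X k) = symbolDx i P * X k := by
  classical
  ext1 s
  simp only [coeff_symbolDx, coeff_mul_X']
  split_ifs
  · rfl
  · simp

theorem symbolDxi_apply (i : Fin n) (P : LocalSymbol n) : symbolDxi i P = pderiv i P := rfl

theorem symbolDxi_C_mul (i : Fin n) (f : SmoothFun n) (P : LocalSymbol n) :
    symbolDxi i (C f * P) = C f * symbolDxi i P := by
  simp [symbolDxi_apply, Derivation.leibniz]

theorem symbolDxi_C (i : Fin n) (f : SmoothFun n) : symbolDxi i (C f) = 0 := by
  simp [symbolDxi_apply]

theorem symbolDxi_mul_X (i k : Fin n) (P : LocalSymbol n) :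
    symbolDxi i (P * X k) = symbolDxi i P * X k + if i = k then P else 0 := by
  simp only [symbolDxi_apply, Derivation.leibniz, pderiv_X, smul_eq_mul, Pi.single_apply]
  split_ifs with h1 h2 h2
  · ring
  · exact absurd h1.symm h2
  · exact absurd h2.symm h1
  · ring

theorem coeff_symbolDxi (i : Fin n) (P : LocalSymbol n) (s : Fin n →₀ ℕ) :
    (symbolDxi i P).coeff s = ((s i + 1 : ℕ) : ℂ) • P.coeff (s + Finsupp.single i 1) := by
  rw [symbolDxi_apply, coeff_pderiv]
  rw [Nat.cast_smul_eq_nsmul, nsmul_eq_mul, mul_comm]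
  push_cast
  rfl

theorem symbolDx_comm (i j : Fin n) (P : LocalSymbol n) :
    symbolDx i (symbolDx j P) = symbolDx j (symbolDx i P) := by
  ext1 s
  simp [coeff_symbolDx, partialD_comm]

theorem symbolDx_symbolDxi (i j : Fin n) (P : LocalSymbol n) :
    symbolDx i (symbolDxi j P) = symbolDxi j (symbolDx i P) := by
  ext1 s
  simp only [coeff_symbolDx, coeff_symbolDxi, map_smul]

theorem symbolDxi_comm (i j : Fin n) (P : LocalSymbol n) :
    symbolDxi i (symbolDxi j P) = symbolDxi j (symbolDxi i P) := by
  classical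
  ext1 s
  simp only [coeff_symbolDxi, smul_smul]
  by_cases h : i = j
  · subst h; rfl
  · have h' : j ≠ i := fun e => h e.symm
    simp [h, h', mul_comm, add_right_comm]

theorem divOp_apply (P : LocalSymbol n) : divOp n P = ∑ i, symbolDx i (symbolDxi i P) := by
  simp [divOp]

theorem eulerOp_apply (P : LocalSymbol n) : eulerOp n P = ∑ i, X i * symbolDxi i P := by
  simp [eulerOp, mulSymbol]

theorem divOp_C (f : SmoothFun n) : divOp n (C f) = 0 := by
  simp [divOp_apply, symbolDxi_C]

/-- This is the commutator [D, ξ_k] = ∂/∂xᵏ, which drives the inductions on symbols built from `C`,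
sums and right factors `X k`. -/
theorem divOp_mul_X (k : Fin n) (P : LocalSymbol n) :
    divOp n (P * X k) = divOp n P * X k + symbolDx k P := by
  have h : ∀ i : Fin n, symbolDx i (if i = k then P else 0) = if i = k then symbolDx i P else 0 :=
    fun i => by split_ifs <;> simp
  simp [divOp_apply, symbolDxi_mul_X, map_add, Finset.sum_add_distrib, symbolDx_mul_X,
    Finset.sum_mul, h]

theorem divOp_C_mul (f : SmoothFun n) (P : LocalSymbol n) :
    divOp n (C f * P) = C f * divOp n P + ∑ i, C (partialD i f) * symbolDxi i P := by
  simp [divOp_apply, symbolDxi_C_mul, symbolDx_C_mul, Finset.sum_add_distrib, Finset.mul_sum,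
    add_comm]

theorem eulerOp_C (f : SmoothFun n) : eulerOp n (C f) = 0 := by
  simp [eulerOp_apply, symbolDxi_C]

theorem eulerOp_mul_X (k : Fin n) (P : LocalSymbol n) :
    eulerOp n (P * X k) = eulerOp n P * X k + P * X k := by
  simp [eulerOp_apply, symbolDxi_mul_X, mul_add, Finset.sum_add_distrib, Finset.sum_mul,
    mul_assoc, mul_comm (X k) P]

/-! ### Functions of the Euler operator -/

/-- The operator that multiplies the part of degree `e` of a symbol by `φ e`. -/
def diagOp (n : ℕ) (φ : ℕ → ℂ) : Module.End ℂ (LocalSymbol n) where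
  toFun P := ∑ s ∈ P.support, monomial s (φ s.degree • P.coeff s)
  map_add' P Q := by
    classical
    ext1 s
    simp only [coeff_add, coeff_sum, coeff_monomial, Finset.sum_ite_eq', mem_support_iff]
    split_ifs <;> simp_all [← smul_add]
  map_smul' c P := by
    classical
    ext1 s
    simp only [coeff_smul, coeff_sum, coeff_monomial, Finset.sum_ite_eq', mem_support_iff,
      RingHom.id_apply]
    split_ifs <;> simp_all [smul_comm c]

theorem coeff_diagOp (φ : ℕ → ℂ) (P : LocalSymbol n) (s : Fin n →₀ ℕ) :
    (diagOp n φ P).coeff s = φ s.degree • P.coeff s := by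
  classical
  change MvPolynomial.coeff s (∑ s ∈ P.support, monomial s (φ s.degree • P.coeff s)) = _
  simp only [coeff_sum, coeff_monomial, Finset.sum_ite_eq', mem_support_iff]
  split_ifs with h
  · rfl
  · simp only [ne_eq, not_not] at h
    simp [h]

/-- `diagOp` as a homomorphism of algebras. -/
def diagHom (n : ℕ) : (ℕ → ℂ) →ₐ[ℂ] Module.End ℂ (LocalSymbol n) where
  toFun := diagOp n
  map_one' := by
    apply LinearMap.ext
    intro P
    ext1 s
    simp [coeff_diagOp]
  map_mul' φ ψ := by
    apply LinearMap.ext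
    intro P
    ext1 s
    simp [coeff_diagOp, mul_smul]
  map_zero' := by
    apply LinearMap.ext
    intro P
    ext1 s
    simp [coeff_diagOp]
  map_add' φ ψ := by
    apply LinearMap.ext
    intro P
    ext1 s
    simp [coeff_diagOp, add_smul]
  commutes' c := by
    apply LinearMap.ext
    intro P
    ext1 s
    simp [coeff_diagOp, Module.algebraMap_end_apply]

theorem diagHom_apply (φ : ℕ → ℂ) : diagHom n φ = diagOp n φ := rfl

theorem diagOp_C (φ : ℕ → ℂ) (f : SmoothFun n) : diagOp n φ (C f) = φ 0 • C f := by
  classical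
  ext1 s
  rw [coeff_diagOp, coeff_smul, coeff_C]
  split_ifs with h
  · subst h; simp
  · simp

theorem diagOp_mul_X (φ : ℕ → ℂ) (k : Fin n) (P : LocalSymbol n) :
    diagOp n φ (P * X k) = diagOp n (fun e => φ (e + 1)) P * X k := by
  classical
  ext1 s
  rw [coeff_diagOp, coeff_mul_X', coeff_mul_X']
  split_ifs with h
  · rw [coeff_diagOp]
    have : s.degree = (s - Finsupp.single k 1).degree + 1 := by
      have h2 : s - Finsupp.single k 1 + Finsupp.single k 1 = s := by
        apply tsub_add_cancel_of_le
        rw [Finsupp.single_le_iff]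
        exact Nat.one_le_iff_ne_zero.mpr (Finsupp.mem_support_iff.mp h)
      conv_lhs => rw [← h2]
      simp
    rw [this]
  · simp

theorem diagOp_C_mul (φ : ℕ → ℂ) (f : SmoothFun n) (P : LocalSymbol n) :
    diagOp n φ (C f * P) = C f * diagOp n φ P := by
  ext1 s
  rw [coeff_diagOp, coeff_C_mul, coeff_C_mul, coeff_diagOp, mul_smul_comm]

theorem diagOp_symbolDx (φ : ℕ → ℂ) (i : Fin n) (P : LocalSymbol n) :
    diagOp n φ (symbolDx i P) = symbolDx i (diagOp n φ P) := by
  ext1 s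
  simp only [coeff_diagOp, coeff_symbolDx, map_smul]

/-- What has degree e after a fibre derivative had degree e + 1 before it. This shift is the source
of q_m(e+1) in `quantCoeff_succ`. -/
theorem symbolDxi_diagOp (φ : ℕ → ℂ) (i : Fin n) (P : LocalSymbol n) :
    symbolDxi i (diagOp n φ P) = diagOp n (fun e => φ (e + 1)) (symbolDxi i P) := by
  ext1 s
  simp [coeff_diagOp, coeff_symbolDxi, smul_comm (φ _)]

theorem divOp_diagOp (φ : ℕ → ℂ) (P : LocalSymbol n) :
    divOp n (diagOp n φ P) = diagOp n (fun e => φ (e + 1)) (divOp n P) := by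
  simp [divOp_apply, symbolDxi_diagOp, diagOp_symbolDx]

theorem eulerOp_eq_diagOp : eulerOp n = diagOp n (fun e => (e : ℂ)) := by
  apply LinearMap.ext
  intro P
  induction P using MvPolynomial.induction_on with
  | C a => simp [eulerOp_C, diagOp_C]
  | add p q hp hq => simp [hp, hq]
  | mul_X p k hp =>
    rw [eulerOp_mul_X, diagOp_mul_X, hp, ← add_mul]
    congr 1
    ext1 s
    simp [coeff_diagOp, add_smul]

/-! ### Operators attached to symbols -/

theorem applyOp_C (c : ℂ) (a f : SmoothFun n) : applyOp c (C a) f = a * f := by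
  classical
  rw [applyOp_eq_sum c (C a) f {0} (by
    intro s hs
    rw [mem_support_iff, coeff_C] at hs
    simp only [Finset.mem_singleton]
    by_contra h
    exact hs (if_neg (fun e => h e.symm)))]
  simp [partialMulti_zero]

/-- All derivatives act before any coefficient, so the last factor ξ_k can be spent on `f` at once.
With `applyOp_C` this turns identities for `applyOp` into inductions on the symbol with `f` general.
-/
theorem applyOp_mul_X (c : ℂ) (P : LocalSymbol n) (k : Fin n) (f : SmoothFun n) :
    applyOp c (P * X k) f = c • applyOp c P (partialD k f) := by
  classical
  rw [applyOp_eq_sum c (P * X k) f (P.support.map (addRightEmbedding (Finsupp.single k 1)))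
    (by rw [support_mul_X]), Finset.sum_map, applyOp, Finset.smul_sum]
  refine Finset.sum_congr rfl fun s _ => ?_
  simp only [addRightEmbedding_apply, coeff_mul_X, partialMulti_add_single, map_add,
    Finsupp.degree_single, pow_succ, smul_smul, mul_comm c]
  rfl

theorem applyOp_add_right (c : ℂ) (P : LocalSymbol n) (f g : SmoothFun n) :
    applyOp c P (f + g) = applyOp c P f + applyOp c P g := by
  simp [applyOp, mul_add, Finset.sum_add_distrib]

theorem applyOp_smul_right (c a : ℂ) (P : LocalSymbol n) (f : SmoothFun n) :
    applyOp c P (a • f) = a • applyOp c P f := by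
  simp [applyOp, Finset.smul_sum, smul_comm a]

/-- `applyOp` as a bilinear map. -/
def applyOpₗ (n : ℕ) (c : ℂ) : LocalSymbol n →ₗ[ℂ] SmoothFun n →ₗ[ℂ] SmoothFun n :=
  LinearMap.mk₂ ℂ (applyOp c) (applyOp_add c) (fun a P f => applyOp_smul c a P f)
    (applyOp_add_right c) (fun a P f => applyOp_smul_right c a P f)

theorem applyOpₗ_apply (c : ℂ) (P : LocalSymbol n) (f : SmoothFun n) :
    applyOpₗ n c P f = applyOp c P f := rfl

theorem applyOp_C_mul (c : ℂ) (a : SmoothFun n) (P : LocalSymbol n) (f : SmoothFun n) :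
    applyOp c (C a * P) f = a * applyOp c P f := by
  induction P using MvPolynomial.induction_on generalizing f with
  | C b => rw [← C_mul, applyOp_C, applyOp_C, mul_assoc]
  | add p q hp hq => rw [mul_add, applyOp_add, hp, hq, applyOp_add, mul_add]
  | mul_X p k hp => rw [← mul_assoc, applyOp_mul_X, hp, applyOp_mul_X, mul_smul_comm]

/-- Substituting c∂ for ξ is rescaling degree e by cᵉ and then substituting ∂. This passes between
normal ordering, where `c = -iħ`, and total symbols, where `c = 1`. -/
theorem applyOp_diagOp (c d : ℂ) (P : LocalSymbol n) (f : SmoothFun n) :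
    applyOp c (diagOp n (fun e => d ^ e) P) f = applyOp (d * c) P f := by
  induction P using MvPolynomial.induction_on generalizing f with
  | C b => simp [diagOp_C, applyOp_C]
  | add p q hp hq => rw [map_add, applyOp_add, hp, hq, applyOp_add]
  | mul_X p k hp =>
    have : diagOp n (fun e => d ^ (e + 1)) p = d • diagOp n (fun e => d ^ e) p := by
      ext1 s
      simp [coeff_diagOp, pow_succ', mul_smul]
    rw [diagOp_mul_X, this, applyOp_mul_X, applyOp_smul, hp, applyOp_mul_X, smul_smul, mul_comm c]

theorem LocalSymbol.sub_mul (P Q R : LocalSymbol n) : (P - Q) * R = P * R - Q * R := by ring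

theorem C_smul_smoothFun (c : ℂ) (f : SmoothFun n) : (C (c • f) : LocalSymbol n) = c • C f := by
  classical
  ext1 s
  rw [coeff_smul, coeff_C, coeff_C]
  split_ifs <;> simp

/-! ### Projective vector fields -/

/-- A real coordinate as a smooth function. -/
def coordFun (i : Fin n) : SmoothFun n :=
  ⟨fun x => ((x i : ℝ) : ℂ), by
    have h : ContDiff ℝ ∞ (fun x : Fin n → ℝ => ((x i : ℝ) : ℂ)) :=
      Complex.ofRealCLM.contDiff.comp (contDiff_apply ℝ ℝ i)
    exact h⟩

theorem coordFun_apply (i : Fin n) (x : Fin n → ℝ) : (coordFun i).1 x = (x i : ℂ) := rfl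

theorem partialD_coordFun (i j : Fin n) :
    partialD i (coordFun j) = if i = j then 1 else 0 := by
  apply Subtype.ext
  funext x
  have h : HasFDerivAt (coordFun j).1
      (Complex.ofRealCLM.comp (ContinuousLinearMap.proj (R := ℝ) (φ := fun _ : Fin n => ℝ) j)) x :=
    (Complex.ofRealCLM.comp (ContinuousLinearMap.proj (R := ℝ) (φ := fun _ : Fin n =>
        ℝ) j)).hasFDerivAt
  rw [partialD_apply, h.fderiv]
  by_cases hij : i = j
  · subst hij; simp
  · have : j ≠ i := fun e => hij e.symm
    simp [hij, this]

/-- The first component `Y₀₀ + ∑ Y₀ⱼ xʲ` of `Y (1, x)`. -/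
def headFun (Y : Matrix (Fin (n + 1)) (Fin (n + 1)) ℝ) : SmoothFun n :=
  algebraMap ℂ _ (Y 0 0 : ℂ) + ∑ j : Fin n, (Y 0 j.succ : ℂ) • coordFun j

theorem projField_eq (Y : Matrix (Fin (n + 1)) (Fin (n + 1)) ℝ) (i : Fin n) :
    projField Y i = algebraMap ℂ _ (Y i.succ 0 : ℂ) + ∑ j : Fin n, (Y i.succ j.succ : ℂ)
        • coordFun j
      - coordFun i * headFun Y := by
  apply Subtype.ext
  funext x
  simp [projField, headFun, coordFun, Algebra.algebraMap_eq_smul_one, -Complex.coe_smul]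

theorem partialD_headFun (Y : Matrix (Fin (n + 1)) (Fin (n + 1)) ℝ) (j : Fin n) :
    partialD j (headFun Y) = algebraMap ℂ _ (Y 0 j.succ : ℂ) := by
  rw [headFun, map_add, partialD_algebraMap]
  simp [partialD_coordFun, Algebra.algebraMap_eq_smul_one, -Complex.coe_smul]

theorem partialD_projField (Y : Matrix (Fin (n + 1)) (Fin (n + 1)) ℝ) (i j : Fin n) :
    partialD j (projField Y i) = algebraMap ℂ _ (Y i.succ j.succ : ℂ)
      - (if j = i then headFun Y else 0) - (Y 0 j.succ : ℂ) • coordFun i := by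
  rw [projField_eq, map_sub, partialD_mul, partialD_headFun, map_add, partialD_algebraMap,
    partialD_coordFun]
  simp [partialD_coordFun, Algebra.algebraMap_eq_smul_one, sub_sub, -Complex.coe_smul]

/-- The fields are quadratic, so their second derivatives are constant, and only the entries `Y₀ⱼ`
contribute. These constants cause every failure of equivariance below. -/
theorem partialD_partialD_projField (Y : Matrix (Fin (n + 1)) (Fin (n + 1)) ℝ) (i j b : Fin n) :
    partialD b (partialD j (projField Y i)) = algebraMap ℂ _
      (-((if j = i then (Y 0 b.succ : ℂ) else 0) + (if b = i then (Y 0 j.succ : ℂ) else 0))) := by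
  rw [partialD_projField, map_sub, map_sub, partialD_algebraMap, map_smul, partialD_coordFun]
  split_ifs <;> simp [partialD_headFun, Algebra.algebraMap_eq_smul_one, sub_eq_add_neg,
    add_smul, add_comm, -Complex.coe_smul]

theorem partialD_divField (Y : Matrix (Fin (n + 1)) (Fin (n + 1)) ℝ) (k : Fin n) :
    partialD k (divField (projField Y)) = algebraMap ℂ _ (-(((n : ℂ) + 1) * Y 0 k.succ)) := by
  simp only [divField, map_sum, partialD_partialD_projField]
  rw [← map_sum]
  congr 1
  simp [Finset.sum_add_distrib]
  ring

/-! ### Lie derivatives of symbols -/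

/-- The contraction `∑ⱼ Y₀ⱼ ∂/∂ξⱼ`. -/
def dualOp (Y : Matrix (Fin (n + 1)) (Fin (n + 1)) ℝ) : Module.End ℂ (LocalSymbol n) :=
  ∑ j : Fin n, (Y 0 j.succ : ℂ) • symbolDxi j

theorem dualOp_apply (Y : Matrix (Fin (n + 1)) (Fin (n + 1)) ℝ) (P : LocalSymbol n) :
    dualOp Y P = ∑ j : Fin n, (Y 0 j.succ : ℂ) • symbolDxi j P := by
  simp [dualOp]

theorem dualOp_C (Y : Matrix (Fin (n + 1)) (Fin (n + 1)) ℝ) (f : SmoothFun n) :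
    dualOp Y (C f) = 0 := by
  simp [dualOp_apply, symbolDxi_C]

theorem dualOp_mul_X (Y : Matrix (Fin (n + 1)) (Fin (n + 1)) ℝ) (P : LocalSymbol n) (k : Fin n) :
    dualOp Y (P * X k) = dualOp Y P * X k + (Y 0 k.succ : ℂ) • P := by
  simp [dualOp_apply, symbolDxi_mul_X, Finset.sum_add_distrib, Finset.sum_mul, smul_add]

theorem dualOp_diagOp (Y : Matrix (Fin (n + 1)) (Fin (n + 1)) ℝ) (φ : ℕ → ℂ) (P : LocalSymbol n) :
    dualOp Y (diagOp n φ P) = diagOp n (fun e => φ (e + 1)) (dualOp Y P) := by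
  simp [dualOp_apply, symbolDxi_diagOp]

theorem dualOp_divOp (Y : Matrix (Fin (n + 1)) (Fin (n + 1)) ℝ) (P : LocalSymbol n) :
    dualOp Y (divOp n P) = divOp n (dualOp Y P) := by
  simp only [dualOp_apply, divOp_apply, map_sum, map_smul]
  rw [Finset.sum_comm]
  simp only [Finset.smul_sum]
  refine Finset.sum_congr rfl fun i _ => Finset.sum_congr rfl fun j _ => ?_
  rw [← symbolDx_symbolDxi, symbolDxi_comm]

theorem lieSymb_add (del : ℂ) (v : Fin n → SmoothFun n) (P Q : LocalSymbol n) :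
    lieSymb del v (P + Q) = lieSymb del v P + lieSymb del v Q := by
  simp only [lieSymb, map_add, mul_add, Finset.sum_add_distrib, smul_add]
  abel

theorem lieSymb_smul (del : ℂ) (v : Fin n → SmoothFun n) (c : ℂ) (P : LocalSymbol n) :
    lieSymb del v (c • P) = c • lieSymb del v P := by
  simp only [lieSymb, map_smul, mul_smul_comm, Finset.smul_sum, smul_add, smul_sub, smul_comm c del]

/-- `lieSymb` as a linear operator on symbols. -/
def lieSymbₗ (del : ℂ) (v : Fin n → SmoothFun n) : Module.End ℂ (LocalSymbol n) where
  toFun := lieSymb del v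
  map_add' := lieSymb_add del v
  map_smul' := lieSymb_smul del v

theorem lieSymbₗ_apply (del : ℂ) (v : Fin n → SmoothFun n) (P : LocalSymbol n) :
    lieSymbₗ del v P = lieSymb del v P := rfl

theorem lieSymb_C (del : ℂ) (v : Fin n → SmoothFun n) (a : SmoothFun n) :
    lieSymb del v (C a) = C (∑ i, v i * partialD i a + del • (divField v * a)) := by
  simp only [lieSymb, symbolDx_C, symbolDxi_C, C_mul, map_sum, map_add, C_smul_smoothFun, mul_zero,
    Finset.sum_const_zero]
  module

theorem lieSymb_mul_X (del : ℂ) (v : Fin n → SmoothFun n) (P : LocalSymbol n) (k : Fin n) :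
    lieSymb del v (P * X k)
      = lieSymb del v P * X k - ∑ i, C (partialD k (v i)) * P * X i := by
  simp only [lieSymb, symbolDx_mul_X, symbolDxi_mul_X, mul_add, Finset.sum_add_distrib, add_mul,
    LocalSymbol.sub_mul, Finset.sum_mul, smul_mul_assoc, mul_assoc]
  simp only [mul_ite, mul_zero, Finset.sum_ite_eq', Finset.mem_univ, if_true]
  simp only [mul_comm (X _) P]
  abel

/-- A Lie derivative of symbols preserves the degree in ξ, whatever the field. -/
theorem lieSymb_diagOp (del : ℂ) (v : Fin n → SmoothFun n) (φ : ℕ → ℂ) (P : LocalSymbol n) :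
    lieSymb del v (diagOp n φ P) = diagOp n φ (lieSymb del v P) := by
  induction P using MvPolynomial.induction_on generalizing φ with
  | C a => rw [diagOp_C, lieSymb_smul, lieSymb_C, diagOp_C]
  | add p q hp hq => simp only [map_add, lieSymb_add, hp, hq]
  | mul_X p k hp =>
    rw [diagOp_mul_X, lieSymb_mul_X, lieSymb_mul_X, hp, map_sub, diagOp_mul_X, map_sum]
    congr 1
    refine Finset.sum_congr rfl fun i _ => ?_
    rw [diagOp_mul_X, diagOp_C_mul]

theorem symbolDx_lieSymb (del : ℂ) (v : Fin n → SmoothFun n) (P : LocalSymbol n) (k : Fin n) :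
    symbolDx k (lieSymb del v P) = lieSymb del v (symbolDx k P)
      + ∑ i, C (partialD k (v i)) * symbolDx i P
      - ∑ i, ∑ j, C (partialD k (partialD j (v i))) * X i * symbolDxi j P
      + del • (C (partialD k (divField v)) * P) := by
  have h : ∀ (a : SmoothFun n) (i : Fin n) (Q : LocalSymbol n), symbolDx k (C a * X i * Q)
      = C (partialD k a) * X i * Q + C a * X i * symbolDx k Q := by
    intro a i Q
    rw [mul_assoc, symbolDx_C_mul, mul_comm (X i), symbolDx_mul_X]
    ring
  simp only [lieSymb, map_add, map_sub, map_sum, map_smul, symbolDx_C_mul, h,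
    Finset.sum_add_distrib, smul_add, symbolDx_comm k, symbolDx_symbolDxi k]
  abel

theorem C_algebraMap_mul (c : ℂ) (P : LocalSymbol n) :
    C (algebraMap ℂ (SmoothFun n) c) * P = c • P := by
  rw [← smul_eq_C_mul, algebraMap_smul]

/-- Of the two Kronecker deltas in the second derivative of the field, one contracts to the Euler
operator and the other to `dualOp Y`. The sum occurs both for D and for normal ordering. -/
theorem sum_partialD_partialD_projField (Y : Matrix (Fin (n + 1)) (Fin (n + 1)) ℝ) (k : Fin n)
    (P : LocalSymbol n) :
    ∑ i, ∑ j, C (partialD k (partialD j (projField Y i))) * X i * symbolDxi j P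
      = -(dualOp Y P * X k + (Y 0 k.succ : ℂ) • eulerOp n P) := by
  have h : ∀ i j : Fin n, C (partialD k (partialD j (projField Y i))) * X i * symbolDxi j P
      = (-1 : ℂ) • ((if j = i then (Y 0 k.succ : ℂ) • (X i * symbolDxi j P) else 0)
        + (if k = i then (Y 0 j.succ : ℂ) • (symbolDxi j P * X i) else 0)) := by
    intro i j
    rw [partialD_partialD_projField, mul_assoc, C_algebraMap_mul, mul_comm (symbolDxi j P)]
    split_ifs <;> module
  simp only [h, ← Finset.smul_sum, Finset.sum_add_distrib]
  rw [dualOp_apply, eulerOp_apply, Finset.sum_mul, Finset.smul_sum]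
  simp only [Finset.sum_ite_eq', Finset.mem_univ, if_true]
  rw [Finset.sum_comm (γ := Fin n)]
  simp only [Finset.sum_ite_eq, Finset.mem_univ, if_true, smul_mul_assoc]
  module

/-- Only second derivatives of the field survive in the commutator. Contracted with two fibre
derivatives they give 2𝓔, their trace gives n + 1, and the density weight gives -(n+1)δ, each times
`dualOp Y`. -/
theorem divOp_lieSymb (del : ℂ) (Y : Matrix (Fin (n + 1)) (Fin (n + 1)) ℝ) (P : LocalSymbol n) :
    divOp n (lieSymb del (projField Y) P) = lieSymb del (projField Y) (divOp n P)
      + diagOp n (fun e => 2 * e + (n + 1) * (1 - del)) (dualOp Y P) := by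
  induction P using MvPolynomial.induction_on with
  | C a => 
    rw [lieSymb_C, divOp_C, divOp_C, dualOp_C]
    simp [lieSymb]
  | add p q hp hq => simp only [map_add, lieSymb_add, hp, hq]; abel
  | mul_X p k hp =>
    have h1 : divOp n (∑ i, C (partialD k (projField Y i)) * p * X i)
        = ∑ i, C (partialD k (projField Y i)) * divOp n p * X i
          + ∑ i, ∑ j, C (partialD k (partialD j (projField Y i))) * X i * symbolDxi j p
          + ∑ i, C (partialD k (projField Y i)) * symbolDx i p
          + ∑ i, C (partialD k (partialD i (projField Y i))) * p := by
      rw [map_sum, ← Finset.sum_add_distrib, ← Finset.sum_add_distrib, ← Finset.sum_add_distrib]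
      refine Finset.sum_congr rfl fun i _ => ?_
      rw [divOp_mul_X, divOp_C_mul, symbolDx_C_mul, partialD_comm k i, add_mul, Finset.sum_mul]
      have : ∀ j, C (partialD j (partialD k (projField Y i))) * symbolDxi j p * X i
          = C (partialD k (partialD j (projField Y i))) * X i * symbolDxi j p := by
        intro j
        rw [partialD_comm k j]
        ring
      simp only [this]
      abel
    have h2 : ∑ i, C (partialD k (partialD i (projField Y i))) * p
        = (-(((n : ℂ) + 1) * Y 0 k.succ)) • p := by
      rw [← Finset.sum_mul, ← map_sum C, ← map_sum (partialD k)]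
      change C (partialD k (divField (projField Y))) * p = _
      rw [partialD_divField, C_algebraMap_mul]
    have h3 : diagOp n (fun e => 2 * ((e + 1 : ℕ) : ℂ) + (n + 1) * (1 - del)) (dualOp Y p)
        = diagOp n (fun e => 2 * e + (n + 1) * (1 - del)) (dualOp Y p) + (2 : ℂ) • dualOp Y p := by
      ext1 s
      simp only [coeff_diagOp, coeff_add, coeff_smul, ← add_smul]
      congr 1
      push_cast
      ring
    have h4 : diagOp n (fun e => 2 * (e : ℂ) + (n + 1) * (1 - del)) p
        = (2 : ℂ) • eulerOp n p + (((n : ℂ) + 1) * (1 - del)) • p := by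
      ext1 s
      rw [eulerOp_eq_diagOp]
      simp only [coeff_diagOp, coeff_add, coeff_smul, smul_smul, ← add_smul]
    rw [lieSymb_mul_X, map_sub, divOp_mul_X, hp, divOp_mul_X, lieSymb_add, lieSymb_mul_X,
      dualOp_mul_X, map_add, diagOp_mul_X, symbolDx_lieSymb, h1, h2, h3, map_smul, h4,
      sum_partialD_partialD_projField, partialD_divField, C_algebraMap_mul, smul_smul]
    simp only [add_mul, smul_mul_assoc]
    module

/-! ### Commutation with normal ordering -/

/-- The derivatives of `u` are constants, so Leibniz's rule stops at first order. It is applied to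
the first derivatives of a quadratic field. -/
theorem applyOp_mul_affine (c : ℂ) (u : SmoothFun n) (w : Fin n → ℂ)
    (hu : ∀ i, partialD i u = algebraMap ℂ _ (w i)) (P : LocalSymbol n) (f : SmoothFun n) :
    applyOp c P (u * f) = applyOp c (C u * P + c • ∑ i, w i • symbolDxi i P) f := by
  induction P using MvPolynomial.induction_on generalizing f with
  | C a =>
    simp only [symbolDxi_C, smul_zero, Finset.sum_const_zero, add_zero]
    rw [applyOp_C_mul, applyOp_C, applyOp_C]
    ring
  | add p q hp hq =>
    rw [applyOp_add, hp, hq, ← applyOp_add]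
    congr 1
    simp only [map_add, smul_add, Finset.sum_add_distrib, mul_add]
    abel
  | mul_X p k hp =>
    have h1 : ∑ i, w i • symbolDxi i (p * X k) = (∑ i, w i • symbolDxi i p) * X k + w k • p := by
      simp [symbolDxi_mul_X, Finset.sum_add_distrib, Finset.sum_mul, smul_add]
    have h2 : C u * (p * X k) + c • ((∑ i, w i • symbolDxi i p) * X k + w k • p)
      = (C u * p + c • ∑ i, w i • symbolDxi i p) * X k + (c * w k) • p := by
      rw [smul_add, add_mul, smul_mul_assoc, smul_smul]
      ring
    have h3 : algebraMap ℂ (SmoothFun n) (w k) * f = w k • f := by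
      rw [Algebra.smul_def]
    rw [applyOp_mul_X, partialD_mul, applyOp_add_right, hu, h3, applyOp_smul_right, hp, h1, h2,
      applyOp_add c _ ((c * w k) • p), applyOp_mul_X, applyOp_smul, smul_add, smul_smul, add_comm]

theorem lieDens_add (lam : ℂ) (v : Fin n → SmoothFun n) (f g : SmoothFun n) :
    lieDens lam v (f + g) = lieDens lam v f + lieDens lam v g := by
  simp only [lieDens, map_add, mul_add, Finset.sum_add_distrib, smul_add]
  abel

theorem lieDens_smul (lam : ℂ) (v : Fin n → SmoothFun n) (c : ℂ) (f : SmoothFun n) :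
    lieDens lam v (c • f) = c • lieDens lam v f := by
  simp only [lieDens, map_smul, mul_smul_comm, Finset.smul_sum, smul_add, smul_comm c lam]

theorem partialD_lieDens (lam : ℂ) (Y : Matrix (Fin (n + 1)) (Fin (n + 1)) ℝ) (f : SmoothFun n)
    (k : Fin n) :
    partialD k (lieDens lam (projField Y) f) = lieDens lam (projField Y) (partialD k f)
      + ∑ i, partialD k (projField Y i) * partialD i f - (lam * ((n + 1) * Y 0 k.succ)) • f := by
  have h : algebraMap ℂ (SmoothFun n) (-(((n : ℂ) + 1) * Y 0 k.succ)) * f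
      = (-(((n : ℂ) + 1) * Y 0 k.succ)) • f := by
    rw [Algebra.smul_def]
  simp only [lieDens, map_add, map_sum, map_smul, partialD_mul, Finset.sum_add_distrib,
    partialD_divField, h, partialD_comm k]
  module

/-- The Lie derivative along a projective vector field of the normal ordered operator of a
symbol. -/
theorem lieDens_applyOp (c lam mu : ℂ) (Y : Matrix (Fin (n + 1)) (Fin (n + 1)) ℝ)
    (P : LocalSymbol n) (f : SmoothFun n) :
    lieDens mu (projField Y) (applyOp c P f) = applyOp c P (lieDens lam (projField Y) f)
      + applyOp c (lieSymb (mu - lam) (projField Y) P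
        + c • diagOp n (fun e => e + (n + 1) * lam) (dualOp Y P)) f := by
  induction P using MvPolynomial.induction_on generalizing f with
  | C a =>
    rw [dualOp_C, map_zero, smul_zero, add_zero, lieSymb_C, applyOp_C, applyOp_C, applyOp_C]
    simp only [lieDens, partialD_mul, mul_add, Finset.sum_add_distrib, add_mul, Finset.sum_mul,
      Finset.mul_sum, mul_smul_comm, smul_mul_assoc]
    have h1 : ∀ i, projField Y i * (a * partialD i f) = a * (projField Y i * partialD i f) :=
      fun i => by ring
    have h2 : a * (divField (projField Y) * f) = divField (projField Y) * (a * f) := by ring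
    simp only [h1, h2, mul_assoc]
    module
  | add p q hp hq =>
    rw [applyOp_add, lieDens_add, hp, hq]
    simp only [map_add, lieSymb_add, smul_add, applyOp_add]
    abel
  | mul_X p k hp =>
    -- Commuting ∂ₖ with the Lie derivative leaves ∂ₖvⁱ ∂ᵢf under `p`. Bringing the affine factor
    -- ∂ₖvⁱ to the left costs exactly the sum evaluated by `sum_partialD_partialD_projField`.
    have h1 : c • ∑ i, applyOp c p (partialD k (projField Y i) * partialD i f)
        = applyOp c (∑ i, C (partialD k (projField Y i)) * p * X i
          - c • (dualOp Y p * X k + (Y 0 k.succ : ℂ) • eulerOp n p)) f := by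
      have h0 : ∀ A B : LocalSymbol n, A - c • B = A + c • (-B) := fun A B => by module
      rw [h0, ← sum_partialD_partialD_projField, applyOp_add, applyOp_smul, ← applyOpₗ_apply,
        ← applyOpₗ_apply]
      simp only [map_sum, LinearMap.sum_apply, applyOpₗ_apply, Finset.smul_sum]
      rw [← Finset.sum_add_distrib]
      refine Finset.sum_congr rfl fun i _ => ?_
      rw [applyOp_mul_affine c _ _ (fun b => partialD_partialD_projField Y i k b), applyOp_mul_X,
        applyOp_add, smul_add, applyOp_smul]
      congr 1
      rw [← Finset.smul_sum]
      congr 1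
      rw [← applyOp_mul_X, Finset.sum_mul, ← applyOpₗ_apply]
      simp only [map_sum, LinearMap.sum_apply, applyOpₗ_apply]
      refine Finset.sum_congr rfl fun j _ => ?_
      rw [partialD_comm k j, partialD_partialD_projField, mul_assoc, C_algebraMap_mul,
        smul_mul_assoc, mul_comm (X i)]
    have h3 : diagOp n (fun e => ((e + 1 : ℕ) : ℂ) + (n + 1) * lam) (dualOp Y p)
        = diagOp n (fun e => e + (n + 1) * lam) (dualOp Y p) + dualOp Y p := by
      ext1 s
      simp only [coeff_diagOp, coeff_add]
      push_cast
      module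
    have h4 : diagOp n (fun e => (e : ℂ) + (n + 1) * lam) p
        = eulerOp n p + (((n : ℂ) + 1) * lam) • p := by
      ext1 s
      rw [eulerOp_eq_diagOp]
      simp only [coeff_diagOp, coeff_add, coeff_smul, ← add_smul]
    have h5 : applyOp c p (∑ i, partialD k (projField Y i) * partialD i f)
        = ∑ i, applyOp c p (partialD k (projField Y i) * partialD i f) := by
      simp only [← applyOpₗ_apply, map_sum]
    rw [applyOp_mul_X, lieDens_smul, hp, applyOp_mul_X, partialD_lieDens, lieSymb_mul_X,
      dualOp_mul_X, map_add, diagOp_mul_X, h3, map_smul, h4]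
    have h6 : ∀ Q : LocalSymbol n, applyOpₗ n c (Q * X k) f = c • applyOpₗ n c Q (partialD k f) :=
      fun Q => applyOp_mul_X c Q k f
    simp only [← applyOpₗ_apply] at h1 h5 ⊢
    simp only [map_add, map_sub, map_smul, h5, smul_add, smul_sub, add_mul,
      LinearMap.add_apply, LinearMap.sub_apply, LinearMap.smul_apply, h6] at h1 ⊢
    rw [h1]
    module

/-! ### Symbols of bounded degree -/

/-- All monomials of `P` have degree less than `k`. -/
def DegLT (k : ℕ) (P : LocalSymbol n) : Prop := ∀ s : Fin n →₀ ℕ, k ≤ s.degree → P.coeff s = 0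

theorem DegLT.mono {k l : ℕ} (h : k ≤ l) {P : LocalSymbol n} (hP : DegLT k P) : DegLT l P :=
  fun s hs => hP s (h.trans hs)

theorem DegLT.smul {k : ℕ} {P : LocalSymbol n} (c : ℂ) (hP : DegLT k P) :
    DegLT k (c • P) := fun s hs => by rw [coeff_smul, hP s hs, smul_zero]

theorem DegLT.sub {k : ℕ} {P Q : LocalSymbol n} (hP : DegLT k P) (hQ : DegLT k Q) :
    DegLT k (P - Q) := fun s hs => by rw [coeff_sub, hP s hs, hQ s hs, sub_zero]

theorem DegLT.sum {ι : Type*} {k : ℕ} {S : Finset ι} {P : ι → LocalSymbol n}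
    (hP : ∀ i ∈ S, DegLT k (P i)) : DegLT k (∑ i ∈ S, P i) := fun s hs => by
  rw [coeff_sum]
  exact Finset.sum_eq_zero fun i hi => hP i hi s hs

theorem DegLT.diagOp {k : ℕ} {P : LocalSymbol n} (φ : ℕ → ℂ) (hP : DegLT k P) :
    DegLT k (diagOp n φ P) := fun s hs => by rw [coeff_diagOp, hP s hs, smul_zero]

theorem degLT_zero_iff {P : LocalSymbol n} : DegLT 0 P ↔ P = 0 := by
  constructor
  · intro h
    ext1 s
    rw [h s (Nat.zero_le _), coeff_zero]
  · rintro rfl s -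
    rw [coeff_zero]

theorem degLT_iff_totalDegree {k : ℕ} {P : LocalSymbol n} :
    DegLT (k + 1) P ↔ P.totalDegree ≤ k := by
  rw [totalDegree, Finset.sup_le_iff]
  refine ⟨fun h s hs => ?_, fun h s hs => ?_⟩
  · by_contra hlt
    exact mem_support_iff.mp hs (h s (by
      change k + 1 ≤ s.sum fun _ e => e
      omega))
  · by_contra hne
    have h1 := h s (mem_support_iff.mpr hne)
    have h2 : k + 1 ≤ s.sum fun _ e => e := hs
    omega

theorem degLT_totalDegree (P : LocalSymbol n) : DegLT (P.totalDegree + 1) P :=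
  degLT_iff_totalDegree.mpr le_rfl

theorem DegLT.divOp {k : ℕ} {P : LocalSymbol n} (hP : DegLT (k + 1) P) :
    DegLT k (divOp n P) := by
  intro s hs
  rw [divOp_apply, coeff_sum]
  refine Finset.sum_eq_zero fun i _ => ?_
  rw [coeff_symbolDx, coeff_symbolDxi, hP _ (by simpa using hs), smul_zero, map_zero]

theorem DegLT.divOp_pow {k m : ℕ} {P : LocalSymbol n} (hP : DegLT (k + m) P) :
    DegLT k ((ProjQuant.divOp n ^ m) P) := by
  induction m generalizing P with
  | zero => simpa using hP
  | succ m ih =>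
    rw [pow_succ, Module.End.mul_apply]
    exact ih (DegLT.divOp hP)

theorem divOp_pow_eq_zero {k m : ℕ} (hkm : k ≤ m) {P : LocalSymbol n} (hP : DegLT k P) :
    (divOp n ^ m) P = 0 :=
  degLT_zero_iff.mp (DegLT.divOp_pow (by simpa using hP.mono hkm))

/-! ### The local quantization map -/

/-- The value at `e` of the coefficient of `(-iħD)^m` in the quantization map. -/
def quantCoeff (n : ℕ) (lam del : ℂ) (m e : ℕ) : ℂ :=
  (ascPochhammer ℂ m).eval (e + (n + 1) * lam)
    / ((ascPochhammer ℂ m).eval (2 * e + (n + 1) * (1 - del) - 1 + m) * m.factorial)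

theorem quantCoeff_zero (n : ℕ) (lam del : ℂ) (e : ℕ) : quantCoeff n lam del 0 e = 1 := by
  simp [quantCoeff]

/-- The recursion that equivariance forces: the left factor comes from the defect of D^(m+1), the
right one from that of normal ordering. Its divisor 2e + (n+1)(1-δ) + m is the nonresonant number
with l = 2e + m. -/
theorem quantCoeff_succ (n : ℕ) (lam del : ℂ) (hres : ∀ l : ℕ, ((n : ℂ) + 1) * (1 - del) + l ≠ 0)
    (m e : ℕ) :
    quantCoeff n lam del (m + 1) e * ((m + 1) * (2 * e + (n + 1) * (1 - del) + m))
      = quantCoeff n lam del m (e + 1) * (e + (n + 1) * lam) := by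
  have h : (2 * (e : ℂ) + (n + 1) * (1 - del) + m) ≠ 0 := by
    have := hres (2 * e + m)
    push_cast at this
    intro h0
    apply this
    rw [← h0]
    ring
  have hm : (m : ℂ) + 1 ≠ 0 := by exact_mod_cast Nat.succ_ne_zero m
  have e1 : (2 * (e : ℂ) + (n + 1) * (1 - del) - 1 + ((m + 1 : ℕ) : ℂ))
      = 2 * (e : ℂ) + (n + 1) * (1 - del) + m := by push_cast; ring
  have e2 : (2 * ((e + 1 : ℕ) : ℂ) + (n + 1) * (1 - del) - 1 + m)
      = 2 * (e : ℂ) + (n + 1) * (1 - del) + m + 1 := by push_cast; ring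
  have e3 : (((e + 1 : ℕ) : ℂ) + (n + 1) * lam) = (e : ℂ) + (n + 1) * lam + 1 := by
    push_cast; ring
  simp only [quantCoeff, e1, e2, e3]
  rw [ascPochhammer_succ_left]
  simp only [Polynomial.eval_mul, Polynomial.eval_X, Polynomial.eval_comp, Polynomial.eval_add,
    Polynomial.eval_one, Nat.factorial_succ]
  push_cast
  generalize (ascPochhammer ℂ m).eval (2 * (e : ℂ) + (n + 1) * (1 - del) + m + 1) = A at *
  generalize (ascPochhammer ℂ m).eval ((e : ℂ) + (n + 1) * lam + 1) = B at *
  generalize (2 * (e : ℂ) + (n + 1) * (1 - del) + m) = y at *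
  have hf : (m.factorial : ℂ) ≠ 0 := by exact_mod_cast m.factorial_ne_zero
  -- The factor `A` occurs in both denominators. Were it zero, both quotients would be zero by the
  -- convention on division, so nonresonance need not be used again.
  by_cases hA : A = 0
  · simp [hA]
  · field_simp

/-- The truncated quantization map on local symbols. -/
def quantTrunc (n : ℕ) (lam del c : ℂ) (K : ℕ) : Module.End ℂ (LocalSymbol n) :=
  ∑ m ∈ Finset.range K, diagOp n (quantCoeff n lam del m) * (c • divOp n) ^ m

theorem quantTrunc_apply (lam del c : ℂ) (K : ℕ) (P : LocalSymbol n) :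
    quantTrunc n lam del c K P
      = ∑ m ∈ Finset.range K, c ^ m • diagOp n (quantCoeff n lam del m) ((divOp n ^ m) P) := by
  simp [quantTrunc, smul_pow]

theorem quantTrunc_eq (lam del c : ℂ) {k K : ℕ} (h : k ≤ K) {P : LocalSymbol n} (hP : DegLT k P) :
    quantTrunc n lam del c K P = quantTrunc n lam del c k P := by
  rw [quantTrunc_apply, quantTrunc_apply]
  symm
  refine Finset.sum_subset (Finset.range_subset_range.mpr h) fun m _ hm => ?_
  rw [divOp_pow_eq_zero (by simpa using hm) hP, map_zero, smul_zero]

/-- The map `F(A₁, A₂; B₁, B₂ | Z)` on local symbols, where `c = -iħ`. -/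
def quantSymb (n : ℕ) (lam del c : ℂ) : Module.End ℂ (LocalSymbol n) where
  toFun P := quantTrunc n lam del c (P.totalDegree + 1) P
  map_add' P Q := by
    have hP := degLT_totalDegree P
    have hQ := degLT_totalDegree Q
    have hPQ := degLT_totalDegree (P + Q)
    -- The truncation depends on the symbol, so linearity is checked at a common order, where the
    -- additional terms vanish.
    set K := max (max (P.totalDegree + 1) (Q.totalDegree + 1)) ((P + Q).totalDegree + 1)
    rw [← quantTrunc_eq lam del c (K := K) (by simp [K]) hP,
      ← quantTrunc_eq lam del c (K := K) (by simp [K]) hQ,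
      ← quantTrunc_eq lam del c (K := K) (by simp [K]) hPQ, map_add]
  map_smul' a P := by
    have hP := degLT_totalDegree P
    have hQ := degLT_totalDegree (a • P)
    set K := max (P.totalDegree + 1) ((a • P).totalDegree + 1)
    rw [← quantTrunc_eq lam del c (K := K) (by simp [K]) hP,
      ← quantTrunc_eq lam del c (K := K) (by simp [K]) hQ, map_smul, RingHom.id_apply]

theorem quantSymb_eq (lam del c : ℂ) {K : ℕ} {P : LocalSymbol n} (hP : DegLT K P) :
    quantSymb n lam del c P = quantTrunc n lam del c K P := by
  change quantTrunc n lam del c (P.totalDegree + 1) P = _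
  rw [← quantTrunc_eq lam del c (le_max_left (P.totalDegree + 1) K) (degLT_totalDegree P),
    quantTrunc_eq lam del c (le_max_right (P.totalDegree + 1) K) hP]

/-- The term m = 0 is P because q₀ = 1, and every D lowers the degree. This unipotence gives the
normalization, the injectivity and the descent on the order in the proof of surjectivity. -/
theorem degLT_quantSymb_sub (lam del c : ℂ) {k : ℕ} {P : LocalSymbol n} (hP : DegLT (k + 1) P) :
    DegLT k (quantSymb n lam del c P - P) := by
  have h1 : diagOp n (quantCoeff n lam del 0) P = P := by
    ext1 s
    rw [coeff_diagOp, quantCoeff_zero, one_smul]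
  rw [quantSymb_eq lam del c hP, quantTrunc_apply, Finset.sum_range_succ', pow_zero, pow_zero,
    one_smul, Module.End.one_apply, h1]
  have h2 : ∀ A B : LocalSymbol n, A + B - B = A := fun A B => by abel
  rw [h2]
  refine DegLT.sum fun m _ => DegLT.smul _ (DegLT.diagOp _ (DegLT.divOp_pow (hP.mono ?_)))
  omega

theorem quantSymb_injective (lam del c : ℂ) : Function.Injective (quantSymb n lam del c) := by
  rw [injective_iff_map_eq_zero]
  intro P hP
  have key : ∀ k, DegLT k P → P = 0 := by
    intro k
    induction k with
    | zero => exact degLT_zero_iff.mp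
    | succ k ih =>
      intro h
      apply ih
      have h1 := degLT_quantSymb_sub lam del c h
      rw [hP] at h1
      have h2 := h1.smul (-1)
      have : (-1 : ℂ) • (0 - P) = P := by module
      rwa [this] at h2
  exact key _ (degLT_totalDegree P)

theorem DegLT.lieSymb {k : ℕ} {P : LocalSymbol n} (hP : DegLT k P) (del : ℂ)
    (v : Fin n → SmoothFun n) : DegLT k (lieSymb del v P) := by
  -- Truncation below degree k is a function of the Euler operator, so it commutes with the Lie
  -- derivative.
  have h : ProjQuant.diagOp n (fun e => if k ≤ e then 0 else 1) P = P := by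
    ext1 s
    rw [coeff_diagOp]
    split_ifs with h
    · rw [hP s h, smul_zero]
    · rw [one_smul]
  intro s hs
  rw [← h, lieSymb_diagOp, coeff_diagOp, if_pos hs, zero_smul]

/-- With b = (n+1)(1-δ), the one-step defects 2𝓔 + b, shifted by the powers of D to their left, add
up: the sum of 2(e+i) + b over 0 ≤ i ≤ m is (m+1)(2e + b + m). -/
theorem divOp_pow_lieSymb (del : ℂ) (Y : Matrix (Fin (n + 1)) (Fin (n + 1)) ℝ) (m : ℕ)
    (P : LocalSymbol n) :
    (divOp n ^ (m + 1)) (lieSymb del (projField Y) P)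
      = lieSymb del (projField Y) ((divOp n ^ (m + 1)) P)
      + diagOp n (fun e => (m + 1) * (2 * e + (n + 1) * (1 - del) + m))
          (dualOp Y ((divOp n ^ m) P)) := by
  induction m with
  | zero => simpa using divOp_lieSymb del Y P
  | succ m ih =>
    rw [pow_succ', Module.End.mul_apply, ih, map_add, divOp_lieSymb, divOp_diagOp, ← dualOp_divOp,
      ← Module.End.mul_apply (divOp n), ← pow_succ', ← Module.End.mul_apply (divOp n), ← pow_succ',
      add_assoc]
    congr 1
    rw [← LinearMap.add_apply, ← diagHom_apply, ← diagHom_apply, ← map_add, ← diagHom_apply]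
    congr 2
    funext e
    simp only [Pi.add_apply]
    push_cast
    ring

/-- The quantization map intertwines the Lie derivative of symbols with that of operators. -/
theorem quantSymb_lieSymb (lam del c : ℂ)
    (hres : ∀ l : ℕ, ((n : ℂ) + 1) * (1 - del) + l ≠ 0)
    (Y : Matrix (Fin (n + 1)) (Fin (n + 1)) ℝ) (P : LocalSymbol n) :
    quantSymb n lam del c (lieSymb del (projField Y) P)
      = lieSymb del (projField Y) (quantSymb n lam del c P)
        + c • diagOp n (fun e => e + (n + 1) * lam) (dualOp Y (quantSymb n lam del c P)) := by
  obtain ⟨k, hk⟩ : ∃ k, DegLT k P := ⟨_, degLT_totalDegree P⟩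
  -- The series is taken one term longer than necessary. As Dᵏ P = 0, the sum under `dualOp Y` loses
  -- its last term and matches the other sum after a shift of the index.
  rw [quantSymb_eq lam del c (hk.mono (Nat.le_succ k)),
    quantSymb_eq lam del c (DegLT.lieSymb (hk.mono (Nat.le_succ k)) _ _),
    quantTrunc_apply, quantTrunc_apply]
  simp only [← lieSymbₗ_apply]
  have hd : dualOp Y (∑ m ∈ Finset.range (k + 1),
        c ^ m • diagOp n (quantCoeff n lam del m) ((divOp n ^ m) P))
      = ∑ m ∈ Finset.range k, c ^ m • dualOp Y (diagOp n (quantCoeff n lam del m)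
          ((divOp n ^ m) P)) := by
    rw [Finset.sum_range_succ, divOp_pow_eq_zero le_rfl hk]
    simp
  rw [hd, Finset.sum_range_succ', Finset.sum_range_succ', map_add, map_sum, map_sum,
    Finset.smul_sum, add_right_comm, ← Finset.sum_add_distrib]
  congr 1
  · refine Finset.sum_congr rfl fun m _ => ?_
    simp only [lieSymbₗ_apply]
    rw [divOp_pow_lieSymb, map_add, map_smul, lieSymb_smul, lieSymb_diagOp, dualOp_diagOp,
      smul_add, smul_smul, ← pow_succ']
    congr 2
    ext1 s
    rw [coeff_diagOp, coeff_diagOp, coeff_diagOp, coeff_diagOp, smul_smul, smul_smul,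
      quantCoeff_succ n lam del hres, mul_comm]
  · simp only [pow_zero, one_smul, Module.End.one_apply, lieSymbₗ_apply, lieSymb_diagOp]

/-- Local infinitesimal equivariance of the quantization map. -/
theorem lieDens_applyOp_quantSymb (c lam mu : ℂ)
    (hres : ∀ l : ℕ, ((n : ℂ) + 1) * (1 - (mu - lam)) + l ≠ 0)
    (Y : Matrix (Fin (n + 1)) (Fin (n + 1)) ℝ) (P : LocalSymbol n) (f : SmoothFun n) :
    lieDens mu (projField Y) (applyOp c (quantSymb n lam (mu - lam) c P) f)
      = applyOp c (quantSymb n lam (mu - lam) c P) (lieDens lam (projField Y) f)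
      + applyOp c (quantSymb n lam (mu - lam) c (lieSymb (mu - lam) (projField Y) P)) f := by
  rw [lieDens_applyOp c lam mu, quantSymb_lieSymb lam (mu - lam) c hres]

/-! ### The Casimir operator -/

section Weyl

variable {A : Type*} [Ring A] [Algebra ℂ A] (x p ξ d : Fin n → A)

/-- The Casimir element of `gl(n+1)` in the Weyl algebra of `T*ℝⁿ`. -/
theorem casimir_weyl (c : ℂ)
    (hpx : ∀ i j, p i * x j = x j * p i + if i = j then 1 else 0)
    (hdξ : ∀ i j, d i * ξ j = ξ j * d i + if i = j then 1 else 0)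
    (hpp : ∀ i j, p i * p j = p j * p i) (hdd : ∀ i j, d i * d j = d j * d i)
    (hxξ : ∀ i j, x i * ξ j = ξ j * x i) (hxd : ∀ i j, x i * d j = d j * x i)
    (hpξ : ∀ i j, p i * ξ j = ξ j * p i) (hpd : ∀ i j, p i * d j = d j * p i) :
    (∑ i, ∑ j, (x j * p i - ξ i * d j + (if i = j then c else 0) • 1)
        * (x i * p j - ξ j * d i + (if j = i then c else 0) • 1))
      + (∑ i, x i * p i - ∑ i, ξ i * d i + (n * c) • 1)
        * (∑ i, x i * p i - ∑ i, ξ i * d i + (n * c) • 1)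
      - ∑ j, (x j * (∑ i, x i * p i - ∑ i, ξ i * d i + ((n + 1) * c) • 1)
          - (∑ i, x i * ξ i) * d j) * p j
      - ∑ j, p j * (x j * (∑ i, x i * p i - ∑ i, ξ i * d i + ((n + 1) * c) • 1)
          - (∑ i, x i * ξ i) * d j)
      = (2 : ℂ) • ((∑ i, ξ i * d i) * (∑ i, ξ i * d i))
        + (2 * (n - (n + 1) * c)) • (∑ i, ξ i * d i) + (n * (n + 1) * c * (c - 1)) • 1 := by
  -- With the Euler elements ε of the base and E of the fibre, W = x·ξ and D = p·d, every product
  -- reduces to a polynomial in ε and E plus a multiple of W D. The terms in ε and in W D cancel,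
  -- and a polynomial in E is left.
  set ε := ∑ i, x i * p i with hε
  set E := ∑ i, ξ i * d i with hE
  set W := ∑ i, x i * ξ i with hW
  set D := ∑ i, p i * d i with hD
  have pε : ∀ j, ε * p j = p j * ε - p j := by
    intro j
    have : p j * ε = ε * p j + p j := by
      rw [hε, Finset.mul_sum, Finset.sum_mul]
      have : ∀ i, p j * (x i * p i) = x i * p i * p j + (if j = i then p i else 0) := by
        intro i
        rw [← mul_assoc, hpx, add_mul, mul_assoc, hpp j i, mul_assoc]
        split_ifs <;> simp
      simp [this, Finset.sum_add_distrib]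
    rw [this, add_sub_cancel_right]
  have dE : ∀ j, E * d j = d j * E - d j := by
    intro j
    have : d j * E = E * d j + d j := by
      rw [hE, Finset.mul_sum, Finset.sum_mul]
      have : ∀ i, d j * (ξ i * d i) = ξ i * d i * d j + (if j = i then d i else 0) := by
        intro i
        rw [← mul_assoc, hdξ, add_mul, mul_assoc, hdd j i, mul_assoc]
        split_ifs <;> simp
      simp [this, Finset.sum_add_distrib]
    rw [this, add_sub_cancel_right]
  have Ep : ∀ j, E * p j = p j * E := by
    intro j
    rw [hE, Finset.mul_sum, Finset.sum_mul]
    refine Finset.sum_congr rfl fun i _ => ?_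
    rw [mul_assoc, ← hpd, ← mul_assoc, ← hpξ, mul_assoc]
  have Ex : ∀ j, E * x j = x j * E := by
    intro j
    rw [hE, Finset.mul_sum, Finset.sum_mul]
    refine Finset.sum_congr rfl fun i _ => ?_
    rw [mul_assoc, ← hxd, ← mul_assoc, ← hxξ, mul_assoc]
  have Eε : E * ε = ε * E := by
    rw [hε, Finset.mul_sum, Finset.sum_mul]
    refine Finset.sum_congr rfl fun i _ => ?_
    rw [← mul_assoc, Ex, mul_assoc, Ep, mul_assoc]
  have px : ∑ i, p i * x i = ε + (n : ℂ) • 1 := by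
    simp [hpx, Finset.sum_add_distrib, hε, Nat.cast_smul_eq_nsmul]
  have dξ : ∑ i, d i * ξ i = E + (n : ℂ) • 1 := by
    simp [hdξ, Finset.sum_add_distrib, hE, Nat.cast_smul_eq_nsmul]
  have s1 : ∑ i, ∑ j, x j * p i * (x i * p j) = ε * ε + (n : ℂ) • ε - ε := by
    rw [Finset.sum_comm]
    have : ∀ j, ∑ i, x j * p i * (x i * p j) = x j * (∑ i, p i * x i) * p j := by
      intro j
      rw [Finset.mul_sum, Finset.sum_mul]
      exact Finset.sum_congr rfl fun i _ => by simp only [mul_assoc]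
    have h2 : ∀ j, x j * (ε + (n : ℂ) • 1) * p j = x j * p j * (ε + (n : ℂ) • 1 - 1) := by
      intro j
      rw [mul_assoc, add_mul, pε]
      simp only [mul_add, mul_sub, smul_mul_assoc, mul_smul_comm, one_mul, mul_one, mul_assoc]
      abel
    simp only [this, px, h2]
    rw [← Finset.sum_mul, ← hε, mul_sub, mul_add, mul_smul_comm, mul_one]
  have s4 : ∑ i, ∑ j, ξ i * d j * (ξ j * d i) = E * E + (n : ℂ) • E - E := by
    have : ∀ i, ∑ j, ξ i * d j * (ξ j * d i) = ξ i * (∑ j, d j * ξ j) * d i := by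
      intro j
      rw [Finset.mul_sum, Finset.sum_mul]
      exact Finset.sum_congr rfl fun i _ => by simp only [mul_assoc]
    have h2 : ∀ j, ξ j * (E + (n : ℂ) • 1) * d j = ξ j * d j * (E + (n : ℂ) • 1 - 1) := by
      intro j
      rw [mul_assoc, add_mul, dE]
      simp only [mul_add, mul_sub, smul_mul_assoc, mul_smul_comm, one_mul, mul_one, mul_assoc]
      abel
    simp only [this, dξ, h2]
    rw [← Finset.sum_mul, ← hE, mul_sub, mul_add, mul_smul_comm, mul_one]
  have s2 : ∑ i, ∑ j, x j * p i * (ξ j * d i) = W * D := by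
    rw [Finset.sum_comm, hW, hD, Finset.sum_mul_sum]
    refine Finset.sum_congr rfl fun j _ => Finset.sum_congr rfl fun i _ => ?_
    rw [mul_assoc, ← mul_assoc (p i), hpξ]
    simp only [mul_assoc]
  have s3 : ∑ i, ∑ j, ξ i * d j * (x i * p j) = W * D := by
    rw [hW, hD, Finset.sum_mul_sum]
    refine Finset.sum_congr rfl fun i _ => Finset.sum_congr rfl fun j _ => ?_
    rw [mul_assoc, ← mul_assoc (d j), ← hxd, mul_assoc, ← hpd, ← mul_assoc, ← hxξ]
  have s5 : ∑ j, x j * ε * p j = ε * ε - ε := by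
    have : ∀ j, x j * ε * p j = x j * p j * ε - x j * p j := by
      intro j
      rw [mul_assoc, pε, mul_sub, mul_assoc]
    simp only [this, Finset.sum_sub_distrib]
    rw [← Finset.sum_mul]
  have s6 : ∑ j, x j * E * p j = ε * E := by
    have : ∀ j, x j * E * p j = x j * p j * E := fun j => by rw [mul_assoc, Ep, mul_assoc]
    simp only [this]
    rw [← Finset.sum_mul]
  have s7 : ∑ j, W * d j * p j = W * D := by
    rw [hD, Finset.mul_sum]
    exact Finset.sum_congr rfl fun j _ => by rw [mul_assoc, hpd]
  have s8 : ∑ j, p j * (W * d j) = W * D + E := by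
    have h1 : ∀ j, p j * W = W * p j + ξ j := by
      intro j
      have : ∀ i, p j * (x i * ξ i) = x i * ξ i * p j + (if j = i then ξ i else 0) := by
        intro i
        rw [← mul_assoc, hpx, add_mul, mul_assoc, hpξ, mul_assoc]
        split_ifs <;> simp
      rw [hW, Finset.mul_sum, Finset.sum_mul]
      simp [this, Finset.sum_add_distrib]
    rw [hD, Finset.mul_sum, hE, ← Finset.sum_add_distrib]
    refine Finset.sum_congr rfl fun j _ => ?_
    rw [← mul_assoc, h1, add_mul, mul_assoc]
  have s9 : ∀ R : A, ∑ j, p j * (x j * R) = ε * R + (n : ℂ) • R := by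
    intro R
    simp only [← mul_assoc]
    rw [← Finset.sum_mul, px, add_mul, smul_mul_assoc, one_mul]
  have t1 : (∑ i, ∑ j, (x j * p i - ξ i * d j + (if i = j then c else 0) • 1)
        * (x i * p j - ξ j * d i + (if j = i then c else 0) • 1))
      = (ε * ε + (n : ℂ) • ε - ε) - W * D - W * D + (E * E + (n : ℂ) • E - E)
        + (2 * c) • (ε - E) + (n * c * c) • 1 := by
    have e1 : ∀ i j, (x j * p i - ξ i * d j + (if i = j then c else 0) • 1)
        * (x i * p j - ξ j * d i + (if j = i then c else 0) • 1)
        = x j * p i * (x i * p j) - x j * p i * (ξ j * d i) - ξ i * d j * (x i * p j)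
          + ξ i * d j * (ξ j * d i)
          + if i = j then (2 * c) • (x i * p i - ξ i * d i) + (c * c) • (1 : A) else 0 := by
      intro i j
      by_cases h : i = j
      · subst h
        simp only [if_true, mul_add, add_mul, mul_sub, sub_mul, smul_mul_assoc, mul_smul_comm,
          one_mul, mul_one]
        module
      · have h' : j ≠ i := fun e => h e.symm
        simp only [h, h', if_false, zero_smul, add_zero, mul_sub, sub_mul]
        abel
    simp only [e1, Finset.sum_add_distrib, Finset.sum_sub_distrib, s1, s2, s3, s4,
      Finset.sum_ite_eq, Finset.mem_univ, if_true, ← Finset.smul_sum, ← hε, ← hE,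
      Finset.sum_const, Finset.card_univ, Fintype.card_fin, ← Nat.cast_smul_eq_nsmul ℂ n, smul_smul]
    module
  have t2 : ∑ j, (x j * (ε - E + ((n + 1) * c) • 1) - W * d j) * p j
      = ε * ε - ε - ε * E + ((n + 1) * c) • ε - W * D := by
    simp only [mul_add, mul_sub, add_mul, sub_mul, Finset.sum_add_distrib, Finset.sum_sub_distrib,
      s5, s6, s7, mul_smul_comm, smul_mul_assoc, mul_one, ← Finset.smul_sum, ← hε]
  have t3 : ∑ j, p j * (x j * (ε - E + ((n + 1) * c) • 1) - W * d j)
      = ε * (ε - E + ((n + 1) * c) • 1) + (n : ℂ) • (ε - E + ((n + 1) * c) • 1) - (W * D + E) := by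
    simp only [mul_sub (p _), Finset.sum_sub_distrib, s8, s9]
  rw [t1, t2, t3]
  simp only [mul_add, mul_sub, add_mul, sub_mul, mul_smul_comm, smul_mul_assoc, mul_one, one_mul,
    Eε]
  module

end Weyl

theorem mulSymbol_apply (a P : LocalSymbol n) : mulSymbol a P = a * P := rfl

/-- Negation is multiplication by -1; it completes the ring structure in which `casimir_weyl` is
applied to operators on symbols. -/
instance endLocalSymbolNeg : Neg (Module.End ℂ (LocalSymbol n)) := ⟨fun T => (-1 : ℂ) • T⟩

/-- The ring structure on the operators on local symbols. -/
instance endLocalSymbolRing : Ring (Module.End ℂ (LocalSymbol n)) :=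
  { (inferInstance : Semiring (Module.End ℂ (LocalSymbol n))) with
    neg := Neg.neg
    zsmul := zsmulRec
    neg_add_cancel := fun T => by
      apply LinearMap.ext
      intro P
      change (-1 : ℂ) • T P + T P = 0
      module }

theorem endLocalSymbol_sub_apply (S T : Module.End ℂ (LocalSymbol n)) (P : LocalSymbol n) :
    (S - T) P = S P - T P := by
  change S P + (-1 : ℂ) • T P = S P - T P
  module

theorem lieSymbₗ_eq (del : ℂ) (v : Fin n → SmoothFun n) :
    lieSymbₗ del v = ∑ i, mulSymbol (C (v i)) * symbolDx i
      - ∑ i, ∑ j, mulSymbol (C (partialD j (v i))) * (mulSymbol (X i) * symbolDxi j)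
      + del • mulSymbol (C (divField v)) := by
  apply LinearMap.ext
  intro P
  simp [lieSymbₗ_apply, lieSymb, mulSymbol_apply, mul_assoc, endLocalSymbol_sub_apply]

theorem mulSymbol_zero : mulSymbol (0 : LocalSymbol n) = 0 := by
  apply LinearMap.ext
  intro P
  simp [mulSymbol_apply]

theorem mulSymbol_one : mulSymbol (1 : LocalSymbol n) = 1 := by
  apply LinearMap.ext
  intro P
  simp [mulSymbol_apply]

theorem mulSymbol_add (a b : LocalSymbol n) : mulSymbol (a + b) = mulSymbol a + mulSymbol b := by
  apply LinearMap.ext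
  intro P
  simp [mulSymbol_apply, add_mul]

theorem mulSymbol_smul (c : ℂ) (a : LocalSymbol n) : mulSymbol (c • a) = c • mulSymbol a := by
  apply LinearMap.ext
  intro P
  simp [mulSymbol_apply]

theorem mulSymbol_mul (a b : LocalSymbol n) : mulSymbol (a * b) = mulSymbol a * mulSymbol b := by
  apply LinearMap.ext
  intro P
  simp [mulSymbol_apply, mul_assoc]

/-- The elementary matrices generate translations, linear fields, minus the radial field and the
quadratic fields. Up to sign, their Lie derivatives are the Weyl algebra elements multiplied in
`casimir_weyl`. -/
theorem lieSymbₗ_single_succ_zero (del : ℂ) (i : Fin n) :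
    lieSymbₗ del (projField (Matrix.single i.succ 0 1)) = symbolDx i := by
  have hv : ∀ k, projField (Matrix.single i.succ 0 (1 : ℝ)) k = if i = k then 1 else 0 := by
    intro k
    apply Subtype.ext
    funext x
    by_cases h : i = k
    · subst h; simp [projField, (Fin.succ_ne_zero _).symm]
    · simp [projField, h]
  have hd : ∀ j k, partialD j (projField (Matrix.single i.succ 0 (1 : ℝ)) k) = 0 := by
    intro j k
    rw [hv]
    split_ifs
    · simpa using partialD_algebraMap j (1 : ℂ)
    · simp
  have h0 : divField (projField (Matrix.single i.succ 0 (1 : ℝ))) = 0 := by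
    simp [divField, hd]
  rw [lieSymbₗ_eq]
  simp only [hd, h0, C_0, mulSymbol_zero, zero_mul, Finset.sum_const_zero, sub_zero, smul_zero,
    add_zero]
  rw [Finset.sum_eq_single i]
  · rw [hv, if_pos rfl, C_1, mulSymbol_one, one_mul]
  · intro k _ hk
    rw [hv, if_neg hk.symm, C_0, mulSymbol_zero, zero_mul]
  · simp

theorem lieSymbₗ_single_succ_succ (del : ℂ) (i j : Fin n) :
    lieSymbₗ del (projField (Matrix.single i.succ j.succ 1))
      = mulSymbol (C (coordFun j)) * symbolDx i - mulSymbol (X i) * symbolDxi j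
        + (if i = j then del else 0) • 1 := by
  have hv : ∀ k, projField (Matrix.single i.succ j.succ (1 : ℝ)) k
      = if i = k then coordFun j else 0 := by
    intro k
    apply Subtype.ext
    funext x
    by_cases h : i = k
    · subst h; simp [projField, Matrix.single_apply, coordFun]
    · simp [projField, h]
  have hd : ∀ b k, partialD b (projField (Matrix.single i.succ j.succ (1 : ℝ)) k)
      = if i = k then if b = j then 1 else 0 else 0 := by
    intro b k
    rw [hv]
    split_ifs <;> simp_all [partialD_coordFun]
  have h0 : divField (projField (Matrix.single i.succ j.succ (1 : ℝ))) = if i = j then 1 else 0 :=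
      by
    simp [divField, hd]
  rw [lieSymbₗ_eq, h0]
  congr 1
  · congr 1
    · rw [Finset.sum_eq_single i]
      · rw [hv, if_pos rfl]
      · intro k _ hk
        rw [hv, if_neg hk.symm, C_0, mulSymbol_zero, zero_mul]
      · simp
    · rw [Finset.sum_eq_single i, Finset.sum_eq_single j]
      · rw [hd, if_pos rfl, if_pos rfl, C_1, mulSymbol_one, one_mul]
      · intro k _ hk
        rw [hd, if_pos rfl, if_neg hk, C_0, mulSymbol_zero, zero_mul]
      · simp
      · intro k _ hk
        refine Finset.sum_eq_zero fun b _ => ?_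
        rw [hd, if_neg hk.symm, C_0, mulSymbol_zero, zero_mul]
      · simp
  · split_ifs
    · rw [C_1, mulSymbol_one]
    · rw [C_0, mulSymbol_zero, smul_zero, zero_smul]

theorem lieSymbₗ_single_zero_zero (del : ℂ) :
    lieSymbₗ (n := n) del (projField (Matrix.single 0 0 1))
      = -(∑ i, mulSymbol (C (coordFun i)) * symbolDx i - ∑ i, mulSymbol (X i) * symbolDxi i
        + (n * del) • (1 : Module.End ℂ (LocalSymbol n))) := by
  have hv : ∀ k : Fin n, projField (Matrix.single 0 0 (1 : ℝ)) k = (-1 : ℂ) • coordFun k := by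
    intro k
    apply Subtype.ext
    funext x
    simp [projField, coordFun, (Fin.succ_ne_zero _).symm]
  have hd : ∀ b k : Fin n, partialD b (projField (Matrix.single 0 0 (1 : ℝ)) k)
      = (-1 : ℂ) • if b = k then 1 else 0 := by
    intro b k
    rw [hv, map_smul, partialD_coordFun]
  have h0 : divField (projField (n := n) (Matrix.single 0 0 (1 : ℝ))) = (-n : ℂ) • 1 := by
    simp only [divField, hd, if_true, Finset.sum_const, Finset.card_univ, Fintype.card_fin,
      ← Nat.cast_smul_eq_nsmul ℂ n]
    module
  rw [lieSymbₗ_eq, h0]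
  simp only [hd]
  simp only [hv, C_smul_smoothFun, mulSymbol_smul, smul_mul_assoc, ← Finset.smul_sum, C_1,
    mulSymbol_one]
  have h1 : ∀ i : Fin n, ∑ j, mulSymbol (C (if j = i then 1 else 0)) * (mulSymbol (X i)
      * symbolDxi j)
      = mulSymbol (X i) * symbolDxi i := by
    intro i
    rw [Finset.sum_eq_single i]
    · rw [if_pos rfl, C_1, mulSymbol_one, one_mul]
    · intro k _ hk
      rw [if_neg hk, C_0, mulSymbol_zero, zero_mul]
    · simp
  simp only [h1]
  module

theorem lieSymbₗ_single_zero_succ (del : ℂ) (j : Fin n) :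
    lieSymbₗ del (projField (Matrix.single 0 j.succ 1))
      = -(mulSymbol (C (coordFun j)) * (∑ i, mulSymbol (C (coordFun i)) * symbolDx i
          - ∑ i, mulSymbol (X i) * symbolDxi i
          + ((n + 1) * del) • (1 : Module.End ℂ (LocalSymbol n)))
        - (∑ i, mulSymbol (C (coordFun i)) * mulSymbol (X i)) * symbolDxi j) := by
  have hv : ∀ k : Fin n, projField (Matrix.single 0 j.succ (1 : ℝ)) k
      = (-1 : ℂ) • (coordFun j * coordFun k) := by
    intro k
    apply Subtype.ext
    funext x
    simp [projField, Matrix.single_apply, coordFun, (Fin.succ_ne_zero _).symm, mul_comm]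
  have hd : ∀ b k : Fin n, partialD b (projField (Matrix.single 0 j.succ (1 : ℝ)) k)
      = (-1 : ℂ) • ((if b = j then coordFun k else 0) + (if b = k then coordFun j else 0)) := by
    intro b k
    rw [hv, map_smul, partialD_mul, partialD_coordFun, partialD_coordFun]
    split_ifs <;> simp
  have h0 : divField (projField (n := n) (Matrix.single 0 j.succ (1 : ℝ)))
      = (-(n + 1) : ℂ) • coordFun j := by
    simp only [divField, hd, ← Finset.smul_sum, Finset.sum_add_distrib, Finset.sum_ite_eq',
      Finset.mem_univ, if_true, Finset.sum_const, Finset.card_univ, Fintype.card_fin,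
      ← Nat.cast_smul_eq_nsmul ℂ n]
    module
  have h1 : ∀ i : Fin n, ∑ b, mulSymbol (C ((if b = j then coordFun i else 0)
        + (if b = i then coordFun j else 0))) * (mulSymbol (X i) * symbolDxi b)
      = mulSymbol (C (coordFun i)) * (mulSymbol (X i) * symbolDxi j)
        + mulSymbol (C (coordFun j)) * (mulSymbol (X i) * symbolDxi i) := by
    intro i
    simp only [map_add, mulSymbol_add, add_mul, Finset.sum_add_distrib]
    congr 1
    · rw [Finset.sum_eq_single j]
      · rw [if_pos rfl]
      · intro k _ hk
        rw [if_neg hk, C_0, mulSymbol_zero, zero_mul]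
      · simp
    · rw [Finset.sum_eq_single i]
      · rw [if_pos rfl]
      · intro k _ hk
        rw [if_neg hk, C_0, mulSymbol_zero, zero_mul]
      · simp
  rw [lieSymbₗ_eq, h0]
  simp only [hd]
  simp only [hv, C_smul_smoothFun, mulSymbol_smul, smul_mul_assoc, ← Finset.smul_sum, h1, C_mul,
    mulSymbol_mul, Finset.sum_add_distrib, mul_assoc, ← Finset.mul_sum, Finset.sum_mul, mul_add,
    mul_sub, mul_smul_comm, mul_one]
  module

/-- The sum over E_ab E_ba is the Casimir operator of gl(n+1). The operators x, ∂/∂x, ξ, ∂/∂ξ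
satisfy the Weyl relations, so `casimir_weyl` makes it a polynomial in 𝓔, whose values will separate
the degrees. -/
theorem sum_lieSymb_lieSymb_single (del : ℂ) (P : LocalSymbol n) :
    ∑ a, ∑ b, lieSymb del (projField (Matrix.single a b 1))
        (lieSymb del (projField (Matrix.single b a 1)) P)
      = diagOp n (fun e => 2 * e * e + 2 * (n - (n + 1) * del) * e + n * (n + 1) * del *
          (del - 1)) P := by
  have key := casimir_weyl (A := Module.End ℂ (LocalSymbol n)) (fun i => mulSymbol (C (coordFun i)))
    symbolDx (fun i => mulSymbol (X i)) symbolDxi del ?_ ?_ ?_ ?_ ?_ ?_ ?_ ?_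
  · have h1 : ∑ a : Fin (n + 1), ∑ b, lieSymbₗ del (projField (Matrix.single a b 1))
        * lieSymbₗ del (projField (Matrix.single b a 1))
        = diagOp n (fun e => 2 * e * e + 2 * (n - (n + 1) * del) * e
          + n * (n + 1) * del * (del - 1)) := by
      have h2 : diagOp n (fun e => 2 * e * e + 2 * (n - (n + 1) * del) * e
          + n * (n + 1) * del * (del - 1)) = (2 : ℂ) • (eulerOp n * eulerOp n)
          + (2 * (n - (n + 1) * del)) • eulerOp n + (n * (n + 1) * del * (del - 1)) • 1 := by
        rw [eulerOp_eq_diagOp]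
        simp only [← diagHom_apply, ← map_mul, ← map_smul, ← map_add, ← map_one (diagHom n)]
        congr 1
        funext e
        simp
        ring
      rw [h2, eulerOp, ← key]
      simp only [Fin.sum_univ_succ, lieSymbₗ_single_succ_zero, lieSymbₗ_single_succ_succ,
        lieSymbₗ_single_zero_zero, lieSymbₗ_single_zero_succ, Finset.sum_add_distrib,
        neg_mul, mul_neg, neg_neg, Finset.sum_neg_distrib]
      abel
    have h3 := congrArg (fun T => T P) h1
    simpa only [LinearMap.sum_apply, Module.End.mul_apply, lieSymbₗ_apply] using h3
  all_goals
    intro i j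
    apply LinearMap.ext
    intro Q
    simp only [Module.End.mul_apply, mulSymbol_apply, LinearMap.add_apply]
  · rw [symbolDx_C_mul, partialD_coordFun, add_comm]
    split_ifs <;> simp
  · rw [mul_comm (X j), symbolDxi_mul_X, mul_comm (X j)]
    split_ifs <;> simp
  · exact symbolDx_comm i j Q
  · exact symbolDxi_comm i j Q
  · ring
  · rw [symbolDxi_C_mul]
  · rw [mul_comm (X j), symbolDx_mul_X, mul_comm (X j)]
  · exact symbolDx_symbolDxi i j Q

/-! ### Changes of affine coordinates -/

/-- The vector `g (1, x)`. -/
def lift (g : SL(n + 1, ℝ)) (x : Fin n → ℝ) : Fin (n + 1) → ℝ := act g (Fin.cons 1 x)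

theorem lift_apply (g : SL(n + 1, ℝ)) (x : Fin n → ℝ) (a : Fin (n + 1)) :
    lift g x a = g.1 a 0 + ∑ j : Fin n, g.1 a j.succ * x j := by
  simp [lift, act, Matrix.mulVec, dotProduct, Fin.sum_univ_succ]

theorem lift_ne_zero (g : SL(n + 1, ℝ)) (x : Fin n → ℝ) : lift g x ≠ 0 :=
  act_ne_zero g (cons_one_ne_zero x)

theorem lift_mul (g h : SL(n + 1, ℝ)) (x : Fin n → ℝ) : lift (g * h) x = act g (lift h x) :=
  act_mul g h _

theorem lift_one (x : Fin n → ℝ) : lift 1 x = Fin.cons 1 x := act_one _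

theorem chart_eq_toSph (g : SL(n + 1, ℝ)) (x : Fin n → ℝ) :
    chart g x = toSph (lift g x) (lift_ne_zero g x) := sphAct_toSph g _ _

/-- The points `x` of the chart `g` and `y` of the chart `h` are the same point of the sphere if
and only if `g (1, x)` is a positive multiple of `h (1, y)`. -/
theorem chart_eq_iff (g h : SL(n + 1, ℝ)) (x y : Fin n → ℝ) :
    chart g x = chart h y ↔ ∃ r : ℝ, 0 < r ∧ lift g x = r • lift h y := by
  rw [chart_eq_toSph, chart_eq_toSph]
  constructor
  · intro e
    have h1 : ‖WithLp.toLp 2 (lift g x)‖ ≠ 0 := by simpa using lift_ne_zero g x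
    have h2 : ‖WithLp.toLp 2 (lift h y)‖ ≠ 0 := by simpa using lift_ne_zero h y
    have e1 := congrArg (fun p : Sph n => p.1.ofLp) e
    simp only [toSph, WithLp.ofLp_smul] at e1
    refine ⟨‖WithLp.toLp 2 (lift g x)‖ * ‖WithLp.toLp 2 (lift h y)‖⁻¹, by positivity, ?_⟩
    rw [mul_smul, ← e1, smul_smul, mul_inv_cancel₀ h1, one_smul]
  · rintro ⟨r, hr, e⟩
    have hne : r • lift h y ≠ 0 := e ▸ lift_ne_zero g x
    rw [← toSph_smul (lift h y) (lift_ne_zero h y) hr hne]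
    congr 1

theorem transition_apply (g h : SL(n + 1, ℝ)) (x : Fin n → ℝ) (i : Fin n) :
    transition g h x i = lift (h⁻¹ * g) x i.succ / lift (h⁻¹ * g) x 0 := by
  have h0 : ‖WithLp.toLp 2 (lift g x)‖⁻¹ ≠ 0 := by simpa using lift_ne_zero g x
  have e : act h⁻¹ (chart g x).1.ofLp
      = ‖WithLp.toLp 2 (lift g x)‖⁻¹ • lift (h⁻¹ * g) x := by
    rw [lift_mul, ← act_smul, chart_eq_toSph]
    rfl
  simp only [transition, coord, e, Pi.smul_apply, smul_eq_mul]
  exact mul_div_mul_left _ _ h0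

theorem lift_inv_mul_of_lift_eq {g h : SL(n + 1, ℝ)} {x y : Fin n → ℝ} {r : ℝ}
    (e : lift g x = r • lift h y) : lift (h⁻¹ * g) x = r • (Fin.cons 1 y : Fin (n + 1) → ℝ) := by
  rw [lift_mul, e, act_smul, ← lift_mul, inv_mul_cancel, lift_one]

theorem hasFDerivAt_lift (g : SL(n + 1, ℝ)) (x : Fin n → ℝ) (a : Fin (n + 1)) :
    HasFDerivAt (fun x => lift g x a)
      (∑ j : Fin n, g.1 a j.succ • ContinuousLinearMap.proj (R := ℝ) (φ := fun _ : Fin n =>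
          ℝ) j) x := by
  simp only [lift_apply]
  refine HasFDerivAt.const_add _ ?_
  refine HasFDerivAt.fun_sum fun j _ => ?_
  exact (ContinuousLinearMap.proj (R := ℝ) (φ := fun _ : Fin n => ℝ) j).hasFDerivAt.const_mul _

/-- The Jacobian matrix of a change of affine coordinates. -/
theorem fderiv_transition {g h : SL(n + 1, ℝ)} {x y : Fin n → ℝ} {r : ℝ} (hr : 0 < r)
    (e : lift g x = r • lift h y) (i j : Fin n) :
    fderiv ℝ (transition g h) x (Pi.single j 1) i
      = r⁻¹ * ((h⁻¹ * g).1 i.succ j.succ - y i * (h⁻¹ * g).1 0 j.succ) := by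
  have e' := lift_inv_mul_of_lift_eq e
  have h0 : lift (h⁻¹ * g) x 0 = r := by rw [e']; simp
  have hi : lift (h⁻¹ * g) x i.succ = r * y i := by rw [e']; simp
  have hne : lift (h⁻¹ * g) x 0 ≠ 0 := by rw [h0]; exact hr.ne'
  have hd : ∀ i : Fin n, HasFDerivAt (fun x => transition g h x i) _ x := fun i => by
    simp only [transition_apply, div_eq_mul_inv]
    exact (hasFDerivAt_lift (h⁻¹ * g) x i.succ).mul
      ((hasDerivAt_inv hne).comp_hasFDerivAt x (hasFDerivAt_lift (h⁻¹ * g) x 0))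
  have hdiff : DifferentiableAt ℝ (transition g h) x :=
    differentiableAt_pi.mpr fun i => (hd i).differentiableAt
  have : fderiv ℝ (transition g h) x (Pi.single j 1) i
      = fderiv ℝ (fun x => transition g h x i) x (Pi.single j 1) := by
    rw [fderiv_apply hdiff]
    rfl
  rw [this, (hd i).fderiv]
  simp [Pi.single_apply, h0, hi]
  field_simp
  ring

/-- By Cramer's rule, replacing column 0 of `M` by M(1, x) = r(1, y) leaves the determinant 1.
Subtracting yᵢ times row 0 from row i reduces that column to (r, 0), and expansion along it gives
the claim. -/
theorem det_of_mulVec_cons {M : Matrix (Fin (n + 1)) (Fin (n + 1)) ℝ} (hM : M.det = 1)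
    {x y : Fin n → ℝ} {r : ℝ}
    (e : M.mulVec (Fin.cons 1 x) = r • (Fin.cons 1 y : Fin (n + 1) → ℝ)) :
    (Matrix.of fun i j : Fin n => M i.succ j.succ - y i * M 0 j.succ).det = r⁻¹ := by
  have h1 : (M.updateCol 0 (r • (Fin.cons 1 y : Fin (n + 1) → ℝ))).det = 1 := by
    rw [← Matrix.cramer_apply, ← e, Matrix.cramer_eq_adjugate_mulVec, Matrix.mulVec_mulVec,
      Matrix.adjugate_mul, hM]
    simp
  let B : Matrix (Fin (n + 1)) (Fin (n + 1)) ℝ := M.updateCol 0 (r • (Fin.cons 1 y))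
  let c : Fin (n + 1) → ℝ := Fin.cons 0 (-y)
  have h2 : (Matrix.of fun i j => B i j + c i * B 0 j).det = B.det :=
    Matrix.det_eq_of_forall_row_eq_smul_add_const c 0 (by simp [c]) (fun i j => rfl)
  rw [Matrix.det_succ_column_zero, Fin.sum_univ_succ] at h2
  have h3 : ∀ i : Fin n, (Matrix.of fun i j => B i j + c i * B 0 j) i.succ 0 = 0 := by
    intro i
    simp [B, c, mul_comm]
  have h4 : (Matrix.of fun i j => B i j + c i * B 0 j) 0 0 = r := by simp [B, c]
  have h5 : (Matrix.of fun i j => B i j + c i * B 0 j).submatrix (Fin.succAbove 0) Fin.succ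
      = Matrix.of fun i j : Fin n => M i.succ j.succ - y i * M 0 j.succ := by
    ext i j
    simp [B, c, sub_eq_add_neg]
  rw [Finset.sum_eq_zero (fun i _ => by rw [h3]; simp), h4, h5, h1] at h2
  simp only [Fin.val_zero, pow_zero, one_mul, add_zero] at h2
  exact eq_inv_of_mul_eq_one_right h2

/-- The n rows contribute r⁻¹ each and the remaining determinant contributes one more. So a density
of degree λ amounts to a function on the nonzero vectors that is positively homogeneous of degree
-(n+1)λ. -/
theorem jac_eq {g h : SL(n + 1, ℝ)} {x y : Fin n → ℝ} {r : ℝ} (hr : 0 < r)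
    (e : lift g x = r • lift h y) : jac g h x = r⁻¹ ^ (n + 1) := by
  have e' := lift_inv_mul_of_lift_eq e
  have h1 : (fderiv ℝ (transition g h) x).det
      = (LinearMap.toMatrix' (fderiv ℝ (transition g h) x).toLinearMap).det := by
    rw [LinearMap.det_toMatrix']
  have h2 : LinearMap.toMatrix' (fderiv ℝ (transition g h) x).toLinearMap
      = r⁻¹ • Matrix.of fun i j : Fin n =>
        (h⁻¹ * g).1 i.succ j.succ - y i * (h⁻¹ * g).1 0 j.succ := by
    ext i j
    rw [LinearMap.toMatrix'_apply]
    exact fderiv_transition hr e i j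
  have h3 := det_of_mulVec_cons (h⁻¹ * g).2 e'
  rw [jac, h1, h2, Matrix.det_smul, h3, Fintype.card_fin, ← pow_succ]
  exact abs_of_pos (by positivity)

theorem jac_cpow {g h : SL(n + 1, ℝ)} {x y : Fin n → ℝ} {r : ℝ} (hr : 0 < r)
    (e : lift g x = r • lift h y) (lam : ℂ) :
    (jac g h x : ℂ) ^ lam = Complex.exp (-((n + 1) * lam * Real.log r)) := by
  have h0 : (0 : ℝ) < r⁻¹ ^ (n + 1) := by positivity
  rw [jac_eq hr e, Complex.cpow_def_of_ne_zero (by exact_mod_cast h0.ne'),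
    ← Complex.ofReal_log h0.le,
    Real.log_pow, Real.log_inv]
  congr 1
  push_cast
  ring

theorem pullCovector_eq {g h : SL(n + 1, ℝ)} {x y : Fin n → ℝ} {r : ℝ} (hr : 0 < r)
    (e : lift g x = r • lift h y) (η : Fin n → ℝ) (j : Fin n) :
    pullCovector g h x η j
      = r⁻¹ * ∑ i, η i * ((h⁻¹ * g).1 i.succ j.succ - y i * (h⁻¹ * g).1 0 j.succ) := by
  rw [pullCovector, Finset.mul_sum]
  refine Finset.sum_congr rfl fun i _ => ?_
  rw [fderiv_transition hr e]
  ring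

/-! ### Evaluation of symbols -/

/-- Evaluation of smooth functions at a point. -/
def evalAt (x : Fin n → ℝ) : SmoothFun n →+* ℂ :=
  (Pi.evalRingHom (fun _ : Fin n → ℝ => ℂ) x).comp (SmoothFun n).val.toRingHom

theorem evalAt_apply (x : Fin n → ℝ) (f : SmoothFun n) : evalAt x f = f.1 x := rfl

theorem evalSymbol_eq (P : LocalSymbol n) (x ξ : Fin n → ℝ) :
    evalSymbol P x ξ = eval (fun i => (ξ i : ℂ)) (map (evalAt x) P) :=
  (eval_map _ _ _).symm

theorem evalSymbol_C (a : SmoothFun n) (x ξ : Fin n → ℝ) : evalSymbol (C a) x ξ = a.1 x := by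
  rw [evalSymbol_eq, map_C, eval_C, evalAt_apply]

theorem evalSymbol_C_mul (a : SmoothFun n) (P : LocalSymbol n) (x ξ : Fin n → ℝ) :
    evalSymbol (C a * P) x ξ = a.1 x * evalSymbol P x ξ := by
  rw [evalSymbol_eq, evalSymbol_eq, map_mul, map_C, map_mul, eval_C, evalAt_apply]

theorem evalSymbol_mul_X (P : LocalSymbol n) (k : Fin n) (x ξ : Fin n → ℝ) :
    evalSymbol (P * X k) x ξ = evalSymbol P x ξ * ξ k := by
  rw [evalSymbol_eq, evalSymbol_eq, map_mul, map_X, map_mul, eval_X]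

theorem evalSymbol_X_mul (P : LocalSymbol n) (k : Fin n) (x ξ : Fin n → ℝ) :
    evalSymbol (X k * P) x ξ = ξ k * evalSymbol P x ξ := by
  rw [mul_comm, evalSymbol_mul_X, mul_comm]

/-- `evalSymbol` as a linear form. -/
def evalSymbolₗ (x ξ : Fin n → ℝ) : LocalSymbol n →ₗ[ℂ] ℂ where
  toFun P := evalSymbol P x ξ
  map_add' P Q := evalSymbol_add P Q x ξ
  map_smul' c P := evalSymbol_smul c P x ξ

theorem evalSymbolₗ_apply (P : LocalSymbol n) (x ξ : Fin n → ℝ) :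
    evalSymbolₗ x ξ P = evalSymbol P x ξ := rfl

theorem eq_zero_of_eval_real {p : MvPolynomial (Fin n) ℂ}
    (h : ∀ ξ : Fin n → ℝ, eval (fun i => (ξ i : ℂ)) p = 0) : p = 0 := by
  refine funext_set (fun _ => Set.range ((↑) : ℝ → ℂ))
    (fun _ => Set.infinite_range_of_injective Complex.ofReal_injective) fun z hz => ?_
  choose ξ hξ using fun i => hz i (Set.mem_univ i)
  have : z = fun i => (ξ i : ℂ) := funext fun i => (hξ i).symm
  rw [this, h, map_zero]

theorem map_evalAt_eq_zero {P : LocalSymbol n} {x : Fin n → ℝ}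
    (h : ∀ ξ, evalSymbol P x ξ = 0) : map (evalAt x) P = 0 :=
  eq_zero_of_eval_real fun ξ => by rw [← evalSymbol_eq, h]

theorem eq_zero_of_evalSymbol {P : LocalSymbol n} (h : ∀ x ξ, evalSymbol P x ξ = 0) : P = 0 := by
  ext1 s
  apply Subtype.ext
  funext x
  have h1 := congrArg (coeff s) (map_evalAt_eq_zero (h x))
  rwa [coeff_map, coeff_zero] at h1

theorem evalSymbol_injective {P Q : LocalSymbol n}
    (h : ∀ x ξ, evalSymbol P x ξ = evalSymbol Q x ξ) : P = Q := by
  have h1 : P - Q = 0 := by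
    refine eq_zero_of_evalSymbol fun x ξ => ?_
    rw [← evalSymbolₗ_apply, map_sub, evalSymbolₗ_apply, evalSymbolₗ_apply, h, sub_self]
  have h2 : P = (P - Q) + Q := by abel
  rw [h2, h1, zero_add]

theorem evalSymbol_smul_right (P : LocalSymbol n) (x ξ : Fin n → ℝ) (τ : ℝ) :
    evalSymbol P x (τ • ξ) = evalSymbol (diagOp n (fun e => (τ : ℂ) ^ e) P) x ξ := by
  induction P using MvPolynomial.induction_on with
  | C a => simp [diagOp_C, evalSymbol_C]
  | add p q hp hq => rw [evalSymbol_add, hp, hq, map_add, evalSymbol_add]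
  | mul_X p k hp =>
    have h1 : diagOp n (fun e => (τ : ℂ) ^ (e + 1)) p = (τ : ℂ) • diagOp n (fun e =>
        (τ : ℂ) ^ e) p := by
      ext1 s
      rw [coeff_diagOp, coeff_smul, coeff_diagOp, smul_smul, pow_succ']
    rw [evalSymbol_mul_X, hp, diagOp_mul_X, h1, smul_mul_assoc, evalSymbol_smul, evalSymbol_mul_X]
    simp
    ring

/-- The homogeneous component of degree `e` of a local symbol. -/
def homPart (n e : ℕ) : Module.End ℂ (LocalSymbol n) := diagOp n (fun k => if k = e then 1 else 0)

theorem coeff_homPart (e : ℕ) (P : LocalSymbol n) (s : Fin n →₀ ℕ) :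
    (homPart n e P).coeff s = if s.degree = e then P.coeff s else 0 := by
  rw [homPart, coeff_diagOp]
  split_ifs <;> simp

theorem sum_homPart {K : ℕ} {P : LocalSymbol n} (hP : DegLT K P) (φ : ℕ → ℂ) :
    diagOp n φ P = ∑ e ∈ Finset.range K, φ e • homPart n e P := by
  ext1 s
  rw [coeff_sum]
  simp only [coeff_smul, coeff_homPart, coeff_diagOp, smul_ite, smul_zero]
  rw [Finset.sum_ite_eq]
  split_ifs with h
  · rfl
  · rw [hP s (by simpa using h), smul_zero]

theorem evalSymbol_smul_right_eq_sum {K : ℕ} {P : LocalSymbol n} (hP : DegLT K P)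
    (x ξ : Fin n → ℝ) (τ : ℝ) :
    evalSymbol P x (τ • ξ) = ∑ e ∈ Finset.range K, (τ : ℂ) ^ e * evalSymbol (homPart n e P) x ξ :=
        by
  rw [evalSymbol_smul_right, sum_homPart hP, ← evalSymbolₗ_apply, map_sum]
  exact Finset.sum_congr rfl fun e _ => by rw [map_smul]; rfl

theorem isHomogeneous_iff_homPart {k : ℕ} {P : LocalSymbol n} :
    P.IsHomogeneous k ↔ homPart n k P = P := by
  constructor
  · intro h
    ext1 s
    rw [coeff_homPart]
    split_ifs with hs
    · rfl
    · by_contra hne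
      exact hs ((Finsupp.degree_eq_weight_one (R := ℕ)) ▸ h (Ne.symm hne))
  · intro h s hs
    rw [← h, coeff_homPart] at hs
    have : s.degree = k := by
      by_contra hne
      exact hs (if_neg hne)
    rw [← this, Finsupp.degree_eq_weight_one]
    rfl

/-! ### Global symbols -/

theorem pullCovector_smul (g h : SL(n + 1, ℝ)) (x η : Fin n → ℝ) (τ : ℝ) :
    pullCovector g h x (τ • η) = τ • pullCovector g h x η := by
  funext j
  simp [pullCovector, Finset.mul_sum, mul_assoc]

theorem eq_of_forall_sum_pow {K : ℕ} {a b : ℕ → ℂ}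
    (h : ∀ τ : ℝ, ∑ e ∈ Finset.range K, (τ : ℂ) ^ e * a e = ∑ e ∈ Finset.range K, (τ : ℂ) ^ e * b e)
    {e : ℕ} (he : e < K) : a e = b e := by
  have h1 : (∑ e ∈ Finset.range K, Polynomial.monomial e (a e))
      = ∑ e ∈ Finset.range K, Polynomial.monomial e (b e) := by
    refine Polynomial.eq_of_infinite_eval_eq _ _ ((Set.infinite_range_of_injective
      Complex.ofReal_injective).mono ?_)
    rintro _ ⟨τ, rfl⟩
    have := h τ
    simpa only [Set.mem_ofPred_eq, Polynomial.eval_finsetSum, Polynomial.eval_monomial, mul_comm]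
      using this
  have h2 := congrArg (fun p => p.coeff e) h1
  simpa [Polynomial.finsetSum_coeff, Polynomial.coeff_monomial, he] using h2

/-- Covectors transform linearly. Replacing η by τη in the transformation rule and comparing
coefficients of τᵉ gives the rule for each component. -/
theorem homPart_mem_symb {del : ℂ} (P : Symb n del) (e : ℕ) :
    (fun g => homPart n e (P.1 g)) ∈ Symb n del := by
  intro g h x y exy η
  obtain ⟨K, heK, hg, hh⟩ : ∃ K, e < K ∧ DegLT K (P.1 g) ∧ DegLT K (P.1 h) :=
    ⟨max (e + 1) (max ((P.1 g).totalDegree + 1) ((P.1 h).totalDegree + 1)), by simp,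
      (degLT_totalDegree _).mono (by simp), (degLT_totalDegree _).mono (by simp)⟩
  refine eq_of_forall_sum_pow (K := K)
    (a := fun e => evalSymbol (homPart n e (P.1 g)) x (pullCovector g h x η))
    (b := fun e => (jac g h x : ℂ) ^ del * evalSymbol (homPart n e (P.1 h)) y η) (fun τ => ?_) heK
  have h1 := P.2 g h x y exy (τ • η)
  rw [pullCovector_smul, evalSymbol_smul_right_eq_sum hg, evalSymbol_smul_right_eq_sum hh,
    Finset.mul_sum] at h1
  rw [h1]
  exact Finset.sum_congr rfl fun e _ => by ring

/-- The homogeneous component of degree `e` of a symbol on the sphere. -/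
def symbPart {del : ℂ} (e : ℕ) (P : Symb n del) : Symb n del :=
  ⟨fun g => homPart n e (P.1 g), homPart_mem_symb P e⟩

/-! ### Finite covers of the sphere by affine charts -/

/-- A transvection adds to coordinate 0 a multiple of another nonzero coordinate and makes it 1. If
only coordinate 0 is nonzero, a first transvection copies it elsewhere; this needs n ≥ 1, and for n
= 0 the group is trivial. -/
theorem exists_act_zero_pos (hn : 1 ≤ n) {v : Fin (n + 1) → ℝ} (hv : v ≠ 0) :
    ∃ g : SL(n + 1, ℝ), 0 < act g v 0 := by
  have key : ∀ (w : Fin (n + 1) → ℝ) (i : Fin (n + 1)), i ≠ 0 → w i ≠ 0 →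
      ∃ g : SL(n + 1, ℝ), 0 < act g w 0 := by
    intro w i hi hw
    refine ⟨Matrix.SpecialLinearGroup.transvection hi.symm ((1 - w 0) / w i), ?_⟩
    have : act (Matrix.SpecialLinearGroup.transvection hi.symm ((1 - w 0) / w i)) w 0 = 1 := by
      simp [act, Matrix.SpecialLinearGroup.transvection_coe, Matrix.add_mulVec,
        Matrix.single_mulVec_eq]
      field_simp
      ring
    rw [this]
    exact one_pos
  by_cases h : ∃ i, i ≠ 0 ∧ v i ≠ 0
  · obtain ⟨i, hi, hw⟩ := h
    exact key v i hi hw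
  · push Not at h
    have h0 : v 0 ≠ 0 := by
      intro h0
      apply hv
      funext i
      by_cases hi : i = 0
      · rw [hi, h0]; rfl
      · exact h i hi
    have h1 : (⟨1, by omega⟩ : Fin (n + 1)) ≠ 0 := by
      intro e
      simpa using congrArg Fin.val e
    set t : SL(n + 1, ℝ) := Matrix.SpecialLinearGroup.transvection h1 1
    have h2 : act t v ⟨1, by omega⟩ ≠ 0 := by
      have : act t v ⟨1, by omega⟩ = v ⟨1, by omega⟩ + v 0 := by
        simp [t, act, Matrix.SpecialLinearGroup.transvection_coe, Matrix.add_mulVec,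
          Matrix.single_mulVec_eq]
      rw [this, h _ h1, zero_add]
      exact h0
    obtain ⟨g, hg⟩ := key _ _ h1 h2
    exact ⟨g * t, by rwa [act_mul]⟩

theorem exists_chart_eq_of_pos {g : SL(n + 1, ℝ)} {p : Sph n} (h : 0 < act g⁻¹ p.1.ofLp 0) :
    ∃ x, chart g x = p := by
  refine ⟨fun i => (act g⁻¹ p.1.ofLp 0)⁻¹ * act g⁻¹ p.1.ofLp i.succ, ?_⟩
  have h1 : (act g⁻¹ p.1.ofLp 0)⁻¹ • p.1.ofLp ≠ 0 :=
    smul_ne_zero (inv_ne_zero h.ne') (toSph_ne_zero p)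
  have h2 : lift g (fun i => (act g⁻¹ p.1.ofLp 0)⁻¹ * act g⁻¹ p.1.ofLp i.succ)
      = (act g⁻¹ p.1.ofLp 0)⁻¹ • p.1.ofLp := by
    have h3 : (Fin.cons 1 (fun i => (act g⁻¹ p.1.ofLp 0)⁻¹ * act g⁻¹ p.1.ofLp i.succ)
        : Fin (n + 1) → ℝ) = (act g⁻¹ p.1.ofLp 0)⁻¹ • act g⁻¹ p.1.ofLp := by
      funext a
      refine Fin.cases ?_ (fun i => ?_) a
      · simp [h.ne']
      · simp
    rw [lift, h3, act_smul, ← act_mul, mul_inv_cancel, act_one]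
  conv_rhs => rw [← toSph_self p, ← toSph_smul _ (toSph_ne_zero p) (inv_pos.mpr h) h1]
  rw [chart_eq_toSph]
  congr 1

/-- Compactness of the sphere, used to bound degrees and orders uniformly over the infinitely many
charts. -/
theorem exists_finite_cover (hn : 1 ≤ n) :
    ∃ T : Finset SL(n + 1, ℝ), ∀ p : Sph n, ∃ g ∈ T, ∃ x, chart g x = p := by
  have hopen : ∀ g : SL(n + 1, ℝ), IsOpen {p : Sph n | 0 < act g⁻¹ p.1.ofLp 0} := by
    intro g
    refine isOpen_lt continuous_const ?_
    have : ∀ p : Sph n, act g⁻¹ p.1.ofLp 0 = ∑ j, (g⁻¹).1 0 j * p.1 j := fun p => rfl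
    simp only [this]
    fun_prop
  obtain ⟨T, hT⟩ := isCompact_univ.elim_finite_subcover
    (fun g : SL(n + 1, ℝ) => {p : Sph n | 0 < act g⁻¹ p.1.ofLp 0}) hopen (by
      intro p _
      obtain ⟨g, hg⟩ := exists_act_zero_pos hn (toSph_ne_zero p)
      exact Set.mem_iUnion.mpr ⟨g⁻¹, by simpa using hg⟩)
  refine ⟨T, fun p => ?_⟩
  obtain ⟨g, hg, hp⟩ := Set.mem_iUnion₂.mp (hT (Set.mem_univ p))
  exact ⟨g, hg, exists_chart_eq_of_pos hp⟩

/-- The largest degree over a finite cover suffices: a homogeneous component that vanishes in the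
covering charts vanishes in every chart, since the Jacobian factor on overlaps is nonzero. -/
theorem exists_degLT_symb (hn : 1 ≤ n) {del : ℂ} (P : Symb n del) :
    ∃ K, ∀ g, DegLT K (P.1 g) := by
  obtain ⟨T, hT⟩ := exists_finite_cover hn
  refine ⟨T.sup fun h => (P.1 h).totalDegree + 1, fun g => ?_⟩
  set K := T.sup fun h => (P.1 h).totalDegree + 1 with hK
  have key : ∀ e, K ≤ e → homPart n e (P.1 g) = 0 := by
    intro e he
    refine eq_zero_of_evalSymbol fun x ξ => ?_
    obtain ⟨h, hh, y, hy⟩ := hT (chart g x)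
    have h1 := homPart_mem_symb P e h g y x hy ξ
    have h2 : homPart n e (P.1 h) = 0 := by
      ext1 s
      rw [coeff_homPart, coeff_zero]
      split_ifs with hs
      · refine degLT_totalDegree (P.1 h) s ?_
        rw [hs]
        exact (Finset.le_sup (f := fun h => (P.1 h).totalDegree + 1) hh).trans he
      · rfl
    simp only [h2, ← evalSymbolₗ_apply, map_zero] at h1
    have h3 : ((jac h g y : ℝ) : ℂ) ^ del ≠ 0 := by
      obtain ⟨r, hr, e⟩ := (chart_eq_iff h g y x).mp hy
      rw [jac_cpow hr e]
      exact Complex.exp_ne_zero _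
    exact (mul_eq_zero.mp h1.symm).resolve_left h3
  intro s hs
  have := congrArg (coeff s) (key _ hs)
  rwa [coeff_homPart, if_pos rfl, coeff_zero] at this

theorem sum_symbPart {del : ℂ} {K : ℕ} {P : Symb n del} (hP : ∀ g, DegLT K (P.1 g)) :
    P = ∑ e ∈ Finset.range K, symbPart e P := by
  apply Subtype.ext
  funext g
  have h1 := sum_homPart (hP g) 1
  rw [← diagHom_apply, map_one] at h1
  simp only [Module.End.one_apply, Pi.one_apply, one_smul] at h1
  rw [h1, AddSubmonoidClass.coe_finsetSum, Finset.sum_apply]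
  rfl

/-! ### Interpolation -/

/-- On polynomials of bounded degree, a coefficient is a linear combination of values at real
points. -/
theorem exists_coeff_eq_sum_eval (n K : ℕ) (s : Fin n →₀ ℕ) :
    ∃ w : (Fin n → ℝ) →₀ ℂ, ∀ p : MvPolynomial (Fin n) ℂ, p.totalDegree ≤ K →
      p.coeff s = w.sum fun ξ c => c * eval (fun i => (ξ i : ℂ)) p := by
  let V := restrictTotalDegree (Fin n) ℂ K
  let ev : (Fin n → ℝ) → Module.Dual ℂ V := fun ξ =>
    (aeval (fun i => (ξ i : ℂ))).toLinearMap.comp V.subtype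
  have hev : ∀ ξ (p : V), ev ξ p = eval (fun i => (ξ i : ℂ)) p.1 := fun ξ p => by
    simp [ev, aeval_eq_eval]
  -- Real points separate polynomials, so the evaluations have zero common kernel and span the dual
  -- of a finite-dimensional space.
  have htop : Submodule.span ℂ (Set.range ev) = ⊤ := by
    have h1 : (Submodule.span ℂ (Set.range ev)).dualCoannihilator = ⊥ := by
      rw [eq_bot_iff]
      intro p hp
      rw [Submodule.mem_dualCoannihilator] at hp
      rw [Submodule.mem_bot]
      apply Subtype.ext
      refine eq_zero_of_eval_real fun ξ => ?_
      rw [← hev]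
      exact hp _ (Submodule.subset_span ⟨ξ, rfl⟩)
    have h2 := Subspace.dualCoannihilator_dualAnnihilator_eq
      (W := Submodule.span ℂ (Set.range ev))
    rw [h1, Submodule.dualAnnihilator_bot] at h2
    exact h2.symm
  have hmem : ((lcoeff ℂ s).comp V.subtype : Module.Dual ℂ V)
      ∈ Submodule.span ℂ (Set.range ev) := by
    rw [htop]
    trivial
  obtain ⟨w, hw⟩ := Finsupp.mem_span_range_iff_exists_finsupp.mp hmem
  refine ⟨w, fun p hp => ?_⟩
  have := congrArg (fun T => T (⟨p, (mem_restrictTotalDegree _ _ _).mpr hp⟩ : V)) hw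
  simp [Finsupp.sum, hev] at this
  rw [← this, Finsupp.sum]

/-! ### One-parameter families of smooth functions -/

/-- The family `u` of smooth functions is smooth in all variables, with time derivative `u'`. -/
def HasTimeDeriv (u u' : ℝ → SmoothFun n) : Prop :=
  ContDiff ℝ ∞ (fun p : ℝ × (Fin n → ℝ) => (u p.1).1 p.2) ∧
    ∀ t x, HasDerivAt (fun τ => (u τ).1 x) ((u' t).1 x) t

theorem HasTimeDeriv.add {u u' v v' : ℝ → SmoothFun n} (hu : HasTimeDeriv u u')
    (hv : HasTimeDeriv v v') : HasTimeDeriv (fun t => u t + v t) (fun t => u' t + v' t) :=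
  ⟨hu.1.add hv.1, fun t x => (hu.2 t x).add (hv.2 t x)⟩

theorem HasTimeDeriv.mul {u u' v v' : ℝ → SmoothFun n} (hu : HasTimeDeriv u u')
    (hv : HasTimeDeriv v v') :
    HasTimeDeriv (fun t => u t * v t) (fun t => u' t * v t + u t * v' t) :=
  ⟨hu.1.mul hv.1, fun t x => (hu.2 t x).mul (hv.2 t x)⟩

theorem HasTimeDeriv.smul {u u' : ℝ → SmoothFun n} (c : ℂ) (hu : HasTimeDeriv u u') :
    HasTimeDeriv (fun t => c • u t) (fun t => c • u' t) :=
  ⟨hu.1.const_smul c, fun t x => (hu.2 t x).const_smul c⟩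

theorem HasTimeDeriv.zero : HasTimeDeriv (fun _ => (0 : SmoothFun n)) (fun _ => 0) :=
  ⟨contDiff_const, fun _ _ => hasDerivAt_const _ _⟩

theorem HasTimeDeriv.sum {ι : Type*} (S : Finset ι) {u u' : ι → ℝ → SmoothFun n}
    (hu : ∀ i ∈ S, HasTimeDeriv (u i) (u' i)) :
    HasTimeDeriv (fun t => ∑ i ∈ S, u i t) (fun t => ∑ i ∈ S, u' i t) := by
  classical
  induction S using Finset.induction_on with
  | empty => simpa using HasTimeDeriv.zero
  | insert a S ha ih =>
    simp only [Finset.sum_insert ha]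
    exact (hu a (Finset.mem_insert_self a S)).add (ih fun i hi => hu i
      (Finset.mem_insert_of_mem hi))

/-- Time and space derivatives commute by symmetry of the second derivative of the joint function.
For this reason `HasTimeDeriv` asks for smoothness in all variables together. -/
theorem HasTimeDeriv.partialD {u u' : ℝ → SmoothFun n} (hu : HasTimeDeriv u u') (i : Fin n) :
    HasTimeDeriv (fun t => partialD i (u t)) (fun t => partialD i (u' t)) := by
  set U : ℝ × (Fin n → ℝ) → ℂ := fun p => (u p.1).1 p.2 with hU
  have hd : ∀ p, DifferentiableAt ℝ U p := fun p => hu.1.differentiable (by simp) p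
  have hU' : ContDiff ℝ ∞ (fderiv ℝ U) := hu.1.fderiv_right (m := ∞) (by simp)
  have hd' : ∀ p, DifferentiableAt ℝ (fderiv ℝ U) p := fun p => hU'.differentiable (by simp) p
  have hx : ∀ t x, (ProjQuant.partialD i (u t)).1 x = fderiv ℝ U (t, x) (0, Pi.single i 1) := by
    intro t x
    rw [partialD_apply]
    have h1 : HasFDerivAt (fun z : Fin n → ℝ => (t, z)) (ContinuousLinearMap.inr ℝ ℝ
        (Fin n → ℝ)) x :=
      hasFDerivAt_prodMk_right t x
    have h2 := (hd (t, x)).hasFDerivAt.comp x h1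
    have h3 : (u t).1 = U ∘ fun z => (t, z) := rfl
    rw [h3, h2.fderiv]
    simp
  have ht : ∀ t x, (u' t).1 x = fderiv ℝ U (t, x) (1, 0) := by
    intro t x
    have h1 : HasDerivAt (fun τ : ℝ => (τ, x)) ((1 : ℝ), (0 : Fin n → ℝ)) t :=
      (hasDerivAt_id t).prodMk (hasDerivAt_const t x)
    have h2 := (hd (t, x)).hasFDerivAt.comp_hasDerivAt t h1
    exact (hu.2 t x).unique h2
  refine ⟨?_, fun t x => ?_⟩
  · have h1 : (fun p : ℝ × (Fin n → ℝ) => (ProjQuant.partialD i (u p.1)).1 p.2)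
        = fun p => fderiv ℝ U p (0, Pi.single i 1) := funext fun p => hx p.1 p.2
    rw [h1]
    exact hU'.clm_apply contDiff_const
  · have h1 : HasDerivAt (fun τ : ℝ => (τ, x)) ((1 : ℝ), (0 : Fin n → ℝ)) t :=
      (hasDerivAt_id t).prodMk (hasDerivAt_const t x)
    have h2' := (hd' (t, x)).hasFDerivAt.clm_apply
      (hasFDerivAt_const ((0 : ℝ), (Pi.single i 1 : Fin n → ℝ)) (t, x))
    have h2 := h2'.comp_hasDerivAt t h1
    have h3 : (ProjQuant.partialD i (u' t)).1 x
        = fderiv ℝ (fderiv ℝ U) (t, x) (1, 0) (0, Pi.single i 1) := by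
      rw [partialD_apply]
      have h4 : (u' t).1 = (fun p => fderiv ℝ U p (1, 0)) ∘ fun z => (t, z) :=
        funext fun z => ht t z
      have h5 : HasFDerivAt (fun z : Fin n → ℝ => (t, z))
          (ContinuousLinearMap.inr ℝ ℝ (Fin n → ℝ)) x := hasFDerivAt_prodMk_right t x
      have h6 := ((hd' (t, x)).hasFDerivAt.clm_apply
        (hasFDerivAt_const ((1 : ℝ), (0 : Fin n → ℝ)) (t, x))).comp x h5
      rw [h4, h6.fderiv]
      have hs : IsSymmSndFDerivAt ℝ U (t, x) := (hu.1.contDiffAt).isSymmSndFDerivAt (by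
        rw [minSmoothness_of_isRCLikeNormedField]
        exact WithTop.coe_le_coe.mpr (le_top : (2 : ℕ∞) ≤ ⊤))
      simpa using hs _ _
    rw [h3]
    simp only [hx]
    have h7 : ((fderiv ℝ U (t, x)).comp (0 : ℝ × (Fin n → ℝ) →L[ℝ] ℝ × (Fin n → ℝ))
        + (fderiv ℝ (fderiv ℝ U) (t, x)).flip (0, Pi.single i 1)) (1, 0)
        = fderiv ℝ (fderiv ℝ U) (t, x) (1, 0) (0, Pi.single i 1) := by simp
    rw [← h7]
    exact h2

theorem HasTimeDeriv.partialMulti {u u' : ℝ → SmoothFun n} (hu : HasTimeDeriv u u')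
    (s : Fin n →₀ ℕ) :
    HasTimeDeriv (fun t => partialMulti s (u t)) (fun t => partialMulti s (u' t)) := by
  induction hk : s.degree generalizing s u u' with
  | zero =>
    have hs : s = 0 := (Finsupp.degree_eq_zero_iff s).mp hk
    subst hs
    simpa [partialMulti_zero] using hu
  | succ k ih =>
    have hs : s ≠ 0 := by
      rintro rfl
      simp at hk
    obtain ⟨i, hi⟩ := Finsupp.ne_iff.mp hs
    have h1 : s - Finsupp.single i 1 + Finsupp.single i 1 = s := by
      apply tsub_add_cancel_of_le
      rw [Finsupp.single_le_iff]
      exact Nat.one_le_iff_ne_zero.mpr hi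
    rw [← h1, map_add, Finsupp.degree_single] at hk
    rw [← h1, partialMulti_add_single]
    exact ih (hu.partialD i) _ (by omega)

/-- The same for families of symbols. -/
def HasTimeDerivSymb (P P' : ℝ → LocalSymbol n) : Prop :=
  (∃ K, ∀ t, DegLT K (P t) ∧ DegLT K (P' t)) ∧
    ∀ s, HasTimeDeriv (fun t => (P t).coeff s) (fun t => (P' t).coeff s)

theorem HasTimeDerivSymb.diagOp {P P' : ℝ → LocalSymbol n} (hP : HasTimeDerivSymb P P')
    (φ : ℕ → ℂ) : HasTimeDerivSymb (fun t => diagOp n φ (P t)) (fun t => diagOp n φ (P' t)) := by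
  obtain ⟨⟨K, hK⟩, hP⟩ := hP
  refine ⟨⟨K, fun t => ⟨(hK t).1.diagOp φ, (hK t).2.diagOp φ⟩⟩, fun s => ?_⟩
  simpa only [coeff_diagOp] using (hP s).smul (φ s.degree)

theorem HasTimeDerivSymb.divOp {P P' : ℝ → LocalSymbol n} (hP : HasTimeDerivSymb P P') :
    HasTimeDerivSymb (fun t => divOp n (P t)) (fun t => divOp n (P' t)) := by
  obtain ⟨⟨K, hK⟩, hP⟩ := hP
  refine ⟨⟨K, fun t => ⟨DegLT.divOp ((hK t).1.mono (Nat.le_succ K)),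
    DegLT.divOp ((hK t).2.mono (Nat.le_succ K))⟩⟩, fun s => ?_⟩
  simp only [divOp_apply, coeff_sum, coeff_symbolDx, coeff_symbolDxi]
  exact HasTimeDeriv.sum _ fun i _ => ((hP _).smul _).partialD i

theorem HasTimeDerivSymb.divOp_pow {P P' : ℝ → LocalSymbol n} (hP : HasTimeDerivSymb P P')
    (m : ℕ) : HasTimeDerivSymb (fun t => (ProjQuant.divOp n ^ m) (P t))
      (fun t => (ProjQuant.divOp n ^ m) (P' t)) := by
  induction m with
  | zero => simpa using hP
  | succ m ih =>
    simp only [pow_succ', Module.End.mul_apply]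
    exact ih.divOp

theorem HasTimeDerivSymb.quantSymb {P P' : ℝ → LocalSymbol n} (hP : HasTimeDerivSymb P P')
    (lam del c : ℂ) :
    HasTimeDerivSymb (fun t => quantSymb n lam del c (P t)) (fun t => quantSymb n lam del c
        (P' t)) := by
  obtain ⟨K, hK⟩ := hP.1
  have h1 : (fun t => ProjQuant.quantSymb n lam del c (P t)) = fun t =>
      quantTrunc n lam del c K (P t) :=
    funext fun t => quantSymb_eq _ _ _ (hK t).1
  have h2 : (fun t => ProjQuant.quantSymb n lam del c (P' t)) = fun t =>
      quantTrunc n lam del c K (P' t) :=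
    funext fun t => quantSymb_eq _ _ _ (hK t).2
  rw [h1, h2]
  refine ⟨⟨K, fun t => ⟨?_, ?_⟩⟩, fun s => ?_⟩
  · change DegLT K (quantTrunc n lam del c K (P t))
    rw [quantTrunc_apply]
    exact DegLT.sum fun m _ => DegLT.smul _ (DegLT.diagOp _
      (DegLT.divOp_pow ((hK t).1.mono (Nat.le_add_right K m))))
  · change DegLT K (quantTrunc n lam del c K (P' t))
    rw [quantTrunc_apply]
    exact DegLT.sum fun m _ => DegLT.smul _ (DegLT.diagOp _
      (DegLT.divOp_pow ((hK t).2.mono (Nat.le_add_right K m))))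
  · simp only [quantTrunc_apply, coeff_sum, coeff_smul]
    exact HasTimeDeriv.sum _ fun m _ => (((hP.divOp_pow m).diagOp _).2 s).smul _

theorem applyOp_eq_sum_of_degLT (c : ℂ) {K : ℕ} {P : LocalSymbol n} (hP : DegLT K P)
    (f : SmoothFun n) :
    applyOp c P f = ∑ s ∈ (Finsupp.finite_of_degree_le (σ := Fin n) K).toFinset,
      c ^ s.degree • (P.coeff s * partialMulti s f) := by
  refine applyOp_eq_sum c P f _ fun s hs => ?_
  rw [Set.Finite.mem_toFinset, Set.mem_ofPred_eq]
  by_contra h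
  exact mem_support_iff.mp hs (hP s (by omega))

/-- The degree bound uniform in time allows one fixed finite set of multi-indices, and the product
rule applies to each term. -/
theorem HasTimeDerivSymb.applyOp {P P' : ℝ → LocalSymbol n} (hP : HasTimeDerivSymb P P')
    {f f' : ℝ → SmoothFun n} (hf : HasTimeDeriv f f') (c : ℂ) :
    HasTimeDeriv (fun t => applyOp c (P t) (f t))
      (fun t => applyOp c (P' t) (f t) + applyOp c (P t) (f' t)) := by
  obtain ⟨⟨K, hK⟩, hP⟩ := hP
  simp only [applyOp_eq_sum_of_degLT c (hK _).1, applyOp_eq_sum_of_degLT c (hK _).2,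
    ← Finset.sum_add_distrib, ← smul_add]
  exact HasTimeDeriv.sum _ fun s _ => ((hP s).mul (hf.partialMulti s)).smul _

/-! ### Right translation of the chart -/

/-- The affine coordinates of `a (1, x)`. -/
def projPoint (a : SL(n + 1, ℝ)) (x : Fin n → ℝ) : Fin n → ℝ :=
  fun i => lift a x i.succ / lift a x 0

/-- The covector at `projPoint a x` that corresponds to the covector `ξ` at `x`. -/
def projCovector (a : SL(n + 1, ℝ)) (x ξ : Fin n → ℝ) : Fin n → ℝ :=
  fun j => lift a x 0 * ∑ i, ξ i * ((a⁻¹).1 i.succ j.succ - x i * (a⁻¹).1 0 j.succ)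

theorem lift_mul_projPoint (g : SL(n + 1, ℝ)) {a : SL(n + 1, ℝ)} {x : Fin n → ℝ}
    (hr : 0 < lift a x 0) : lift (g * a) x = lift a x 0 • lift g (projPoint a x) := by
  rw [lift_mul]
  rw [lift.eq_def g, ← act_smul]
  congr 1
  funext i
  refine Fin.cases ?_ (fun i => ?_) i
  · simp
  · simp only [Pi.smul_apply, Fin.cons_succ, projPoint, smul_eq_mul]
    field_simp

/-- Right translation by `a` changes the chart and keeps the density, which is thus composed with
the projective map of `a` and multiplied by a Jacobian factor. Differentiating in `a` will produce
the Lie derivative. -/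
theorem density_mul_right {lam : ℂ} (f : Density n lam) (g : SL(n + 1, ℝ)) {a : SL(n + 1, ℝ)}
    {x : Fin n → ℝ} (hr : 0 < lift a x 0) :
    (f.1 (g * a)).1 x
      = Complex.exp (-((n + 1) * lam * Real.log (lift a x 0))) * (f.1 g).1 (projPoint a x) := by
  have e := lift_mul_projPoint g hr
  rw [f.2 (g * a) g x (projPoint a x) ((chart_eq_iff _ _ _ _).mpr ⟨_, hr, e⟩), jac_cpow hr e]

theorem symb_mul_right {del : ℂ} (P : Symb n del) (g : SL(n + 1, ℝ)) {a : SL(n + 1, ℝ)}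
    {x : Fin n → ℝ} (hr : 0 < lift a x 0) (ξ : Fin n → ℝ) :
    evalSymbol (P.1 (g * a)) x ξ = Complex.exp (-((n + 1) * del * Real.log (lift a x 0)))
      * evalSymbol (P.1 g) (projPoint a x) (projCovector a x ξ) := by
  have e : lift g (projPoint a x) = (lift a x 0)⁻¹ • lift (g * a) x := by
    rw [lift_mul_projPoint g hr, smul_smul, inv_mul_cancel₀ hr.ne', one_smul]
  have hr' := inv_pos.mpr hr
  -- The rule pulls covectors back, so the overlap is read from `g` to `g * a`, with the inverse
  -- scaling, in order to have ξ as the given covector at `x`.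
  have h1 := P.2 g (g * a) (projPoint a x) x ((chart_eq_iff _ _ _ _).mpr ⟨_, hr', e⟩) ξ
  have h2 : pullCovector g (g * a) (projPoint a x) ξ = projCovector a x ξ := by
    funext j
    rw [pullCovector_eq hr' e, projCovector, inv_inv, mul_inv_rev, inv_mul_cancel_right]
  rw [h2, jac_cpow hr' e, Real.log_inv] at h1
  rw [h1, ← mul_assoc, ← Complex.exp_add]
  simp

/-! ### Derivatives along curves -/

theorem fderiv_eq_sum_partialD (f : SmoothFun n) (x v : Fin n → ℝ) :
    fderiv ℝ f.1 x v = ∑ i, (v i : ℂ) * (partialD i f).1 x := by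
  conv_lhs => rw [← Finset.univ_sum_single v]
  rw [map_sum]
  refine Finset.sum_congr rfl fun i _ => ?_
  rw [partialD_apply]
  have : (Pi.single i (v i) : Fin n → ℝ) = v i • Pi.single i (1 : ℝ) := by
    rw [← Pi.single_smul]
    simp
  rw [this, map_smul]
  simp

theorem hasDerivAt_smoothFun_comp (f : SmoothFun n) {y : ℝ → Fin n → ℝ} {y' : Fin n → ℝ} {t : ℝ}
    (hy : HasDerivAt y y' t) :
    HasDerivAt (fun τ => f.1 (y τ)) (∑ i, (y' i : ℂ) * (partialD i f).1 (y t)) t := by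
  rw [← fderiv_eq_sum_partialD]
  exact (differentiableAt_smoothFun f (y t)).hasFDerivAt.comp_hasDerivAt t hy

theorem hasDerivAt_evalSymbol_comp (P : LocalSymbol n) {y ζ : ℝ → Fin n → ℝ} {y' ζ' : Fin n → ℝ}
    {t : ℝ} (hy : HasDerivAt y y' t) (hζ : HasDerivAt ζ ζ' t) :
    HasDerivAt (fun τ => evalSymbol P (y τ) (ζ τ))
      (∑ i, (y' i : ℂ) * evalSymbol (symbolDx i P) (y t) (ζ t)
        + ∑ j, (ζ' j : ℂ) * evalSymbol (symbolDxi j P) (y t) (ζ t)) t := by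
  induction P using MvPolynomial.induction_on with
  | C a =>
    simp only [evalSymbol_C, symbolDx_C, symbolDxi_C]
    refine (hasDerivAt_smoothFun_comp a hy).congr_deriv ?_
    simp [← evalSymbolₗ_apply]
  | add p q hp hq =>
    simp only [evalSymbol_add, map_add, mul_add, Finset.sum_add_distrib]
    refine (hp.add hq).congr_deriv ?_
    ring
  | mul_X p k hp =>
    have hk : HasDerivAt (fun τ => ((ζ τ k : ℝ) : ℂ)) (ζ' k : ℂ) t :=
      ((hasDerivAt_pi.mp hζ) k).ofReal_comp
    simp only [evalSymbol_mul_X, symbolDx_mul_X, symbolDxi_mul_X, evalSymbol_add]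
    refine (hp.mul hk).congr_deriv ?_
    simp only [mul_add, Finset.sum_add_distrib, add_mul, Finset.sum_mul, mul_assoc]
    have : ∀ j, evalSymbol (if j = k then p else 0) (y t) (ζ t)
        = if j = k then evalSymbol p (y t) (ζ t) else 0 := fun j => by
      split_ifs
      · rfl
      · rw [← evalSymbolₗ_apply, map_zero]
    simp [this, mul_comm, add_assoc]

theorem contDiffAt_evalSymbol_comp {E : Type*} [NormedAddCommGroup E] [NormedSpace ℝ E]
    (P : LocalSymbol n) {y ζ : E → Fin n → ℝ} {z : E} (hy : ContDiffAt ℝ ∞ y z)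
    (hζ : ContDiffAt ℝ ∞ ζ z) : ContDiffAt ℝ ∞ (fun p => evalSymbol P (y p) (ζ p)) z := by
  induction P using MvPolynomial.induction_on with
  | C a =>
    simp only [evalSymbol_C]
    exact (contDiff_smoothFun a).contDiffAt.comp z hy
  | add p q hp hq =>
    simp only [evalSymbol_add]
    exact hp.add hq
  | mul_X p k hp =>
    simp only [evalSymbol_mul_X]
    exact hp.mul (Complex.ofRealCLM.contDiff.contDiffAt.comp z (contDiffAt_pi.mp hζ k))

theorem headFun_apply (Y : Matrix (Fin (n + 1)) (Fin (n + 1)) ℝ) (x : Fin n → ℝ) :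
    (headFun Y).1 x = ((Y 0 0 + ∑ j : Fin n, Y 0 j.succ * x j : ℝ) : ℂ) := by
  simp [headFun, coordFun_apply]

theorem divField_projField (Y : Matrix (Fin (n + 1)) (Fin (n + 1)) ℝ) (x : Fin n → ℝ) :
    (divField (projField Y)).1 x
      = ((Y.trace - (n + 1) * (Y 0 0 + ∑ j : Fin n, Y 0 j.succ * x j) : ℝ) : ℂ) := by
  have h1 : (divField (projField Y)).1 x = ∑ i : Fin n, ((Y i.succ i.succ : ℂ)
      - (headFun Y).1 x - Y 0 i.succ * x i) := by
    simp [divField, partialD_projField, coordFun_apply]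
  rw [h1, headFun_apply]
  simp only [Finset.sum_sub_distrib, Matrix.trace, Fin.sum_univ_succ, Matrix.diag]
  push_cast
  simp
  ring

theorem lieDens_apply (lam : ℂ) (v : Fin n → SmoothFun n) (f : SmoothFun n) (x : Fin n → ℝ) :
    (lieDens lam v f).1 x
      = ∑ i, (v i).1 x * (partialD i f).1 x + lam * ((divField v).1 x * f.1 x) := by
  simp [lieDens]

theorem evalSymbol_lieSymb (del : ℂ) (v : Fin n → SmoothFun n) (P : LocalSymbol n)
    (x ξ : Fin n → ℝ) :
    evalSymbol (lieSymb del v P) x ξ = ∑ i, (v i).1 x * evalSymbol (symbolDx i P) x ξ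
      - ∑ j, (∑ i, (partialD j (v i)).1 x * ξ i) * evalSymbol (symbolDxi j P) x ξ
      + del * ((divField v).1 x * evalSymbol P x ξ) := by
  rw [lieSymb, ← evalSymbolₗ_apply]
  simp only [map_add, map_sub, map_sum, map_smul, evalSymbolₗ_apply, evalSymbol_C_mul, smul_eq_mul,
    mul_assoc, evalSymbol_X_mul, Finset.sum_mul]
  rw [Finset.sum_comm (f := fun i j => (partialD j (v i)).1 x * _)]

section Shear

/-! ### Shears -/

/-- The one-parameter group `1 + t u wᵀ`, where `w · u = 0`. -/
def shear (u w : Fin (n + 1) → ℝ) (h : w ⬝ᵥ u = 0) (t : ℝ) : SL(n + 1, ℝ) :=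
  ⟨1 + t • Matrix.vecMulVec u w, by
    have h1 : t • Matrix.vecMulVec u w
        = Matrix.replicateCol Unit (t • u) * Matrix.replicateRow Unit w := by
      rw [← Matrix.vecMulVec_eq, Matrix.smul_vecMulVec]
    rw [h1, Matrix.det_one_add_replicateCol_mul_replicateRow, dotProduct_smul, h]
    simp⟩

variable {u w : Fin (n + 1) → ℝ} (h : w ⬝ᵥ u = 0)

theorem coe_shear (t : ℝ) : (shear u w h t).1 = 1 + t • Matrix.vecMulVec u w := rfl

theorem shear_apply (t : ℝ) (a b : Fin (n + 1)) :
    (shear u w h t).1 a b = (if a = b then 1 else 0) + t * (u a * w b) := by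
  simp [coe_shear, Matrix.one_apply, Matrix.vecMulVec_apply]

/-- The condition w · u = 0 makes u wᵀ square to zero, so the shear is the exponential of t u wᵀ. -/
theorem shear_add (s t : ℝ) : shear u w h (s + t) = shear u w h s * shear u w h t := by
  apply Subtype.ext
  rw [Matrix.SpecialLinearGroup.coe_mul, coe_shear, coe_shear, coe_shear]
  have h0 : Matrix.vecMulVec u w * Matrix.vecMulVec u w = 0 := by
    rw [Matrix.vecMulVec_mul_vecMulVec, h]
    ext
    simp
  simp only [add_mul, mul_add, one_mul, mul_one, smul_mul_assoc, mul_smul_comm, h0, smul_zero,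
    add_zero, add_smul]
  abel

theorem shear_zero : shear u w h 0 = 1 := by
  apply Subtype.ext
  simp [coe_shear]

theorem shear_inv (t : ℝ) : (shear u w h t)⁻¹ = shear u w h (-t) := by
  rw [inv_eq_iff_mul_eq_one, ← shear_add, add_neg_cancel, shear_zero]

theorem trace_vecMulVec_eq_zero (h : w ⬝ᵥ u = 0) : (Matrix.vecMulVec u w).trace = 0 := by
  rw [Matrix.trace_vecMulVec, dotProduct_comm, h]

theorem lift_shear (t : ℝ) (x : Fin n → ℝ) (a : Fin (n + 1)) :
    lift (shear u w h t) x a = (Fin.cons 1 x : Fin (n + 1) → ℝ) a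
      + t * (u a * (w 0 + ∑ j : Fin n, w j.succ * x j)) := by
  have : lift (shear u w h t) x = (Fin.cons 1 x : Fin (n + 1) → ℝ)
      + t • (Matrix.vecMulVec u w).mulVec (Fin.cons 1 x) := by
    rw [lift, act, coe_shear, Matrix.add_mulVec, Matrix.one_mulVec, Matrix.smul_mulVec]
  rw [this]
  simp [Matrix.mulVec, dotProduct, Fin.sum_univ_succ, Matrix.vecMulVec_apply, mul_add,
    Finset.mul_sum, mul_assoc]

theorem projPoint_shear_zero (x : Fin n → ℝ) : projPoint (shear u w h 0) x = x := by
  funext i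
  simp [projPoint, lift_shear]

theorem projCovector_shear_zero (x ξ : Fin n → ℝ) : projCovector (shear u w h 0) x ξ = ξ := by
  funext i
  simp [projCovector, lift_shear, shear_inv, shear_apply, (Fin.succ_ne_zero i).symm]

theorem hasDerivAt_lift_shear (t : ℝ) (x : Fin n → ℝ) (a : Fin (n + 1)) :
    HasDerivAt (fun τ => lift (shear u w h τ) x a)
      (u a * (w 0 + ∑ j : Fin n, w j.succ * x j)) t := by
  simp only [lift_shear]
  simpa using ((hasDerivAt_id t).mul_const
    (u a * (w 0 + ∑ j : Fin n, w j.succ * x j))).const_add ((Fin.cons 1 x : Fin (n + 1) → ℝ) a)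

theorem hasDerivAt_projPoint_shear (x : Fin n → ℝ) :
    HasDerivAt (fun τ => projPoint (shear u w h τ) x)
      (fun i => (u i.succ - x i * u 0) * (w 0 + ∑ j : Fin n, w j.succ * x j)) 0 := by
  refine hasDerivAt_pi.mpr fun i => ?_
  have h1 := (hasDerivAt_lift_shear h 0 x i.succ).div (hasDerivAt_lift_shear h 0 x 0)
    (by simp [lift_shear])
  refine h1.congr_deriv ?_
  simp [lift_shear]
  ring

theorem hasDerivAt_projCovector_shear (x ξ : Fin n → ℝ) :
    HasDerivAt (fun τ => projCovector (shear u w h τ) x ξ)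
      (fun j => u 0 * (w 0 + ∑ j : Fin n, w j.succ * x j) * ξ j
        - ∑ i, ξ i * (u i.succ - x i * u 0) * w j.succ) 0 := by
  refine hasDerivAt_pi.mpr fun j => ?_
  have h1 : HasDerivAt (fun τ => ∑ i, ξ i * (((shear u w h τ)⁻¹).1 i.succ j.succ
      - x i * ((shear u w h τ)⁻¹).1 0 j.succ))
      (∑ i, ξ i * (-(u i.succ * w j.succ) - x i * (-(u 0 * w j.succ)))) 0 := by
    refine HasDerivAt.fun_sum fun i _ => HasDerivAt.const_mul _ (HasDerivAt.sub ?_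
      (HasDerivAt.const_mul _ ?_))
    all_goals
      simp only [shear_inv, shear_apply]
      exact (((hasDerivAt_id (0 : ℝ)).neg.mul_const _).const_add _).congr_deriv (by ring)
  have h2 := (hasDerivAt_lift_shear h 0 x 0).mul h1
  refine h2.congr_deriv ?_
  simp only [lift_shear, shear_inv, shear_apply]
  simp [sub_eq_add_neg, ← Finset.sum_neg_distrib, (Fin.succ_ne_zero j).symm]
  refine Finset.sum_congr rfl fun i _ => ?_
  ring

theorem hasDerivAt_exp_log_lift_shear (lam : ℂ) (x : Fin n → ℝ) :
    HasDerivAt (fun τ => Complex.exp (-((n + 1) * lam * Real.log (lift (shear u w h τ) x 0))))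
      (-((n + 1) * lam * ((u 0 * (w 0 + ∑ j : Fin n, w j.succ * x j) : ℝ) : ℂ))) 0 := by
  have h1 := (((hasDerivAt_lift_shear h 0 x 0).log (by simp [lift_shear])).ofReal_comp.const_mul
    (((n : ℂ) + 1) * lam)).neg.cexp
  refine h1.congr_deriv ?_
  simp [lift_shear]

theorem projField_vecMulVec (x : Fin n → ℝ) (i : Fin n) :
    (projField (Matrix.vecMulVec u w) i).1 x
      = (((u i.succ - x i * u 0) * (w 0 + ∑ j : Fin n, w j.succ * x j) : ℝ) : ℂ) := by
  simp only [projField, Matrix.vecMulVec_apply, mul_assoc, ← Finset.mul_sum]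
  congr 1
  ring

theorem divField_vecMulVec (h : w ⬝ᵥ u = 0) (x : Fin n → ℝ) :
    (divField (projField (Matrix.vecMulVec u w))).1 x
      = ((-((n + 1) * (u 0 * (w 0 + ∑ j : Fin n, w j.succ * x j))) : ℝ) : ℂ) := by
  rw [divField_projField, trace_vecMulVec_eq_zero h]
  simp only [Matrix.vecMulVec_apply, mul_assoc, ← Finset.mul_sum]
  congr 1
  ring

theorem eventually_lift_shear_pos (t₀ t : ℝ) (x : Fin n → ℝ) (ht : t = t₀) :
    ∀ᶠ p : ℝ × (Fin n → ℝ) in nhds (t, x), 0 < lift (shear u w h (p.1 - t₀)) p.2 0 := by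
  simp only [lift_shear]
  have hc : Continuous fun p : ℝ × (Fin n → ℝ) => (Fin.cons 1 p.2 : Fin (n + 1) → ℝ) 0
      + (p.1 - t₀) * (u 0 * (w 0 + ∑ j : Fin n, w j.succ * p.2 j)) := by
    simp only [Fin.cons_zero]
    fun_prop
  refine hc.continuousAt.eventually_const_lt ?_
  simp [ht]

theorem contDiff_lift_shear (t₀ : ℝ) (a : Fin (n + 1)) :
    ContDiff ℝ ∞ fun p : ℝ × (Fin n → ℝ) => lift (shear u w h (p.1 - t₀)) p.2 a := by
  simp only [lift_shear]
  refine Fin.cases ?_ (fun i => ?_) a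
  · simp only [Fin.cons_zero]
    fun_prop
  · simp only [Fin.cons_succ]
    fun_prop

theorem contDiffAt_exp_log_lift_shear (lam : ℂ) (t₀ : ℝ) (x : Fin n → ℝ) :
    ContDiffAt ℝ ∞ (fun p : ℝ × (Fin n → ℝ) =>
      Complex.exp (-((n + 1) * lam * Real.log (lift (shear u w h (p.1 - t₀)) p.2 0)))) (t₀, x) := by
  have h1 : ContDiffAt ℝ ∞ (fun p : ℝ × (Fin n → ℝ) =>
      Real.log (lift (shear u w h (p.1 - t₀)) p.2 0)) (t₀, x) :=
    (contDiff_lift_shear h t₀ 0).contDiffAt.log (by simp [lift_shear])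
  exact (contDiffAt_const.mul (Complex.ofRealCLM.contDiff.contDiffAt.comp _ h1)).neg.cexp

theorem contDiffAt_projPoint_shear (t₀ : ℝ) (x : Fin n → ℝ) :
    ContDiffAt ℝ ∞ (fun p : ℝ × (Fin n → ℝ) => projPoint (shear u w h (p.1 - t₀)) p.2) (t₀, x) :=
  contDiffAt_pi.mpr fun i => (contDiff_lift_shear h t₀ i.succ).contDiffAt.div
    (contDiff_lift_shear h t₀ 0).contDiffAt (by simp [lift_shear])

theorem contDiffAt_projCovector_shear (t₀ : ℝ) (x ξ : Fin n → ℝ) :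
    ContDiffAt ℝ ∞ (fun p : ℝ × (Fin n → ℝ) =>
      projCovector (shear u w h (p.1 - t₀)) p.2 ξ) (t₀, x) := by
  refine contDiffAt_pi.mpr fun j => (contDiff_lift_shear h t₀ 0).contDiffAt.mul ?_
  simp only [shear_inv, shear_apply]
  apply ContDiff.contDiffAt
  fun_prop

theorem shear_eq_mul_sub (g : SL(n + 1, ℝ)) (t₀ t : ℝ) :
    g * shear u w h t = g * shear u w h t₀ * shear u w h (t - t₀) := by
  rw [mul_assoc, ← shear_add, add_sub_cancel]

/-- Near t₀ the remaining shear by t - t₀ is close to the identity, so `density_mul_right` applies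
in the chart `g * shear u w h t₀`. At t₀ the point moves along the projective field, and the
exponential factor contributes λ times the divergence. -/
theorem hasTimeDeriv_density {lam : ℂ} (f : Density n lam) (g : SL(n + 1, ℝ)) :
    HasTimeDeriv (fun t => f.1 (g * shear u w h t))
      (fun t => lieDens lam (projField (Matrix.vecMulVec u w)) (f.1 (g * shear u w h t))) := by
  have key : ∀ t₀ x, ∀ᶠ p : ℝ × (Fin n → ℝ) in nhds (t₀, x), (f.1 (g * shear u w h p.1)).1 p.2
      = Complex.exp (-((n + 1) * lam * Real.log (lift (shear u w h (p.1 - t₀)) p.2 0)))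
        * (f.1 (g * shear u w h t₀)).1 (projPoint (shear u w h (p.1 - t₀)) p.2) := by
    intro t₀ x
    filter_upwards [eventually_lift_shear_pos h t₀ t₀ x rfl] with p hp
    rw [shear_eq_mul_sub h g t₀ p.1, density_mul_right f _ hp]
  refine ⟨contDiff_iff_contDiffAt.mpr fun ⟨t₀, x⟩ => ?_, fun t₀ x => ?_⟩
  · refine ContDiffAt.congr_of_eventuallyEq ?_ (key t₀ x)
    refine (contDiffAt_exp_log_lift_shear h lam t₀ x).mul ?_
    exact (contDiff_smoothFun _).contDiffAt.comp _ (contDiffAt_projPoint_shear h t₀ x)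
  · have hk := ((continuous_id.prodMk continuous_const).continuousAt (x :=
      t₀)).eventually (key t₀ x)
    refine HasDerivAt.congr_of_eventuallyEq ?_ hk
    have h1 := (hasDerivAt_exp_log_lift_shear h lam x).mul
      (hasDerivAt_smoothFun_comp (f.1 (g * shear u w h t₀)) (hasDerivAt_projPoint_shear h x))
    have h2 := HasDerivAt.comp_sub_const (x := t₀) (a := t₀) (by rw [sub_self]; exact h1)
    refine h2.congr_deriv ?_
    rw [projPoint_shear_zero, lieDens_apply, divField_vecMulVec h]
    simp only [projField_vecMulVec, lift_shear]
    simp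
    ring

theorem hasTimeDeriv_evalSymbol {del : ℂ} (P : Symb n del) (g : SL(n + 1, ℝ)) (ξ : Fin n → ℝ) :
    ContDiff ℝ ∞ (fun p : ℝ × (Fin n → ℝ) => evalSymbol (P.1 (g * shear u w h p.1)) p.2 ξ) ∧
    ∀ t x, HasDerivAt (fun τ => evalSymbol (P.1 (g * shear u w h τ)) x ξ)
      (evalSymbol (lieSymb del (projField (Matrix.vecMulVec u w)) (P.1 (g
          * shear u w h t))) x ξ) t := by
  have key : ∀ t₀ x, ∀ᶠ p : ℝ × (Fin n → ℝ) in nhds (t₀, x),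
      evalSymbol (P.1 (g * shear u w h p.1)) p.2 ξ
      = Complex.exp (-((n + 1) * del * Real.log (lift (shear u w h (p.1 - t₀)) p.2 0)))
        * evalSymbol (P.1 (g * shear u w h t₀)) (projPoint (shear u w h (p.1 - t₀)) p.2)
          (projCovector (shear u w h (p.1 - t₀)) p.2 ξ) := by
    intro t₀ x
    filter_upwards [eventually_lift_shear_pos h t₀ t₀ x rfl] with p hp
    rw [shear_eq_mul_sub h g t₀ p.1, symb_mul_right P _ hp]
  refine ⟨contDiff_iff_contDiffAt.mpr fun ⟨t₀, x⟩ => ?_, fun t₀ x => ?_⟩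
  · refine ContDiffAt.congr_of_eventuallyEq ?_ (key t₀ x)
    refine (contDiffAt_exp_log_lift_shear h del t₀ x).mul ?_
    exact contDiffAt_evalSymbol_comp _ (contDiffAt_projPoint_shear h t₀ x)
      (contDiffAt_projCovector_shear h t₀ x ξ)
  · have hk := ((continuous_id.prodMk continuous_const).continuousAt (x :=
      t₀)).eventually (key t₀ x)
    refine HasDerivAt.congr_of_eventuallyEq ?_ hk
    have h1 := (hasDerivAt_exp_log_lift_shear h del x).mul
      (hasDerivAt_evalSymbol_comp (P.1 (g * shear u w h t₀)) (hasDerivAt_projPoint_shear h x)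
        (hasDerivAt_projCovector_shear h x ξ))
    have h2 := HasDerivAt.comp_sub_const (x := t₀) (a := t₀) (by rw [sub_self]; exact h1)
    refine h2.congr_deriv ?_
    rw [projPoint_shear_zero, projCovector_shear_zero, evalSymbol_lieSymb, divField_vecMulVec h]
    -- The velocity of the transported covector is minus the transposed Jacobian of the field
    -- applied to ξ, as in the second term of `lieSymb`.
    have h3 : ∀ j, ∑ i, (partialD j (projField (Matrix.vecMulVec u w) i)).1 x * ξ i
        = -((u 0 * (w 0 + ∑ j : Fin n, w j.succ * x j) * ξ j
        - ∑ i, ξ i * (u i.succ - x i * u 0) * w j.succ : ℝ) : ℂ) := by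
      intro j
      have : ∀ i, (partialD j (projField (Matrix.vecMulVec u w) i)).1 x = (u i.succ * w j.succ : ℂ)
          - (if j = i then ((u 0 * (w 0 + ∑ j : Fin n, w j.succ * x j) : ℝ) : ℂ) else 0)
          - u 0 * w j.succ * x i := by
        intro i
        rw [partialD_projField]
        have h4 : (headFun (Matrix.vecMulVec u w)).1 x
            = ((u 0 * (w 0 + ∑ j : Fin n, w j.succ * x j) : ℝ) : ℂ) := by
          rw [headFun_apply]
          simp only [Matrix.vecMulVec_apply, mul_assoc, ← Finset.mul_sum, ← mul_add]
        split_ifs <;> simp [coordFun_apply, Matrix.vecMulVec_apply, h4]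
      simp only [this, sub_mul, Finset.sum_sub_distrib, ite_mul, zero_mul, Finset.sum_ite_eq,
        Finset.mem_univ, if_true]
      push_cast
      simp only [mul_sub, sub_mul, Finset.sum_sub_distrib]
      have e1 : ∀ i, (u i.succ : ℂ) * w j.succ * ξ i = ξ i * u i.succ * w j.succ := fun i => by ring
      have e2 : ∀ i, (u 0 : ℂ) * w j.succ * x i * ξ i = ξ i * (x i * u 0) * w j.succ := fun i =>
          by ring
      simp only [e1, e2]
      ring
    simp only [projField_vecMulVec, lift_shear, h3, neg_mul, Finset.sum_neg_distrib, sub_neg_eq_add,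
      Fin.cons_zero, zero_mul, add_zero, Real.log_one, Complex.ofReal_zero, mul_zero, neg_zero,
      Complex.exp_zero, one_mul]
    push_cast
    ring

/-- The transformation rule controls values at covectors only. Because the degree is bounded over
all charts, each coefficient is a fixed finite combination of such values. -/
theorem hasTimeDerivSymb_symb (hn : 1 ≤ n) {del : ℂ} (P : Symb n del) (g : SL(n + 1, ℝ)) :
    HasTimeDerivSymb (fun t => P.1 (g * shear u w h t))
      (fun t => lieSymb del (projField (Matrix.vecMulVec u w)) (P.1 (g * shear u w h t))) := by
  obtain ⟨K, hK⟩ := exists_degLT_symb hn P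
  refine ⟨⟨K, fun t => ⟨hK _, (hK _).lieSymb _ _⟩⟩, fun s => ?_⟩
  obtain ⟨v, hv⟩ := exists_coeff_eq_sum_eval n K s
  have hc : ∀ Q : LocalSymbol n, DegLT K Q → ∀ x, (Q.coeff s).1 x
      = ∑ ξ ∈ v.support, v ξ * evalSymbol Q x ξ := by
    intro Q hQ x
    have h1 := hv (map (evalAt x) Q) ((Finset.sup_mono (support_map_subset _ _)).trans
      (degLT_iff_totalDegree.mp (hQ.mono (Nat.le_succ K))))
    rw [coeff_map, evalAt_apply] at h1
    rw [h1]
    simp only [Finsupp.sum, evalSymbol_eq]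
  refine ⟨?_, fun t x => ?_⟩
  · simp only [hc _ (hK _)]
    exact ContDiff.sum fun ξ _ => contDiff_const.mul (hasTimeDeriv_evalSymbol h P g ξ).1
  · simp only [hc _ (hK _), hc _ ((hK _).lieSymb _ _)]
    exact HasDerivAt.fun_sum fun ξ _ => ((hasTimeDeriv_evalSymbol h P g ξ).2 t x).const_mul _

end Shear

section Affine

/-! ### Affine changes of coordinates -/

/-- Pull-back of functions by the affine map `x ↦ A x + v`. -/
def affComp (A : Matrix (Fin n) (Fin n) ℝ) (v : Fin n → ℝ) : SmoothFun n →ₐ[ℂ] SmoothFun n where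
  toFun f := ⟨fun x => f.1 (A.mulVec x + v), by
    have h1 : ContDiff ℝ ∞ fun x : Fin n → ℝ => A.mulVec x + v :=
      (A.mulVecLin.toContinuousLinearMap.contDiff).add contDiff_const
    have h2 : ContDiff ℝ ∞ fun x => f.1 (A.mulVec x + v) := (contDiff_smoothFun f).comp h1
    exact h2⟩
  map_one' := rfl
  map_mul' _ _ := rfl
  map_zero' := rfl
  map_add' _ _ := rfl
  commutes' _ := rfl

theorem affComp_apply (A : Matrix (Fin n) (Fin n) ℝ) (v : Fin n → ℝ) (f : SmoothFun n)
    (x : Fin n → ℝ) : (affComp A v f).1 x = f.1 (A.mulVec x + v) := rfl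

theorem partialD_affComp (A : Matrix (Fin n) (Fin n) ℝ) (v : Fin n → ℝ) (f : SmoothFun n)
    (j : Fin n) : partialD j (affComp A v f) = ∑ i, (A i j : ℂ) • affComp A v (partialD i f) := by
  apply Subtype.ext
  funext x
  rw [partialD_apply]
  have h1 : HasFDerivAt (fun x : Fin n → ℝ => A.mulVec x + v)
      A.mulVecLin.toContinuousLinearMap x :=
    (A.mulVecLin.toContinuousLinearMap.hasFDerivAt).add_const v
  have h2 := (differentiableAt_smoothFun f (A.mulVec x + v)).hasFDerivAt.comp x h1
  have h3 : (affComp A v f).1 = f.1 ∘ fun x => A.mulVec x + v := rfl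
  rw [h3, h2.fderiv, ContinuousLinearMap.comp_apply, fderiv_eq_sum_partialD]
  simp [affComp_apply, -Complex.coe_smul]

/-- Pull-back of symbols: the substitution `x ↦ A x + v`, `ξ ↦ Bᵀ ξ`. -/
def affPull (A B : Matrix (Fin n) (Fin n) ℝ) (v : Fin n → ℝ) : LocalSymbol n →+* LocalSymbol n :=
  eval₂Hom (C.comp (affComp A v).toRingHom) (fun k => ∑ j, (B j k : ℂ) • X j)

variable {A B : Matrix (Fin n) (Fin n) ℝ} {v : Fin n → ℝ}

theorem affPull_C (a : SmoothFun n) : affPull A B v (C a) = C (affComp A v a) := by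
  simp [affPull]

theorem affPull_mul_X (P : LocalSymbol n) (k : Fin n) :
    affPull A B v (P * X k) = ∑ j, (B j k : ℂ) • (affPull A B v P * X j) := by
  rw [map_mul]
  simp [affPull, Finset.mul_sum, -Complex.coe_smul]

theorem affPull_smul (c : ℂ) (P : LocalSymbol n) :
    affPull A B v (c • P) = c • affPull A B v P := by
  rw [← C_algebraMap_mul, map_mul, affPull_C, AlgHom.commutes, C_algebraMap_mul]

theorem evalSymbol_affPull (P : LocalSymbol n) (x ξ : Fin n → ℝ) :
    evalSymbol (affPull A B v P) x ξ
      = evalSymbol P (A.mulVec x + v) (fun k => ∑ j, B j k * ξ j) := by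
  induction P using MvPolynomial.induction_on with
  | C a => rw [affPull_C, evalSymbol_C, evalSymbol_C, affComp_apply]
  | add p q hp hq => rw [map_add, evalSymbol_add, evalSymbol_add, hp, hq]
  | mul_X p k hp =>
    rw [affPull_mul_X, evalSymbol_mul_X, ← evalSymbolₗ_apply, map_sum]
    simp only [map_smul, evalSymbolₗ_apply, evalSymbol_mul_X, hp, smul_eq_mul]
    push_cast
    rw [Finset.mul_sum]
    exact Finset.sum_congr rfl fun j _ => by ring

theorem sum_ofReal_mul_eq_ite (h : A * B = 1) (i k : Fin n) :
    ∑ j, (B j k : ℂ) * A i j = if i = k then 1 else 0 := by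
  have := congrFun (congrFun h i) k
  rw [Matrix.mul_apply, Matrix.one_apply] at this
  rw [← Complex.ofReal_one, ← Complex.ofReal_zero, ← apply_ite, ← this]
  push_cast
  exact Finset.sum_congr rfl fun j _ => mul_comm _ _

theorem sum_smul_partialD_affComp (h : A * B = 1) (f : SmoothFun n) (k : Fin n) :
    ∑ j, (B j k : ℂ) • partialD j (affComp A v f) = affComp A v (partialD k f) := by
  simp only [partialD_affComp, Finset.smul_sum, smul_smul]
  rw [Finset.sum_comm]
  simp only [← Finset.sum_smul]
  simp [sum_ofReal_mul_eq_ite h]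

theorem applyOp_affPull (h : A * B = 1) (c : ℂ) (P : LocalSymbol n) (f : SmoothFun n) :
    applyOp c (affPull A B v P) (affComp A v f) = affComp A v (applyOp c P f) := by
  induction P using MvPolynomial.induction_on generalizing f with
  | C a => rw [affPull_C, applyOp_C, applyOp_C, map_mul]
  | add p q hp hq => rw [map_add, applyOp_add, applyOp_add, hp, hq, map_add]
  | mul_X p k hp =>
    rw [affPull_mul_X, applyOp_mul_X, ← applyOpₗ_apply, map_sum, LinearMap.sum_apply, map_smul,
      ← hp,
      ← sum_smul_partialD_affComp h, ← applyOpₗ_apply c (affPull A B v p), map_sum, Finset.smul_sum]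
    refine Finset.sum_congr rfl fun j _ => ?_
    rw [map_smul, LinearMap.smul_apply, applyOpₗ_apply, applyOp_mul_X, map_smul, smul_comm,
      applyOpₗ_apply]

theorem symbolDx_affPull (P : LocalSymbol n) (j : Fin n) :
    symbolDx j (affPull A B v P) = ∑ i, (A i j : ℂ) • affPull A B v (symbolDx i P) := by
  induction P using MvPolynomial.induction_on with
  | C a => simp only [affPull_C, symbolDx_C, partialD_affComp, map_sum, C_smul_smoothFun]
  | add p q hp hq => simp only [map_add, hp, hq, smul_add, Finset.sum_add_distrib]
  | mul_X p k hp =>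
    simp only [affPull_mul_X, symbolDx_mul_X, map_sum, map_smul, hp, Finset.sum_mul,
      Finset.smul_sum]
    rw [Finset.sum_comm]
    refine Finset.sum_congr rfl fun i _ => Finset.sum_congr rfl fun l _ => ?_
    rw [smul_mul_assoc, smul_comm]

/-- The relation A B = 1 says that x and ξ change contragrediently, so the contraction of ∂/∂x with
∂/∂ξ is unchanged. -/
theorem divOp_affPull (h : A * B = 1) (P : LocalSymbol n) :
    divOp n (affPull A B v P) = affPull A B v (divOp n P) := by
  induction P using MvPolynomial.induction_on with
  | C a => simp only [affPull_C, divOp_C, map_zero]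
  | add p q hp hq => simp only [map_add, hp, hq]
  | mul_X p k hp =>
    simp only [affPull_mul_X, divOp_mul_X, map_sum, map_smul, map_add, hp, smul_add,
      Finset.sum_add_distrib]
    congr 1
    simp only [symbolDx_affPull, Finset.smul_sum, smul_smul]
    rw [Finset.sum_comm]
    simp only [← Finset.sum_smul]
    simp [sum_ofReal_mul_eq_ite h]

theorem diagOp_affPull (φ : ℕ → ℂ) (P : LocalSymbol n) :
    diagOp n φ (affPull A B v P) = affPull A B v (diagOp n φ P) := by
  induction P using MvPolynomial.induction_on generalizing φ with
  | C a => simp only [affPull_C, diagOp_C, affPull_smul]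
  | add p q hp hq => simp only [map_add, hp, hq]
  | mul_X p k hp => simp only [affPull_mul_X, diagOp_mul_X, map_sum, map_smul, hp]

theorem quantSymb_affPull (h : A * B = 1) (lam del c : ℂ) (P : LocalSymbol n) :
    quantSymb n lam del c (affPull A B v P) = affPull A B v (quantSymb n lam del c P) := by
  have hpow : ∀ m, (divOp n ^ m) (affPull A B v P) = affPull A B v ((divOp n ^ m) P) := by
    intro m
    induction m with
    | zero => simp
    | succ m ih => rw [pow_succ', Module.End.mul_apply, Module.End.mul_apply, ih, divOp_affPull h]
  rw [quantSymb_eq lam del c ((degLT_totalDegree _).mono (le_max_left _ (P.totalDegree + 1))),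
    quantSymb_eq lam del c ((degLT_totalDegree P).mono
      (le_max_right ((affPull A B v P).totalDegree + 1) _)), quantTrunc_apply, quantTrunc_apply]
  simp only [map_sum, affPull_smul, hpow, diagOp_affPull]

end Affine

/-! ### The local expressions of the quantized operator fit together -/

section

variable {lam mu : ℂ} (c : ℂ)

/-- The local expression in the chart `g` of the quantization of `P` applied to `f`. -/
def quantLocal (P : Symb n (mu - lam)) (f : Density n lam) (g : SL(n + 1, ℝ)) : SmoothFun n :=
  applyOp c (quantSymb n lam (mu - lam) c (P.1 g)) (f.1 g)

/-- When row 0 of `a` is (a₀₀, 0), the change of coordinates is affine and the density factors are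
constants. Substitution of an affine map respects D, the functions of 𝓔 and normal ordering, so the
comparison is exact, with no differentiation in time. -/
theorem quantLocal_mul_affine (P : Symb n (mu - lam)) (f : Density n lam) (g a : SL(n + 1, ℝ))
    (hr : 0 < a.1 0 0) (ha : ∀ j : Fin n, a.1 0 j.succ = 0) (x : Fin n → ℝ) :
    (quantLocal c P f (g * a)).1 x
      = Complex.exp (-((n + 1) * mu * Real.log (a.1 0 0)))
        * (quantLocal c P f g).1 (projPoint a x) := by
  have hl : ∀ x, lift a x 0 = a.1 0 0 := fun x => by simp [lift_apply, ha]
  have hmul : a.1 * (a⁻¹).1 = 1 := by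
    rw [← Matrix.SpecialLinearGroup.coe_mul, mul_inv_cancel, Matrix.SpecialLinearGroup.coe_one]
  have hinv : ∀ j : Fin n, (a⁻¹).1 0 j.succ = 0 := fun j => by
    have := congrFun (congrFun hmul 0) j.succ
    rw [Matrix.mul_apply, Fin.sum_univ_succ] at this
    simpa [ha, hr.ne', (Fin.succ_ne_zero j).symm] using this
  set A : Matrix (Fin n) (Fin n) ℝ := Matrix.of fun i j => a.1 i.succ j.succ / a.1 0 0 with hA
  set B : Matrix (Fin n) (Fin n) ℝ := Matrix.of fun i j => a.1 0 0 * (a⁻¹).1 i.succ j.succ with hB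
  set v : Fin n → ℝ := fun i => a.1 i.succ 0 / a.1 0 0 with hv
  have hAB : A * B = 1 := by
    ext i k
    have := congrFun (congrFun hmul i.succ) k.succ
    rw [Matrix.mul_apply, Fin.sum_univ_succ, hinv] at this
    simp only [Matrix.one_apply, Fin.succ_inj, mul_zero, zero_add] at this
    rw [Matrix.mul_apply, Matrix.one_apply, ← this]
    refine Finset.sum_congr rfl fun j _ => ?_
    simp only [hA, hB, Matrix.of_apply]
    field_simp
  have hpt : ∀ x, projPoint a x = A.mulVec x + v := by
    intro x
    funext i
    simp only [projPoint, hl, lift_apply, hA, hv, Matrix.mulVec, dotProduct, Pi.add_apply,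
      Matrix.of_apply, add_div, Finset.sum_div, div_mul_eq_mul_div]
    rw [add_comm]
  have hcov : ∀ x ξ, projCovector a x ξ = fun k => ∑ j, B j k * ξ j := by
    intro x ξ
    funext k
    simp only [projCovector, hl, hinv, hB, Matrix.of_apply, mul_zero, sub_zero, Finset.mul_sum]
    exact Finset.sum_congr rfl fun j _ => by ring
  have hP : P.1 (g * a) = Complex.exp (-((n + 1) * (mu - lam) * Real.log (a.1 0 0)))
      • affPull A B v (P.1 g) := by
    refine evalSymbol_injective fun x ξ => ?_
    rw [evalSymbol_smul, evalSymbol_affPull, symb_mul_right P g (by rw [hl]; exact hr), hl, hpt,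
      hcov]
  have hf : f.1 (g * a) = Complex.exp (-((n + 1) * lam * Real.log (a.1 0 0)))
      • affComp A v (f.1 g) := by
    apply Subtype.ext
    funext x
    rw [density_mul_right f g (by rw [hl]; exact hr), hl, hpt]
    rfl
  rw [quantLocal, hP, hf, map_smul, applyOp_smul, applyOp_smul_right, quantSymb_affPull hAB,
    applyOp_affPull hAB, smul_smul, ← Complex.exp_add, hpt]
  change Complex.exp _ * _ = _
  rw [affComp_apply, quantLocal]
  congr 2
  ring

theorem hasDerivAt_quantLocal_mul_shear (hn : 1 ≤ n)
    (hres : ∀ l : ℕ, ((n : ℂ) + 1) * (1 - (mu - lam)) + l ≠ 0)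
    (P : Symb n (mu - lam)) (f : Density n lam) (g : SL(n + 1, ℝ)) {u w : Fin (n + 1) → ℝ}
    (h : w ⬝ᵥ u = 0) (t : ℝ) (x : Fin n → ℝ) :
    HasDerivAt (fun t => (quantLocal c P f (g * shear u w h t)).1 x)
      ((lieDens mu (projField (Matrix.vecMulVec u w))
        (quantLocal c P f (g * shear u w h t))).1 x) t := by
  have h1 := (((hasTimeDerivSymb_symb h hn P g).quantSymb lam (mu - lam) c).applyOp
    (hasTimeDeriv_density h f g) c).2 t x
  refine h1.congr_deriv ?_
  rw [quantLocal, lieDens_applyOp_quantSymb c lam mu hres]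
  exact congrArg (fun F : SmoothFun n => F.1 x) (add_comm _ _)

/-- For w₀ = 0 the projective field and its divergence vanish at the origin, so the Lie derivative
is zero there and the value is constant along the shear. Here infinitesimal equivariance is
integrated. -/
theorem quantLocal_mul_shear_zero (hn : 1 ≤ n)
    (hres : ∀ l : ℕ, ((n : ℂ) + 1) * (1 - (mu - lam)) + l ≠ 0)
    (P : Symb n (mu - lam)) (f : Density n lam) (g : SL(n + 1, ℝ)) {u w : Fin (n + 1) → ℝ}
    (h : w ⬝ᵥ u = 0) (hw : w 0 = 0) :
    (quantLocal c P f (g * shear u w h 1)).1 0 = (quantLocal c P f g).1 0 := by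
  have hd := fun t => hasDerivAt_quantLocal_mul_shear c hn hres P f g h t 0
  have h0 : ∀ t, (lieDens mu (projField (Matrix.vecMulVec u w))
        (quantLocal c P f (g * shear u w h t))).1 0 = 0 := by
    intro t
    rw [lieDens_apply, divField_vecMulVec h]
    simp [projField_vecMulVec, hw]
  have := is_const_of_deriv_eq_zero (fun t => (hd t).differentiableAt)
    (fun t => by rw [(hd t).deriv, h0]) 1 0
  rwa [shear_zero, mul_one] at this

/-- The translation by `v` of the affine coordinates. -/
def transl (v : Fin n → ℝ) : SL(n + 1, ℝ) :=
  shear (Fin.cons 0 v) (Pi.single 0 1) (by simp) 1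

theorem transl_zero_zero (v : Fin n → ℝ) : (transl v).1 0 0 = 1 := by
  simp [transl, shear_apply]

theorem transl_zero_succ (v : Fin n → ℝ) (j : Fin n) : (transl v).1 0 j.succ = 0 := by
  simp [transl, shear_apply, (Fin.succ_ne_zero j).symm]

theorem lift_transl (v x : Fin n → ℝ) : lift (transl v) x = Fin.cons 1 (x + v) := by
  funext i
  rw [transl, lift_shear]
  refine Fin.cases ?_ (fun i => ?_) i <;> simp

theorem quantLocal_mul_transl (P : Symb n (mu - lam)) (f : Density n lam) (g : SL(n + 1, ℝ))
    (v : Fin n → ℝ) : (quantLocal c P f (g * transl v)).1 0 = (quantLocal c P f g).1 v := by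
  rw [quantLocal_mul_affine c P f g (transl v) (by rw [transl_zero_zero]; exact one_pos)
    (transl_zero_succ v), transl_zero_zero]
  have : projPoint (transl v) 0 = v := by
    funext i
    simp [projPoint, lift_transl]
  simp [this]

/-- Translations move the common point to the origin of both charts. The remaining matrix M
preserves the ray of (1, 0) and factors as a block diagonal N times a shear; `quantLocal_mul_affine`
handles N and `quantLocal_mul_shear_zero` the shear. -/
theorem quantLocal_mem_density (hn : 1 ≤ n)
    (hres : ∀ l : ℕ, ((n : ℂ) + 1) * (1 - (mu - lam)) + l ≠ 0)
    (P : Symb n (mu - lam)) (f : Density n lam) : quantLocal c P f ∈ Density n mu := by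
  intro g h x y e
  obtain ⟨r, hr, e⟩ := (chart_eq_iff g h x y).mp e
  rw [jac_cpow hr e]
  set M : SL(n + 1, ℝ) := (h * transl y)⁻¹ * (g * transl x) with hM
  have h0 : lift M 0 = r • (Fin.cons 1 0 : Fin (n + 1) → ℝ) := by
    refine lift_inv_mul_of_lift_eq ?_
    rw [lift_mul, lift_transl, lift_mul, lift_transl, zero_add, zero_add]
    exact e
  have hcol : ∀ i, M.1 i 0 = r * (Fin.cons 1 0 : Fin (n + 1) → ℝ) i := fun i => by
    have := congrFun h0 i
    simpa [lift_apply] using this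
  -- Column 0 of M is (r, 0), so dividing row 0 by r gives the shear whose inverse, on the right,
  -- clears that row apart from its first entry.
  set w : Fin (n + 1) → ℝ := fun j => if j = 0 then 0 else M.1 0 j / r with hw
  have hwu : w ⬝ᵥ (Pi.single 0 1) = 0 := by simp [hw]
  set N : SL(n + 1, ℝ) := M * (shear (Pi.single 0 1) w hwu 1)⁻¹ with hN
  have hent : ∀ i j, N.1 i j = M.1 i j - M.1 i 0 * w j := by
    intro i j
    rw [hN, shear_inv, Matrix.SpecialLinearGroup.coe_mul, coe_shear]
    simp only [mul_add, mul_one, neg_smul, one_smul, mul_neg, Matrix.mul_vecMulVec,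
      Matrix.add_apply,
      Matrix.neg_apply, Matrix.vecMulVec_apply, Matrix.mulVec_single_one]
    simp [sub_eq_add_neg]
  have h00 : N.1 0 0 = r := by
    rw [hent, hcol]
    simp [hw]
  have h0j : ∀ j : Fin n, N.1 0 j.succ = 0 := by
    intro j
    rw [hent, hcol]
    simp only [hw, Fin.succ_ne_zero, if_false, Fin.cons_zero]
    field_simp
    simp
  have hi0 : ∀ i : Fin n, N.1 i.succ 0 = 0 := by
    intro i
    rw [hent, hcol]
    simp [hw]
  have hpt : projPoint N 0 = 0 := by
    funext i
    simp [projPoint, lift_apply, hi0]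
  have hg : g * transl x = h * transl y * N * shear (Pi.single 0 1) w hwu 1 := by
    rw [hN, hM]
    group
  rw [← quantLocal_mul_transl c P f g x, hg, quantLocal_mul_shear_zero c hn hres P f _ hwu
    (by simp [hw]),
    quantLocal_mul_affine c P f _ N (by rw [h00]; exact hr) h0j, h00, hpt, quantLocal_mul_transl]

end

/-! ### Lie derivatives of densities and symbols -/

theorem projField_add (Y Z : Matrix (Fin (n + 1)) (Fin (n + 1)) ℝ) :
    projField (Y + Z) = projField Y + projField Z := by
  funext i
  apply Subtype.ext
  funext x
  change (((_ : ℝ) : ℂ)) = ((_ : ℝ) : ℂ) + ((_ : ℝ) : ℂ)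
  rw [← Complex.ofReal_add]
  simp only [Matrix.add_apply, add_mul, Finset.sum_add_distrib]
  congr 1
  ring

theorem projField_smul (a : ℝ) (Y : Matrix (Fin (n + 1)) (Fin (n + 1)) ℝ) :
    projField (a • Y) = (a : ℂ) • projField Y := by
  funext i
  apply Subtype.ext
  funext x
  change (((_ : ℝ) : ℂ)) = (a : ℂ) * ((_ : ℝ) : ℂ)
  rw [← Complex.ofReal_mul]
  simp only [Matrix.smul_apply, smul_eq_mul, mul_assoc, ← Finset.mul_sum]
  congr 1
  ring

theorem projField_one : projField (1 : Matrix (Fin (n + 1)) (Fin (n + 1)) ℝ) = 0 := by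
  funext i
  apply Subtype.ext
  funext x
  simp [projField, Matrix.one_apply, (Fin.succ_ne_zero _).symm]

theorem fundField_add (X Y : Matrix (Fin (n + 1)) (Fin (n + 1)) ℝ) (g : SL(n + 1, ℝ)) :
    fundField (X + Y) g = fundField X g + fundField Y g := by
  rw [fundField, mul_add, add_mul, projField_add]
  rfl

theorem fundField_smul (a : ℝ) (X : Matrix (Fin (n + 1)) (Fin (n + 1)) ℝ) (g : SL(n + 1, ℝ)) :
    fundField (a • X) g = (a : ℂ) • fundField X g := by
  rw [fundField, mul_smul_comm, smul_mul_assoc, projField_smul]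
  rfl

theorem fundField_one (g : SL(n + 1, ℝ)) :
    fundField (1 : Matrix (Fin (n + 1)) (Fin (n + 1)) ℝ) g = 0 := by
  rw [fundField, mul_one, ← Matrix.SpecialLinearGroup.coe_mul, inv_mul_cancel,
    Matrix.SpecialLinearGroup.coe_one, projField_one]

theorem divField_add (v v' : Fin n → SmoothFun n) :
    divField (v + v') = divField v + divField v' := by
  simp [divField, Finset.sum_add_distrib]

theorem divField_smul (a : ℂ) (v : Fin n → SmoothFun n) : divField (a • v) = a • divField v := by
  simp [divField, Finset.smul_sum]

theorem lieSymb_add_field (del : ℂ) (v v' : Fin n → SmoothFun n) (P : LocalSymbol n) :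
    lieSymb del (v + v') P = lieSymb del v P + lieSymb del v' P := by
  simp only [lieSymb, divField_add, Pi.add_apply, map_add, add_mul, Finset.sum_add_distrib,
    smul_add]
  abel

theorem lieSymb_smul_field (del a : ℂ) (v : Fin n → SmoothFun n) (P : LocalSymbol n) :
    lieSymb del (a • v) P = a • lieSymb del v P := by
  simp only [lieSymb, divField_smul, Pi.smul_apply, map_smul, C_smul_smoothFun, smul_mul_assoc,
    ← Finset.smul_sum, smul_comm del a, smul_sub, smul_add]

theorem lieDens_add_field (lam : ℂ) (v v' : Fin n → SmoothFun n) (f : SmoothFun n) :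
    lieDens lam (v + v') f = lieDens lam v f + lieDens lam v' f := by
  simp only [lieDens, divField_add, Pi.add_apply, add_mul, Finset.sum_add_distrib, smul_add]
  abel

theorem lieDens_smul_field (lam a : ℂ) (v : Fin n → SmoothFun n) (f : SmoothFun n) :
    lieDens lam (a • v) f = a • lieDens lam v f := by
  simp only [lieDens, divField_smul, Pi.smul_apply, smul_mul_assoc,
    ← Finset.smul_sum, smul_comm lam a, smul_add]

theorem lieSymb_zero_field (del : ℂ) (P : LocalSymbol n) : lieSymb del 0 P = 0 := by
  rw [← zero_smul ℂ (0 : Fin n → SmoothFun n), lieSymb_smul_field, zero_smul]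

theorem lieDens_zero_field (lam : ℂ) (f : SmoothFun n) : lieDens lam 0 f = 0 := by
  rw [← zero_smul ℂ (0 : Fin n → SmoothFun n), lieDens_smul_field, zero_smul]

theorem fundField_zero (g : SL(n + 1, ℝ)) :
    fundField (0 : Matrix (Fin (n + 1)) (Fin (n + 1)) ℝ) g = 0 := by
  rw [← zero_smul ℝ (0 : Matrix (Fin (n + 1)) (Fin (n + 1)) ℝ), fundField_smul, Complex.ofReal_zero,
    zero_smul]

/-- The rank one matrices `u wᵀ` with `w · u = 0`, together with the identity, span all matrices. -/
theorem mem_of_vecMulVec_mem {S : Submodule ℝ (Matrix (Fin (n + 1)) (Fin (n + 1)) ℝ)}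
    (hS : ∀ u w, w ⬝ᵥ u = 0 → Matrix.vecMulVec u w ∈ S) (h1 : 1 ∈ S)
    (X : Matrix (Fin (n + 1)) (Fin (n + 1)) ℝ) : X ∈ S := by
  have hne : ∀ a b : Fin (n + 1), a ≠ b → Matrix.single a b (1 : ℝ) ∈ S := by
    intro a b hab
    rw [Matrix.single_eq_single_vecMulVec_single]
    exact hS _ _ (by simp [hab])
  have hdiag : ∀ a b : Fin (n + 1), Matrix.single a a (1 : ℝ) - Matrix.single b b 1 ∈ S := by
    intro a b
    rcases eq_or_ne a b with rfl | hab
    · simp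
    have h2 := hS (Pi.single a 1 + Pi.single b 1) (Pi.single a 1 - Pi.single b 1) (by
      simp [hab, hab.symm])
    have h3 : Matrix.single a a (1 : ℝ) - Matrix.single b b 1
        = Matrix.vecMulVec (Pi.single a 1 + Pi.single b 1) (Pi.single a 1 - Pi.single b 1)
          + Matrix.single a b 1 - Matrix.single b a 1 := by
      rw [Matrix.add_vecMulVec, Matrix.vecMulVec_sub, Matrix.vecMulVec_sub,
        ← Matrix.single_eq_single_vecMulVec_single, ← Matrix.single_eq_single_vecMulVec_single,
        ← Matrix.single_eq_single_vecMulVec_single, ← Matrix.single_eq_single_vecMulVec_single]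
      abel
    rw [h3]
    exact S.sub_mem (S.add_mem h2 (hne a b hab)) (hne b a hab.symm)
  have hdd : ∀ a : Fin (n + 1), Matrix.single a a (1 : ℝ) ∈ S := by
    intro a
    have h2 : ((n : ℝ) + 1) • Matrix.single a a (1 : ℝ) = 1
        + ∑ b, (Matrix.single a a (1 : ℝ) - Matrix.single b b 1) := by
      rw [Finset.sum_sub_distrib, Matrix.sum_single_one]
      simp [← Nat.cast_smul_eq_nsmul ℝ]
    have h3 : ((n : ℝ) + 1) • Matrix.single a a (1 : ℝ) ∈ S := by
      rw [h2]
      exact S.add_mem h1 (S.sum_mem fun b _ => hdiag a b)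
    exact (S.smul_mem_iff (by positivity)).mp h3
  rw [Matrix.matrix_eq_sum_single X]
  refine S.sum_mem fun a _ => S.sum_mem fun b _ => ?_
  have : Matrix.single a b (X a b) = X a b • Matrix.single a b (1 : ℝ) := by simp
  rw [this]
  refine S.smul_mem _ ?_
  rcases eq_or_ne a b with rfl | hab
  · exact hdd a
  · exact hne a b hab

/-- Conjugation by g turns u wᵀ into (g⁻¹u)(wᵀg). Thus moving the chart by a shear on the left is
moving it by another shear on the right, where the time derivative is known. -/
theorem shear_mul {u w : Fin (n + 1) → ℝ} (h : w ⬝ᵥ u = 0) (g : SL(n + 1, ℝ)) :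
    ∃ u' w', ∃ h' : w' ⬝ᵥ u' = 0,
      (∀ t, shear u w h t * g = g * shear u' w' h' t) ∧
        ((g⁻¹ : SL(n + 1, ℝ)) : Matrix (Fin (n + 1)) (Fin (n + 1)) ℝ) * Matrix.vecMulVec u w * g.1
          = Matrix.vecMulVec u' w' := by
  have hinv : g.1 * (g⁻¹).1 = 1 := by
    rw [← Matrix.SpecialLinearGroup.coe_mul, mul_inv_cancel, Matrix.SpecialLinearGroup.coe_one]
  refine ⟨(g⁻¹).1.mulVec u, Matrix.vecMul w g.1, ?_, fun t => ?_, ?_⟩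
  · rw [← Matrix.dotProduct_mulVec, Matrix.mulVec_mulVec, hinv, Matrix.one_mulVec, h]
  · apply Subtype.ext
    rw [Matrix.SpecialLinearGroup.coe_mul, Matrix.SpecialLinearGroup.coe_mul, coe_shear, coe_shear,
      add_mul, mul_add, one_mul, mul_one, mul_smul_comm, smul_mul_assoc, Matrix.mul_vecMulVec,
      Matrix.mulVec_mulVec, hinv, Matrix.one_mulVec, Matrix.vecMulVec_mul]
  · rw [Matrix.mul_vecMulVec, Matrix.vecMulVec_mul]

/-- For X = u wᵀ, the transformation rule of the symbols moved by the shear is differentiated at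
time 0; its Jacobian and covector do not depend on time. Such X and the identity, which acts by
zero, span all matrices. -/
theorem lieSymb_mem_symb {del : ℂ} (P : Symb n del) (X : Matrix (Fin (n + 1)) (Fin (n + 1)) ℝ) :
    (fun g => lieSymb del (fundField X g) (P.1 g)) ∈ Symb n del := by
  let S : Submodule ℝ (Matrix (Fin (n + 1)) (Fin (n + 1)) ℝ) :=
    { carrier := {X | (fun g => lieSymb del (fundField X g) (P.1 g)) ∈ Symb n del}
      add_mem' := fun {X Y} hX hY => by
        have := (Symb n del).add_mem hX hY
        simp only [Set.mem_ofPred_eq, fundField_add, lieSymb_add_field]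
        exact this
      zero_mem' := by
        simp only [Set.mem_ofPred_eq, fundField_zero, lieSymb_zero_field]
        exact (Symb n del).zero_mem
      smul_mem' := fun a X hX => by
        have := (Symb n del).smul_mem (a : ℂ) hX
        simp only [Set.mem_ofPred_eq, fundField_smul, lieSymb_smul_field]
        exact this }
  refine mem_of_vecMulVec_mem (S := S) (fun u w h => ?_) ?_ X
  · intro g k x y e η
    have hd : ∀ (g : SL(n + 1, ℝ)) x ξ, HasDerivAt (fun t => evalSymbol (P.1 (shear u w h t
        * g)) x ξ)
        (evalSymbol (lieSymb del (fundField (Matrix.vecMulVec u w) g) (P.1 g)) x ξ) 0 := by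
      intro g x ξ
      obtain ⟨u', w', h', h1, h2⟩ := shear_mul h g
      simp only [h1]
      have h3 := (hasTimeDeriv_evalSymbol h' P g ξ).2 0 x
      rw [shear_zero, mul_one] at h3
      rw [fundField, h2]
      exact h3
    have h1 : ∀ t, evalSymbol (P.1 (shear u w h t * g)) x (pullCovector g k x η)
        = (jac g k x : ℂ) ^ del * evalSymbol (P.1 (shear u w h t * k)) y η := by
      intro t
      have := (symbAct (shear u w h t)⁻¹ P).2 g k x y e η
      simpa [symbAct] using this
    have h2 := hd g x (pullCovector g k x η)
    simp only [h1] at h2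
    exact h2.unique ((hd k y η).const_mul _)
  · change (fun g => lieSymb del (fundField 1 g) (P.1 g)) ∈ Symb n del
    simp only [fundField_one, lieSymb_zero_field]
    exact (Symb n del).zero_mem

theorem lieDens_mem_density {lam : ℂ} (f : Density n lam)
    (X : Matrix (Fin (n + 1)) (Fin (n + 1)) ℝ) :
    (fun g => lieDens lam (fundField X g) (f.1 g)) ∈ Density n lam := by
  let S : Submodule ℝ (Matrix (Fin (n + 1)) (Fin (n + 1)) ℝ) :=
    { carrier := {X | (fun g => lieDens lam (fundField X g) (f.1 g)) ∈ Density n lam}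
      add_mem' := fun {X Y} hX hY => by
        have := (Density n lam).add_mem hX hY
        simp only [Set.mem_ofPred_eq, fundField_add, lieDens_add_field]
        exact this
      zero_mem' := by
        simp only [Set.mem_ofPred_eq, fundField_zero, lieDens_zero_field]
        exact (Density n lam).zero_mem
      smul_mem' := fun a X hX => by
        have := (Density n lam).smul_mem (a : ℂ) hX
        simp only [Set.mem_ofPred_eq, fundField_smul, lieDens_smul_field]
        exact this }
  refine mem_of_vecMulVec_mem (S := S) (fun u w h => ?_) ?_ X
  · intro g k x y e
    have hd : ∀ (g : SL(n + 1, ℝ)) x, HasDerivAt (fun t => (f.1 (shear u w h t * g)).1 x)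
        ((lieDens lam (fundField (Matrix.vecMulVec u w) g) (f.1 g)).1 x) 0 := by
      intro g x
      obtain ⟨u', w', h', h1, h2⟩ := shear_mul h g
      simp only [h1]
      have h3 := (hasTimeDeriv_density h' f g).2 0 x
      simp only [shear_zero, mul_one] at h3
      rw [fundField, h2]
      exact h3
    have h1 : ∀ t, (f.1 (shear u w h t * g)).1 x
        = (jac g k x : ℂ) ^ lam * (f.1 (shear u w h t * k)).1 y := by
      intro t
      have := (densAct (shear u w h t)⁻¹ f).2 g k x y e
      simpa [densAct] using this
    have h2 := hd g x
    simp only [h1] at h2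
    exact h2.unique ((hd k y).const_mul _)
  · change (fun g => lieDens lam (fundField 1 g) (f.1 g)) ∈ Density n lam
    simp only [fundField_one, lieDens_zero_field]
    exact (Density n lam).zero_mem

/-- The Lie derivative of symbols on the sphere along the vector field generated by `X`. -/
def symbLie {del : ℂ} (X : Matrix (Fin (n + 1)) (Fin (n + 1)) ℝ) : Module.End ℂ (Symb n del) where
  toFun P := ⟨fun g => lieSymb del (fundField X g) (P.1 g), lieSymb_mem_symb P X⟩
  map_add' _ _ := Subtype.ext (funext fun _ => lieSymb_add _ _ _ _)
  map_smul' _ _ := Subtype.ext (funext fun _ => lieSymb_smul _ _ _ _)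

/-- The Lie derivative of densities on the sphere along the vector field generated by `X`. -/
def densLie {lam : ℂ} (X : Matrix (Fin (n + 1)) (Fin (n + 1)) ℝ) (f : Density n lam) :
    Density n lam :=
  ⟨fun g => lieDens lam (fundField X g) (f.1 g), lieDens_mem_density f X⟩

/-! ### The quantization map -/

theorem applyOp_one_diagOp_pow (c : ℂ) (P : LocalSymbol n) (f : SmoothFun n) :
    applyOp 1 (diagOp n (fun e => c ^ e) P) f = applyOp c P f := by
  rw [applyOp_diagOp, mul_one]

section

variable (hn : 1 ≤ n) {lam mu : ℂ} (c : ℂ)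
  (hres : ∀ l : ℕ, ((n : ℂ) + 1) * (1 - (mu - lam)) + l ≠ 0)

/-- The differential operator quantizing the symbol `P`, with `c = -iħ`. -/
def quantDens (P : Symb n (mu - lam)) : Density n lam →ₗ[ℂ] Density n mu where
  toFun f := ⟨quantLocal c P f, quantLocal_mem_density c hn hres P f⟩
  map_add' f f' := by
    apply Subtype.ext
    funext g
    exact applyOp_add_right c (quantSymb n lam (mu - lam) c (P.1 g)) (f.1 g) (f'.1 g)
  map_smul' a f := by
    apply Subtype.ext
    funext g
    exact applyOp_smul_right c a (quantSymb n lam (mu - lam) c (P.1 g)) (f.1 g)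

theorem quantDens_apply (P : Symb n (mu - lam)) (f : Density n lam) (g : SL(n + 1, ℝ)) :
    (quantDens hn c hres P f).1 g
      = applyOp c (quantSymb n lam (mu - lam) c (P.1 g)) (f.1 g) := rfl

theorem quantDens_mem_diffOp (P : Symb n (mu - lam)) : quantDens hn c hres P ∈ DiffOp n lam mu :=
  fun g => ⟨diagOp n (fun e => c ^ e) (quantSymb n lam (mu - lam) c (P.1 g)), fun f => by
    rw [applyOp_one_diagOp_pow, quantDens_apply]⟩

/-- The projectively equivariant quantization map, with `c = -iħ`. -/
def quantMap : Symb n (mu - lam) →ₗ[ℂ] DiffOp n lam mu where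
  toFun P := ⟨quantDens hn c hres P, quantDens_mem_diffOp hn c hres P⟩
  map_add' P P' := by
    apply Subtype.ext
    refine LinearMap.ext fun f => Subtype.ext ?_
    funext g
    change applyOp c (quantSymb n lam (mu - lam) c (P.1 g + P'.1 g)) (f.1 g)
      = applyOp c (quantSymb n lam (mu - lam) c (P.1 g)) (f.1 g)
        + applyOp c (quantSymb n lam (mu - lam) c (P'.1 g)) (f.1 g)
    rw [map_add, applyOp_add]
  map_smul' a P := by
    apply Subtype.ext
    refine LinearMap.ext fun f => Subtype.ext ?_
    funext g
    change applyOp c (quantSymb n lam (mu - lam) c (a • P.1 g)) (f.1 g)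
      = a • applyOp c (quantSymb n lam (mu - lam) c (P.1 g)) (f.1 g)
    rw [map_smul, applyOp_smul]

theorem quantMap_apply (P : Symb n (mu - lam)) (f : Density n lam) (g : SL(n + 1, ℝ)) :
    ((quantMap hn c hres P).1 f).1 g
      = applyOp c (quantSymb n lam (mu - lam) c (P.1 g)) (f.1 g) := rfl

/-- The group permutes the labels of the charts and one formula serves for all labels, so both sides
agree by definition. -/
theorem isGroupEquivariant_quantMap : IsGroupEquivariant (quantMap hn c hres) := by
  intro a P f
  apply Subtype.ext
  funext g
  rfl

theorem isLieOp_quantMap (X : Matrix (Fin (n + 1)) (Fin (n + 1)) ℝ) (P : Symb n (mu - lam)) :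
    IsLieOp X (quantMap hn c hres P) (quantMap hn c hres (symbLie X P)) := by
  intro f
  refine ⟨densLie X f, fun g => rfl, fun g => ?_⟩
  change applyOp c (quantSymb n lam (mu - lam) c (lieSymb (mu - lam) (fundField X g) (P.1 g)))
      (f.1 g)
    + applyOp c (quantSymb n lam (mu - lam) c (P.1 g)) (lieDens lam (fundField X g) (f.1 g))
    = lieDens mu (fundField X g) (applyOp c (quantSymb n lam (mu - lam) c (P.1 g)) (f.1 g))
  rw [fundField, lieDens_applyOp_quantSymb c lam mu hres, add_comm]

theorem isLieEquivariant_quantMap : IsLieEquivariant (quantMap hn c hres) :=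
  fun X _ P => ⟨symbLie X P, fun _ => rfl, isLieOp_quantMap hn c hres X P⟩

theorem degLT_of_isHomogeneous {k : ℕ} {P : LocalSymbol n} (h : P.IsHomogeneous k) :
    DegLT (k + 1) P :=
  degLT_iff_totalDegree.mpr h.totalDegree_le

theorem isNormalized_quantMap (ħ : ℝ) :
    IsNormalized ħ (quantMap hn (-(Complex.I * ħ)) hres) := by
  intro k P hP g
  refine ⟨quantSymb n lam (mu - lam) (-(Complex.I * ħ)) (P.1 g) - P.1 g, fun s hs => ?_, fun f =>
    ?_⟩
  · by_contra h
    exact mem_support_iff.mp hs (degLT_quantSymb_sub lam (mu - lam) _ (degLT_of_isHomogeneous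
      (hP g))
      s (not_lt.mp h))
  · rw [quantMap_apply, normalOrder]
    congr 1
    abel

end

/-! ### Principal symbols and test densities -/

theorem partialD_pow (i : Fin n) (φ : SmoothFun n) (k : ℕ) :
    partialD i (φ ^ (k + 1)) = ((k : ℂ) + 1) • (φ ^ k * partialD i φ) := by
  induction k with
  | zero => simp
  | succ k ih =>
    rw [pow_succ, partialD_mul, ih, pow_succ]
    push_cast
    simp only [Algebra.smul_def, map_add, map_one]
    ring

/-- At a zero of φ a Leibniz term survives only if each of the k factors φ is differentiated. This
takes all of the derivatives when there are k of them, and can be done in k! ways. -/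
theorem partialMulti_pow_mul_apply {φ : SmoothFun n} {x : Fin n → ℝ} (hφ : φ.1 x = 0)
    (s : Fin n →₀ ℕ) (k : ℕ) (hs : s.degree ≤ k) (u : SmoothFun n) :
    (partialMulti s (φ ^ k * u)).1 x = if s.degree = k then
      (k.factorial : ℂ) * (∏ i, (partialD i φ).1 x ^ s i) * u.1 x else 0 := by
  induction hd : s.degree generalizing s k u with
  | zero =>
    have hs : s = 0 := (Finsupp.degree_eq_zero_iff s).mp hd
    subst hs
    rcases k with _ | k
    · simp [partialMulti_zero]
    · simp [partialMulti_zero, hφ]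
  | succ d ih =>
    have hs0 : s ≠ 0 := by
      rintro rfl
      simp at hd
    obtain ⟨i, hi⟩ := Finsupp.ne_iff.mp hs0
    obtain ⟨s', rfl⟩ : ∃ s', s = s' + Finsupp.single i 1 := by
      refine ⟨s - Finsupp.single i 1, (tsub_add_cancel_of_le ?_).symm⟩
      rw [Finsupp.single_le_iff]
      exact Nat.one_le_iff_ne_zero.mpr hi
    rw [map_add, Finsupp.degree_single] at hd hs
    obtain ⟨k, rfl⟩ : ∃ k', k = k' + 1 := ⟨k - 1, by omega⟩
    rw [partialMulti_add_single, Module.End.mul_apply, partialD_mul, partialD_pow, smul_mul_assoc,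
      mul_assoc, map_add, map_smul]
    change ((k : ℂ) + 1) * (partialMulti s' (φ ^ k * (partialD i φ * u))).1 x
      + (partialMulti s' (φ ^ (k + 1) * partialD i u)).1 x = _
    rw [ih s' k (by omega) _ (by omega), ih s' (k + 1) (by omega) _ (by omega),
      if_neg (by omega : ¬ d = k + 1)]
    by_cases hdk : d = k
    · rw [if_pos hdk, if_pos (by omega)]
      have : ∏ j, (partialD j φ).1 x ^ ((s' + Finsupp.single i 1 : Fin n →₀ ℕ) j)
          = (∏ j, (partialD j φ).1 x ^ s' j) * (partialD i φ).1 x := by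
        simp only [Finsupp.add_apply, pow_add, Finset.prod_mul_distrib]
        congr 1
        rw [Finset.prod_eq_single i]
        · simp
        · intro j _ hj
          simp [hj.symm]
        · simp
      rw [this, Nat.factorial_succ]
      push_cast
      change _ * (_ * _ * ((partialD i φ).1 x * u.1 x)) + 0 = _
      ring
    · rw [if_neg hdk, if_neg (by omega)]
      simp

/-- The value at a zero `x` of `φ` of an operator of order `k` on `φᵏ u` is given by its principal
symbol. -/
theorem applyOp_pow_mul_apply {k : ℕ} {p : LocalSymbol n} (hp : DegLT (k + 1) p) {φ : SmoothFun n}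
    {x η : Fin n → ℝ} (hφ : φ.1 x = 0) (hη : ∀ i, (partialD i φ).1 x = η i) (u : SmoothFun n) :
    (applyOp 1 p (φ ^ k * u)).1 x
      = (k.factorial : ℂ) * evalSymbol (homPart n k p) x η * u.1 x := by
  have h1 : evalSymbol (homPart n k p) x η = ∑ s ∈ p.support,
      if s.degree = k then (p.coeff s).1 x * ∏ i, (η i : ℂ) ^ s i else 0 := by
    rw [evalSymbol, eval₂_eq']
    refine (Finset.sum_subset (s₂ := p.support) (fun s hs => ?_) fun s _ hs => ?_).trans
      (Finset.sum_congr rfl fun s _ => ?_)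
    · rw [mem_support_iff, coeff_homPart] at hs
      rw [mem_support_iff]
      intro h
      simp [h] at hs
    · rw [notMem_support_iff.mp hs]
      simp
    · rw [coeff_homPart]
      split_ifs
      · rfl
      · simp
  rw [h1, applyOp, AddSubmonoidClass.coe_finsetSum, Finset.sum_apply, Finset.mul_sum,
    Finset.sum_mul]
  refine Finset.sum_congr rfl fun s hs => ?_
  have hs' : s.degree ≤ k := by
    by_contra h
    exact mem_support_iff.mp hs (hp s (by omega))
  change (1 : ℂ) ^ s.degree * ((p.coeff s).1 x * (partialMulti s (φ ^ k * u)).1 x) = _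
  rw [partialMulti_pow_mul_apply hφ s k hs' u]
  simp only [hη]
  split_ifs <;> simp
  ring

/-- The linear form `ℓ` on `ℝⁿ⁺¹` in the affine chart of `g`. -/
def linFun (ℓ : Fin (n + 1) → ℝ) (g : SL(n + 1, ℝ)) : SmoothFun n :=
  ⟨fun x => ((ℓ ⬝ᵥ lift g x : ℝ) : ℂ), by
    have h : ContDiff ℝ ∞ fun x : Fin n → ℝ => ℓ ⬝ᵥ lift g x := by
      simp only [dotProduct, lift_apply]
      fun_prop
    exact Complex.ofRealCLM.contDiff.comp h⟩

theorem linFun_apply (ℓ : Fin (n + 1) → ℝ) (g : SL(n + 1, ℝ)) (x : Fin n → ℝ) :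
    (linFun ℓ g).1 x = ((ℓ ⬝ᵥ lift g x : ℝ) : ℂ) := rfl

theorem linFun_eq (ℓ : Fin (n + 1) → ℝ) (g : SL(n + 1, ℝ)) :
    linFun ℓ g = algebraMap ℂ _ ((Matrix.vecMul ℓ g.1 0 : ℝ) : ℂ)
      + ∑ j : Fin n, ((Matrix.vecMul ℓ g.1 j.succ : ℝ) : ℂ) • coordFun j := by
  apply Subtype.ext
  funext x
  rw [linFun_apply, lift, act, Matrix.dotProduct_mulVec]
  simp [dotProduct, Fin.sum_univ_succ, coordFun_apply]

theorem partialD_linFun (ℓ : Fin (n + 1) → ℝ) (g : SL(n + 1, ℝ)) (i : Fin n) :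
    partialD i (linFun ℓ g) = algebraMap ℂ _ ((Matrix.vecMul ℓ g.1 i.succ : ℝ) : ℂ) := by
  rw [linFun_eq, map_add, partialD_algebraMap]
  simp [partialD_coordFun, Algebra.algebraMap_eq_smul_one, -Complex.coe_smul]

theorem dotProduct_lift_pos (g : SL(n + 1, ℝ)) (x : Fin n → ℝ) : 0 < lift g x ⬝ᵥ lift g x := by
  have h := lift_ne_zero g x
  have h1 : 0 ≤ lift g x ⬝ᵥ lift g x := Finset.sum_nonneg fun i _ => mul_self_nonneg _
  exact lt_of_le_of_ne h1 fun h2 => h (dotProduct_self_eq_zero.mp h2.symm)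

/-- The positively homogeneous function `‖v‖^(-a)` in the affine chart of `g`. -/
def normFun (a : ℂ) (g : SL(n + 1, ℝ)) : SmoothFun n :=
  ⟨fun x => Complex.exp (-(a * (Real.log (lift g x ⬝ᵥ lift g x) / 2 : ℝ))), by
    have h : ContDiff ℝ ∞ fun x : Fin n → ℝ => lift g x ⬝ᵥ lift g x := by
      simp only [dotProduct, lift_apply]
      fun_prop
    have h1 : ContDiff ℝ ∞ fun x : Fin n → ℝ => Real.log (lift g x ⬝ᵥ lift g x) / 2 :=
      (h.log fun x => (dotProduct_lift_pos g x).ne').div_const 2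
    have h2 : ContDiff ℝ ∞ fun x : Fin n → ℝ =>
        Complex.exp (-(a * (Real.log (lift g x ⬝ᵥ lift g x) / 2 : ℝ))) :=
      (contDiff_const.mul (Complex.ofRealCLM.contDiff.comp h1)).neg.cexp
    exact h2⟩

theorem normFun_apply (a : ℂ) (g : SL(n + 1, ℝ)) (x : Fin n → ℝ) :
    (normFun a g).1 x = Complex.exp (-(a * (Real.log (lift g x ⬝ᵥ lift g x) / 2 : ℝ))) := rfl

theorem normFun_eq (a : ℂ) {g h : SL(n + 1, ℝ)} {x y : Fin n → ℝ} {r : ℝ} (hr : 0 < r)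
    (e : lift g x = r • lift h y) :
    (normFun a g).1 x = Complex.exp (-(a * Real.log r)) * (normFun a h).1 y := by
  rw [normFun_apply, normFun_apply, ← Complex.exp_add, e, smul_dotProduct, dotProduct_smul,
    smul_eq_mul,
    smul_eq_mul, Real.log_mul hr.ne' (mul_pos hr (dotProduct_lift_pos h y)).ne',
    Real.log_mul hr.ne' (dotProduct_lift_pos h y).ne']
  congr 1
  push_cast
  ring

theorem exp_natCast_log {r : ℝ} (hr : 0 < r) (k : ℕ) :
    Complex.exp (-((k : ℂ) * Real.log r)) = ((r : ℂ) ^ k)⁻¹ := by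
  rw [Complex.exp_neg, Complex.exp_nat_mul, ← Complex.ofReal_exp, Real.exp_log hr]

/-- The density `ℓ(v)ᵏ ‖v‖^(-(n+1)λ-k)`. -/
def testDensity (lam : ℂ) (ℓ : Fin (n + 1) → ℝ) (k : ℕ) : Density n lam :=
  ⟨fun g => linFun ℓ g ^ k * normFun ((n + 1) * lam + k) g, by
    intro g h x y e
    obtain ⟨r, hr, e⟩ := (chart_eq_iff g h x y).mp e
    change (linFun ℓ g).1 x ^ k * (normFun _ g).1 x
      = _ * ((linFun ℓ h).1 y ^ k * (normFun _ h).1 y)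
    have hr' : (r : ℂ) ≠ 0 := by exact_mod_cast hr.ne'
    rw [jac_cpow hr e, normFun_eq _ hr e, linFun_apply, linFun_apply, e, dotProduct_smul, add_mul,
      neg_add, Complex.exp_add, exp_natCast_log hr]
    rw [smul_eq_mul, Complex.ofReal_mul, mul_pow]
    field_simp⟩

/-- The linear form whose expression in the chart of `h` is `η · (y' - y)`. -/
def testForm (h : SL(n + 1, ℝ)) (y η : Fin n → ℝ) : Fin (n + 1) → ℝ :=
  Matrix.vecMul (Fin.cons (-(η ⬝ᵥ y)) η : Fin (n + 1) → ℝ) (h⁻¹).1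

theorem testForm_apply {g h : SL(n + 1, ℝ)} {x y : Fin n → ℝ} {r : ℝ}
    (e : lift g x = r • lift h y) (η : Fin n → ℝ) : (linFun (testForm h y η) g).1 x = 0 := by
  rw [linFun_apply, testForm, ← Matrix.dotProduct_mulVec]
  change (((Fin.cons (-(η ⬝ᵥ y)) η : Fin (n + 1) → ℝ) ⬝ᵥ act h⁻¹ (lift g x) : ℝ) : ℂ) = 0
  rw [← lift_mul, lift_inv_mul_of_lift_eq e, dotProduct_smul]
  simp [dotProduct, Fin.sum_univ_succ]

/-- One linear form probes both charts at a common point: its differential in the other chart is the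
pull-back of η, up to the scaling r. -/
theorem partialD_testForm {g h : SL(n + 1, ℝ)} {x y : Fin n → ℝ} {r : ℝ} (hr : 0 < r)
    (e : lift g x = r • lift h y) (η : Fin n → ℝ) (j : Fin n) :
    (partialD j (linFun (testForm h y η) g)).1 x = ((r • pullCovector g h x η) j : ℝ) := by
  rw [partialD_linFun, testForm, Matrix.vecMul_vecMul, ← Matrix.SpecialLinearGroup.coe_mul,
    Pi.smul_apply, pullCovector_eq hr e, smul_eq_mul, mul_inv_cancel_left₀ hr.ne']
  change ((_ : ℝ) : ℂ) = _
  congr 1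
  simp only [Matrix.vecMul, dotProduct, Fin.sum_univ_succ, Fin.cons_zero, Fin.cons_succ, mul_sub,
    Finset.sum_sub_distrib, neg_mul, Finset.sum_mul, mul_assoc]
  ring

theorem pullCovector_self (g : SL(n + 1, ℝ)) (x η : Fin n → ℝ) : pullCovector g g x η = η := by
  funext j
  rw [pullCovector_eq one_pos (one_smul ℝ (lift g x)).symm, inv_mul_cancel]
  simp [Matrix.one_apply, (Fin.succ_ne_zero j).symm]

theorem applyOp_testDensity (lam : ℂ) {g h : SL(n + 1, ℝ)} {x y : Fin n → ℝ} {r : ℝ} (hr : 0 < r)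
    (e : lift g x = r • lift h y) (η : Fin n → ℝ) {k : ℕ} {p : LocalSymbol n}
    (hp : DegLT (k + 1) p) :
    (applyOp 1 p ((testDensity lam (testForm h y η) k).1 g)).1 x
      = (k.factorial : ℂ) * evalSymbol (homPart n k p) x (r • pullCovector g h x η)
        * (normFun ((n + 1) * lam + k) g).1 x :=
  applyOp_pow_mul_apply hp (testForm_apply e η) (partialD_testForm hr e η) _

/-- The test densities read off the part of degree k at every point and covector, so an operator
that kills them there has no such part. -/
theorem DegLT.of_testDensity (lam : ℂ) {g : SL(n + 1, ℝ)} {k : ℕ} {p : LocalSymbol n}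
    (hp : DegLT (k + 1) p)
    (h : ∀ y η, (applyOp 1 p ((testDensity lam (testForm g y η) k).1 g)).1 y = 0) : DegLT k p := by
  have h1 : homPart n k p = 0 := by
    refine eq_zero_of_evalSymbol fun y η => ?_
    have h2 := h y η
    rw [applyOp_testDensity lam one_pos (one_smul ℝ (lift g y)).symm η hp, one_smul,
      pullCovector_self] at h2
    have h3 : (normFun ((n + 1) * lam + k) g).1 y ≠ 0 := Complex.exp_ne_zero _
    have h4 : (k.factorial : ℂ) ≠ 0 := by exact_mod_cast k.factorial_ne_zero
    simpa [h3, h4] using h2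
  intro s hs
  rcases hs.eq_or_lt with hs | hs
  · have := congrArg (coeff s) h1
    rwa [coeff_homPart, if_pos hs.symm, coeff_zero] at this
  · exact hp s hs

/-- An operator is determined by its values on the densities. -/
theorem eq_zero_of_applyOp_density (lam : ℂ) (g : SL(n + 1, ℝ)) {p : LocalSymbol n}
    (h : ∀ f : Density n lam, applyOp 1 p (f.1 g) = 0) : p = 0 := by
  have key : ∀ k, DegLT k p → p = 0 := by
    intro k
    induction k with
    | zero => exact degLT_zero_iff.mp
    | succ k ih =>
      refine fun hp => ih (DegLT.of_testDensity lam (g := g) hp fun y η => ?_)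
      rw [h]
      rfl
  exact key _ (degLT_totalDegree p)

/-! ### Total symbols of differential operators on the sphere -/

section

variable {lam mu : ℂ}

/-- The total symbol of the differential operator `T` in the chart of `g`. -/
def totalSymb (T : DiffOp n lam mu) (g : SL(n + 1, ℝ)) : LocalSymbol n := (T.2 g).choose

theorem totalSymb_spec (T : DiffOp n lam mu) (g : SL(n + 1, ℝ)) (f : Density n lam) :
    (T.1 f).1 g = applyOp 1 (totalSymb T g) (f.1 g) := (T.2 g).choose_spec f

theorem totalSymb_eq {T : DiffOp n lam mu} {g : SL(n + 1, ℝ)} {p : LocalSymbol n}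
    (h : ∀ f : Density n lam, (T.1 f).1 g = applyOp 1 p (f.1 g)) : totalSymb T g = p := by
  have h1 : totalSymb T g - p = 0 := by
    refine eq_zero_of_applyOp_density lam g fun f => ?_
    rw [← applyOpₗ_apply, map_sub, LinearMap.sub_apply, applyOpₗ_apply, applyOpₗ_apply,
      ← totalSymb_spec, h, sub_self]
  exact sub_eq_zero.mp h1

theorem eq_zero_of_totalSymb {T : DiffOp n lam mu} (h : ∀ g, totalSymb T g = 0) : T = 0 := by
  apply Subtype.ext
  refine LinearMap.ext fun f => Subtype.ext ?_
  funext g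
  rw [totalSymb_spec, h, ← applyOpₗ_apply, map_zero]
  rfl

/-- A finite cover bounds the order. In any other chart the degrees above this bound are removed one
at a time, by evaluating on test densities at a point seen by a covering chart. -/
theorem exists_degLT_totalSymb (hn : 1 ≤ n) (T : DiffOp n lam mu) :
    ∃ K, ∀ g, DegLT K (totalSymb T g) := by
  obtain ⟨S, hS⟩ := exists_finite_cover hn
  set K := S.sup fun g => (totalSymb T g).totalDegree + 1 with hK
  have hKS : ∀ g ∈ S, DegLT K (totalSymb T g) := fun g hg =>
    (degLT_totalDegree _).mono (Finset.le_sup (f := fun g => (totalSymb T g).totalDegree + 1) hg)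
  refine ⟨K, fun h => ?_⟩
  have key : ∀ m, DegLT (K + m) (totalSymb T h) → DegLT K (totalSymb T h) := by
    intro m
    induction m with
    | zero => exact id
    | succ m ih =>
      refine fun hp => ih (DegLT.of_testDensity lam (g := h) (k := K + m) hp fun y η => ?_)
      obtain ⟨g, hg, x, hx⟩ := hS (chart h y)
      obtain ⟨r, hr, e⟩ := (chart_eq_iff g h x y).mp hx
      have h1 := (T.1 (testDensity lam (testForm h y η) (K + m))).2 g h x y hx
      rw [totalSymb_spec, totalSymb_spec, applyOp_testDensity lam hr e η
        ((hKS g hg).mono (by omega))] at h1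
      have h2 : homPart n (K + m) (totalSymb T g) = 0 := by
        ext1 s
        rw [coeff_homPart, coeff_zero]
        split_ifs with hs
        · exact hKS g hg s (by omega)
        · rfl
      rw [h2, ← evalSymbolₗ_apply, map_zero, mul_zero, zero_mul, jac_cpow hr e] at h1
      exact (mul_eq_zero.mp h1.symm).resolve_left (Complex.exp_ne_zero _)
  refine key ((totalSymb T h).totalDegree + 1) ((degLT_totalDegree _).mono (by omega))

/-- The value of T on a test density is computed in both charts. The power rᵏ from the covector
cancels that of the normalizing factor, and the weights μ and λ leave the weight μ - λ of a symbol.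
-/
theorem homPart_totalSymb_mem_symb {T : DiffOp n lam mu} {k : ℕ}
    (hT : ∀ g, DegLT (k + 1) (totalSymb T g)) :
    (fun g => homPart n k (totalSymb T g)) ∈ Symb n (mu - lam) := by
  intro g h x y hx η
  obtain ⟨r, hr, e⟩ := (chart_eq_iff g h x y).mp hx
  have h1 := (T.1 (testDensity lam (testForm h y η) k)).2 g h x y hx
  rw [totalSymb_spec, totalSymb_spec, applyOp_testDensity lam hr e η (hT g),
    applyOp_testDensity lam one_pos (one_smul ℝ (lift h y)).symm η (hT h), one_smul,
    pullCovector_self, normFun_eq _ hr e, evalSymbol_smul_right, jac_cpow hr e] at h1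
  have h2 : diagOp n (fun e => (r : ℂ) ^ e) (homPart n k (totalSymb T g))
      = (r : ℂ) ^ k • homPart n k (totalSymb T g) := by
    ext1 s
    rw [coeff_diagOp, coeff_smul, coeff_homPart]
    split_ifs with hs
    · rw [hs]
    · simp
  have h3 : (normFun ((n + 1) * lam + k) h).1 y ≠ 0 := Complex.exp_ne_zero _
  have h4 : (k.factorial : ℂ) ≠ 0 := by exact_mod_cast k.factorial_ne_zero
  have hr' : (r : ℂ) ≠ 0 := by exact_mod_cast hr.ne'
  rw [h2, evalSymbol_smul, add_mul, neg_add, Complex.exp_add, exp_natCast_log hr] at h1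
  rw [jac_cpow hr e]
  have h5 : Complex.exp (-((n + 1) * mu * Real.log r))
      = Complex.exp (-((n + 1) * (mu - lam) * Real.log r)) * Complex.exp (-((n + 1) * lam
          * Real.log r)) := by
    rw [← Complex.exp_add]
    congr 1
    ring
  rw [h5] at h1
  have h6 : Complex.exp (-((n + 1) * lam * Real.log r)) ≠ 0 := Complex.exp_ne_zero _
  generalize Complex.exp (-((n + 1) * lam * Real.log r)) = E at *
  generalize Complex.exp (-((n + 1) * (mu - lam) * Real.log r)) = F at *
  have h7 : ((k.factorial : ℂ) * E * (normFun ((n + 1) * lam + k) h).1 y)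
      * (evalSymbol (homPart n k (totalSymb T g)) x (pullCovector g h x η))
      = ((k.factorial : ℂ) * E * (normFun ((n + 1) * lam + k) h).1 y)
      * (F * evalSymbol (homPart n k (totalSymb T h)) y η) := by
    rw [← sub_eq_zero] at h1 ⊢
    rw [← h1]
    field_simp
  exact mul_left_cancel₀ (mul_ne_zero (mul_ne_zero h4 h6) h3) h7

end

/-! ### Bijectivity of the quantization map -/

instance instAddCommGroupSymb (del : ℂ) : AddCommGroup (Symb n del) :=
  Module.addCommMonoidToAddCommGroup ℂ

instance instAddCommGroupDiffOp (lam mu : ℂ) : AddCommGroup (DiffOp n lam mu) :=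
  Module.addCommMonoidToAddCommGroup ℂ

theorem eq_zero_of_diagOp_pow_eq_zero {c : ℂ} (hc : c ≠ 0) {P : LocalSymbol n}
    (h : diagOp n (fun e => c ^ e) P = 0) : P = 0 := by
  ext1 s
  have := congrArg (coeff s) h
  rw [coeff_diagOp, coeff_zero] at this
  rw [coeff_zero]
  exact (smul_eq_zero.mp this).resolve_left (pow_ne_zero _ hc)

theorem DegLT.of_diagOp_pow {c : ℂ} (hc : c ≠ 0) {k : ℕ} {P : LocalSymbol n}
    (h : DegLT k (ProjQuant.diagOp n (fun e => c ^ e) P)) : DegLT k P := by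
  intro s hs
  have := h s hs
  rw [coeff_diagOp] at this
  exact (smul_eq_zero.mp this).resolve_left (pow_ne_zero _ hc)

/-- Quantization preserves the leading degree, so a bound on the image descends to the symbol one
degree at a time. -/
theorem DegLT.of_quantSymb {lam del c : ℂ} {k : ℕ} {P : LocalSymbol n}
    (h : DegLT k (ProjQuant.quantSymb n lam del c P)) : DegLT k P := by
  have key : ∀ m, DegLT (k + m) P → DegLT k P := by
    intro m
    induction m with
    | zero => exact id
    | succ m ih =>
      intro hP
      have h1 := (h.mono (Nat.le_add_right k m)).sub (degLT_quantSymb_sub lam del c hP)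
      refine ih ?_
      have h2 : ProjQuant.quantSymb n lam del c P - (ProjQuant.quantSymb n lam del c P - P) = P :=
          by
        abel
      rwa [h2] at h1
  exact key (P.totalDegree + 1) ((degLT_totalDegree P).mono (by omega))

section

variable (hn : 1 ≤ n) {lam mu : ℂ} {c : ℂ}
  (hres : ∀ l : ℕ, ((n : ℂ) + 1) * (1 - (mu - lam)) + l ≠ 0)

theorem totalSymb_quantMap (P : Symb n (mu - lam)) (g : SL(n + 1, ℝ)) :
    totalSymb (quantMap hn c hres P) g
      = diagOp n (fun e => c ^ e) (quantSymb n lam (mu - lam) c (P.1 g)) :=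
  totalSymb_eq fun f => by rw [applyOp_one_diagOp_pow, quantMap_apply]

theorem totalSymb_sub (T T' : DiffOp n lam mu) (g : SL(n + 1, ℝ)) :
    totalSymb (T - T') g = totalSymb T g - totalSymb T' g :=
  totalSymb_eq fun f => by
    rw [← applyOpₗ_apply, map_sub, LinearMap.sub_apply, applyOpₗ_apply, applyOpₗ_apply,
      ← totalSymb_spec, ← totalSymb_spec, sub_eq_add_neg]
    change (T.1 f).1 g + (-1 : ℂ) • (T'.1 f).1 g = _
    module

theorem quantMap_injective (hc : c ≠ 0) : Function.Injective (quantMap hn c hres) := by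
  rw [injective_iff_map_eq_zero]
  intro P hP
  apply Subtype.ext
  funext g
  apply quantSymb_injective lam (mu - lam) c
  change _ = quantSymb n lam (mu - lam) c 0
  rw [map_zero]
  apply eq_zero_of_diagOp_pow_eq_zero hc
  rw [← totalSymb_quantMap hn hres, hP]
  refine totalSymb_eq fun f => ?_
  rw [← applyOpₗ_apply, map_zero]
  rfl

/-- Induction on the order: subtracting the quantization of the leading part of T lowers the order.
Division by cᵏ undoes the factor that normal ordering puts on degree k. -/
theorem quantMap_surjective (hc : c ≠ 0) : Function.Surjective (quantMap hn c hres) := by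
  have key : ∀ K (T : DiffOp n lam mu), (∀ g, DegLT K (totalSymb T g)) →
      ∃ P, quantMap hn c hres P = T := by
    intro K
    induction K with
    | zero =>
      intro T hT
      exact ⟨0, by rw [map_zero, eq_zero_of_totalSymb fun g => degLT_zero_iff.mp (hT g)]⟩
    | succ k ih =>
      intro T hT
      set P : Symb n (mu - lam) := (c ^ k)⁻¹ • ⟨_, homPart_totalSymb_mem_symb hT⟩ with hP
      have hPg : ∀ g, P.1 g = (c ^ k)⁻¹ • homPart n k (totalSymb T g) := fun g => rfl
      obtain ⟨P', hP'⟩ := ih (T - quantMap hn c hres P) fun g => by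
        have hdeg : DegLT (k + 1) (P.1 g) := by
          rw [hPg]
          exact ((hT g).diagOp _).smul _
        have h1 := (degLT_quantSymb_sub lam (mu - lam) c hdeg).diagOp (fun e => c ^ e)
        have h2 : DegLT k (totalSymb T g - diagOp n (fun e => c ^ e) (P.1 g)) := by
          intro s hs
          rw [coeff_sub, coeff_diagOp, hPg, coeff_smul, coeff_homPart]
          rcases hs.eq_or_lt with hs | hs
          · rw [if_pos hs.symm, ← hs, smul_smul, mul_inv_cancel₀ (pow_ne_zero _ hc), one_smul,
              sub_self]
          · rw [if_neg hs.ne', hT g s hs, smul_zero, smul_zero, sub_zero]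
        rw [totalSymb_sub, totalSymb_quantMap]
        have h3 := h2.sub h1
        rw [map_sub] at h3
        convert h3 using 1
        abel
      exact ⟨P' + P, by rw [map_add, hP', sub_add_cancel]⟩
  intro T
  obtain ⟨K, hK⟩ := exists_degLT_totalSymb hn T
  exact key K T hK

end

/-! ### Uniqueness -/

theorem conj_single_eq_sum (g : SL(n + 1, ℝ)) (a b : Fin (n + 1)) :
    (g⁻¹).1 * Matrix.single a b (1 : ℝ) * g.1
      = ∑ i, ∑ j, ((g⁻¹).1 i a * g.1 b j) • Matrix.single i j (1 : ℝ) := by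
  rw [Matrix.single_eq_single_vecMulVec_single, Matrix.mul_vecMulVec, Matrix.vecMulVec_mul]
  ext i j
  simp [Matrix.sum_apply, Matrix.vecMulVec_apply, Matrix.single_apply, ite_and]

/-- The tensor ∑ E_ab ⊗ E_ba is invariant under conjugation. In the chart of g the generator X
appears as g⁻¹Xg, and the invariance brings the Casimir operator back to the elementary matrices. -/
theorem sum_conj_single {W : Type*} [AddCommMonoid W] [Module ℝ W]
    (B : Matrix (Fin (n + 1)) (Fin (n + 1)) ℝ →ₗ[ℝ] Matrix (Fin (n + 1)) (Fin (n + 1)) ℝ →ₗ[ℝ] W)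
    (g : SL(n + 1, ℝ)) :
    ∑ a, ∑ b, B ((g⁻¹).1 * Matrix.single a b (1 : ℝ) * g.1)
        ((g⁻¹).1 * Matrix.single b a (1 : ℝ) * g.1)
      = ∑ a, ∑ b, B (Matrix.single a b 1) (Matrix.single b a 1) := by
  have hinv : (g⁻¹).1 * g.1 = 1 := by
    rw [← Matrix.SpecialLinearGroup.coe_mul, inv_mul_cancel, Matrix.SpecialLinearGroup.coe_one]
  have hd : ∀ i j, ∑ a, (g⁻¹).1 i a * g.1 a j = if i = j then 1 else 0 := fun i j => by
    rw [← Matrix.one_apply, ← hinv, Matrix.mul_apply]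
  have h1 : ∀ a b, B ((g⁻¹).1 * Matrix.single a b (1 : ℝ) * g.1)
        ((g⁻¹).1 * Matrix.single b a (1 : ℝ) * g.1)
      = ∑ q : (Fin (n + 1) × Fin (n + 1)) × Fin (n + 1) × Fin (n + 1),
        (((g⁻¹).1 q.2.1 a * g.1 a q.1.2) * ((g⁻¹).1 q.1.1 b * g.1 b q.2.2))
        • B (Matrix.single q.2.1 q.2.2 1) (Matrix.single q.1.1 q.1.2 1) := by
    intro a b
    rw [conj_single_eq_sum, conj_single_eq_sum]
    simp only [map_sum, LinearMap.sum_apply, map_smul, LinearMap.smul_apply, Finset.smul_sum,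
      smul_smul,
      Fintype.sum_prod_type]
    refine Finset.sum_congr rfl fun i _ => Finset.sum_congr rfl fun j _ =>
      Finset.sum_congr rfl fun k _ => Finset.sum_congr rfl fun l _ => ?_
    congr 1
    ring
  simp only [h1]
  have h2 : ∀ a, (∑ b, ∑ q : (Fin (n + 1) × Fin (n + 1)) × Fin (n + 1) × Fin (n + 1),
        (((g⁻¹).1 q.2.1 a * g.1 a q.1.2) * ((g⁻¹).1 q.1.1 b * g.1 b q.2.2))
        • B (Matrix.single q.2.1 q.2.2 1) (Matrix.single q.1.1 q.1.2 1))
      = ∑ q : (Fin (n + 1) × Fin (n + 1)) × Fin (n + 1) × Fin (n + 1),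
        (((g⁻¹).1 q.2.1 a * g.1 a q.1.2) * if q.1.1 = q.2.2 then 1 else 0)
        • B (Matrix.single q.2.1 q.2.2 1) (Matrix.single q.1.1 q.1.2 1) := by
    intro a
    rw [Finset.sum_comm]
    simp only [← Finset.sum_smul, ← Finset.mul_sum, hd]
  simp only [h2]
  rw [Finset.sum_comm]
  simp only [← Finset.sum_smul, ← Finset.sum_mul, hd, Fintype.sum_prod_type]
  simp only [mul_ite, mul_one, mul_zero, ite_smul, one_smul, zero_smul, Finset.sum_ite_eq,
    Finset.sum_ite_eq', Finset.mem_univ, if_true]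
  rw [Finset.sum_comm]

theorem ofReal_smul_localSymbol (r : ℝ) (P : LocalSymbol n) : (r : ℂ) • P = r • P := by
  ext1 s
  rw [coeff_smul, coeff_smul]
  apply Subtype.ext
  funext x
  simp

/-- The Casimir operator acts on symbols through their degree. -/
theorem sum_symbLie_symbLie {del : ℂ} (P : Symb n del) (g : SL(n + 1, ℝ)) :
    (∑ a, ∑ b, symbLie (Matrix.single a b 1) (symbLie (Matrix.single b a 1) P)).1 g
      = diagOp n (fun e => 2 * e * e + 2 * (n - (n + 1) * del) * e + n * (n + 1) * del * (del - 1))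
        (P.1 g) := by
  rw [← sum_lieSymb_lieSymb_single]
  let B : Matrix (Fin (n + 1)) (Fin (n + 1)) ℝ →ₗ[ℝ]
      Matrix (Fin (n + 1)) (Fin (n + 1)) ℝ →ₗ[ℝ] LocalSymbol n :=
    LinearMap.mk₂ ℝ (fun X Y => lieSymb del (projField X) (lieSymb del (projField Y) (P.1 g)))
      (fun X X' Y => by rw [projField_add, lieSymb_add_field])
      (fun r X Y => by rw [projField_smul, lieSymb_smul_field, ofReal_smul_localSymbol])
      (fun X Y Y' => by rw [projField_add, lieSymb_add_field, lieSymb_add])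
      (fun r X Y => by rw [projField_smul, lieSymb_smul_field, lieSymb_smul,
          ofReal_smul_localSymbol])
  have h1 := sum_conj_single B g
  simp only [AddSubmonoidClass.coe_finsetSum, Finset.sum_apply]
  exact h1

theorem symbLie_eq_of_trace {del : ℂ} (X : Matrix (Fin (n + 1)) (Fin (n + 1)) ℝ) (a : ℝ)
    (P : Symb n del) : symbLie (X + a • 1) P = symbLie X P := by
  apply Subtype.ext
  funext g
  change lieSymb del (fundField (X + a • 1) g) (P.1 g) = lieSymb del (fundField X g) (P.1 g)
  rw [fundField_add, fundField_smul, fundField_one, smul_zero, add_zero]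

theorem isLieOp_unique {lam mu : ℂ} {X : Matrix (Fin (n + 1)) (Fin (n + 1)) ℝ}
    {T T₁ T₂ : DiffOp n lam mu} (h₁ : IsLieOp X T T₁) (h₂ : IsLieOp X T T₂) : T₁ = T₂ := by
  apply Subtype.ext
  refine LinearMap.ext fun f => Subtype.ext ?_
  funext g
  obtain ⟨f₁, hf₁, h₁⟩ := h₁ f
  obtain ⟨f₂, hf₂, h₂⟩ := h₂ f
  have hf : f₁ = f₂ := by
    apply Subtype.ext
    funext g
    rw [hf₁ g, hf₂ g]
  subst hf
  have h3 := (h₁ g).trans (h₂ g).symm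
  exact add_right_cancel (b := (T.1 f₁).1 g) h3

/-- The comparison map T = Q⁻¹Q' commutes with the Casimir operator. On P of degree k, the
difference T P - P has components of lower degree only, yet it must have the Casimir eigenvalue of
degree k, so it vanishes. -/
theorem quantMap_unique (hn : 1 ≤ n) {lam mu : ℂ}
    (hres : ∀ l : ℕ, ((n : ℂ) + 1) * (1 - (mu - lam)) + l ≠ 0) {ħ : ℝ} (hħ : ħ ≠ 0)
    (Q' : Symb n (mu - lam) →ₗ[ℂ] DiffOp n lam mu)
    (hN : IsNormalized ħ Q') (hL : IsLieEquivariant Q') :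
    Q' = quantMap hn (-(Complex.I * ħ)) hres := by
  set c : ℂ := -(Complex.I * ħ) with hcdef
  have hc : c ≠ 0 := by simp [hcdef, hħ]
  let Q := LinearEquiv.ofBijective (quantMap hn c hres)
    ⟨quantMap_injective hn hres hc, quantMap_surjective hn hres hc⟩
  have hQ : ∀ P, Q P = quantMap hn c hres P := fun P => rfl
  let T : Module.End ℂ (Symb n (mu - lam)) := Q.symm.toLinearMap.comp Q'
  have hT : ∀ P, quantMap hn c hres (T P) = Q' P := fun P => Q.apply_symm_apply (Q' P)
  -- Both sides quantize to the Lie derivative of Q'(P), which is unique, and quantization is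
  -- injective.
  have hcomm₀ : ∀ X : Matrix (Fin (n + 1)) (Fin (n + 1)) ℝ, X.trace = 0 → ∀ P,
      T (symbLie X P) = symbLie X (T P) := by
    intro X hX P
    obtain ⟨P', hP', hop⟩ := hL X hX P
    have h1 : P' = symbLie X P := by
      apply Subtype.ext
      funext g
      exact hP' g
    rw [h1, ← hT, ← hT] at hop
    exact quantMap_injective hn hres hc (isLieOp_unique hop (isLieOp_quantMap hn c hres X (T P)))
  -- The Casimir sum involves the E_aa, whose trace is not zero. A multiple of the identity corrects
  -- the trace and acts by zero.
  have hcomm : ∀ (X : Matrix (Fin (n + 1)) (Fin (n + 1)) ℝ) P,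
      T (symbLie X P) = symbLie X (T P) := by
    intro X P
    rw [← symbLie_eq_of_trace X (-(X.trace / (n + 1))) P,
      ← symbLie_eq_of_trace X (-(X.trace / (n + 1))) (T P)]
    refine hcomm₀ _ ?_ P
    have : (n : ℝ) + 1 ≠ 0 := by positivity
    simp [Matrix.trace_add, Matrix.trace_smul]
    field_simp
    ring
  have hhom : ∀ k (P : Symb n (mu - lam)), (∀ g, (P.1 g).IsHomogeneous k) → T P = P := by
    intro k P hP
    have hdeg : ∀ g, DegLT k ((T P - P).1 g) := by
      intro g
      obtain ⟨r, hr, hf⟩ := hN k P hP g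
      have h1 : totalSymb (Q' P) g = diagOp n (fun e => c ^ e) (P.1 g + r) :=
        totalSymb_eq fun f => by rw [applyOp_one_diagOp_pow, hf, normalOrder]
      have h2 : totalSymb (quantMap hn c hres (T P - P)) g
          = diagOp n (fun e => c ^ e) (r - (quantSymb n lam (mu - lam) c (P.1 g) - P.1 g)) := by
        rw [map_sub, totalSymb_sub, hT, h1, totalSymb_quantMap, map_sub, map_sub, map_add]
        abel
      have hr' : DegLT k r := fun s hs => by
        by_contra h
        exact absurd (hr s (mem_support_iff.mpr h)) (not_lt.mpr hs)
      have h3 := (hr'.sub (degLT_quantSymb_sub lam (mu - lam) c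
        (degLT_of_isHomogeneous (hP g)))).diagOp (fun e => c ^ e)
      rw [← h2, totalSymb_quantMap] at h3
      exact (h3.of_diagOp_pow hc).of_quantSymb
    set κ : ℕ → ℂ := fun e => 2 * e * e + 2 * (n - (n + 1) * (mu - lam)) * e
      + n * (n + 1) * (mu - lam) * ((mu - lam) - 1) with hκ
    have hcas : ∑ a, ∑ b, symbLie (Matrix.single a b 1) (symbLie (Matrix.single b a 1) P) = κ k
        • P := by
      apply Subtype.ext
      funext g
      rw [sum_symbLie_symbLie]
      ext1 s
      change _ = (κ k • P.1 g).coeff s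
      rw [coeff_diagOp, coeff_smul]
      by_cases hs : (P.1 g).coeff s = 0
      · rw [hs, smul_zero, smul_zero]
      · rw [show s.degree = k by
          rw [← (hP g) hs, Finsupp.degree_eq_weight_one]
          rfl]
    have hcas' : ∑ a, ∑ b, symbLie (Matrix.single a b 1) (symbLie (Matrix.single b a 1) (T P - P))
        = κ k • (T P - P) := by
      have h1 := congrArg T hcas
      simp only [map_sum, hcomm, map_smul] at h1
      simp only [map_sub, Finset.sum_sub_distrib, h1, hcas, smul_sub]
    have hzero : T P - P = 0 := by
      apply Subtype.ext
      funext g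
      ext1 s
      change _ = (0 : LocalSymbol n).coeff s
      rw [coeff_zero]
      by_cases hs : k ≤ s.degree
      · exact hdeg g s hs
      have h1 := congrArg (fun R : Symb n (mu - lam) => (R.1 g).coeff s) hcas'
      simp only [sum_symbLie_symbLie] at h1
      change _ = (κ k • (T P - P).1 g).coeff s at h1
      rw [coeff_diagOp, coeff_smul, ← sub_eq_zero, ← sub_smul] at h1
      refine (smul_eq_zero.mp h1).resolve_left ?_
      -- For e < k, κ(e) - κ(k) = 2(e - k)(e + k - 1 + (n+1)(1-δ)). With k = e + 1 + m the last
      -- factor is the nonresonant number for l = 2e + m.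
      obtain ⟨m, hm⟩ : ∃ m, k = s.degree + 1 + m := ⟨k - s.degree - 1, by omega⟩
      have h2 := hres (2 * s.degree + m)
      have h3 : (m : ℂ) + 1 ≠ 0 := by exact_mod_cast m.succ_ne_zero
      have h4 : κ s.degree - κ k = -2 * ((m : ℂ) + 1) * (((n : ℂ) + 1) * (1 - (mu - lam))
          + ((2 * s.degree + m : ℕ) : ℂ)) := by
        simp only [hκ, hm]
        push_cast
        ring
      change κ s.degree - κ k ≠ 0
      rw [h4]
      exact mul_ne_zero (mul_ne_zero (by norm_num) h3) h2
    exact sub_eq_zero.mp hzero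
  have hid : ∀ P, T P = P := by
    intro P
    obtain ⟨K, hK⟩ := exists_degLT_symb hn P
    conv_lhs => rw [sum_symbPart hK]
    conv_rhs => rw [sum_symbPart hK]
    rw [map_sum]
    refine Finset.sum_congr rfl fun e _ => hhom e _ fun g => ?_
    rw [isHomogeneous_iff_homPart]
    change homPart n e (homPart n e (P.1 g)) = homPart n e (P.1 g)
    ext1 s
    rw [coeff_homPart, coeff_homPart]
    split_ifs <;> rfl
  refine LinearMap.ext fun P => ?_
  rw [← hT, hid]

/-! ### The hypergeometric formula -/

theorem rising_eq_prod {A : Type*} [CommRing A] [Algebra ℂ A] (a : A) (m : ℕ) :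
    rising a m = ∏ i ∈ Finset.range m, (a + i) := by
  induction m with
  | zero => simp [rising]
  | succ m ih =>
    rw [Finset.prod_range_succ, ← ih, rising, rising, ascPochhammer_succ_right]
    simp

theorem rising_eq_eval (a : ℂ) (m : ℕ) : rising a m = (ascPochhammer ℂ m).eval a := by
  rw [rising, Polynomial.coe_aeval_eq_eval]

theorem map_rising {A A' : Type*} [Semiring A] [Algebra ℂ A] [Semiring A'] [Algebra ℂ A']
    (φ : A →ₐ[ℂ] A') (a : A) (m : ℕ) : φ (rising a m) = rising (φ a) m :=
  (Polynomial.aeval_algHom_apply φ a _).symm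

theorem map_parA₁ {A A' : Type*} [Semiring A] [Algebra ℂ A] [Semiring A'] [Algebra ℂ A']
    (φ : A →ₐ[ℂ] A') (lam : ℂ) (E : A) : φ (parA₁ n lam E) = parA₁ n lam (φ E) := by
  simp [parA₁]

theorem map_parA₂ {A A' : Type*} [Semiring A] [Algebra ℂ A] [Semiring A'] [Algebra ℂ A']
    (φ : A →ₐ[ℂ] A') (del : ℂ) (E : A) : φ (parA₂ n del E) = parA₂ n del (φ E) := by
  rw [parA₂, parA₂, map_add, map_mul, map_ofNat, AlgHom.commutes]

theorem map_parB₁ {A A' : Type*} [Semiring A] [Algebra ℂ A] [Semiring A'] [Algebra ℂ A']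
    (φ : A →ₐ[ℂ] A') (del : ℂ) (E : A) : φ (parB₁ n del E) = parB₁ n del (φ E) := by
  simp [parB₁]

theorem map_parB₂ {A A' : Type*} [Semiring A] [Algebra ℂ A] [Semiring A'] [Algebra ℂ A']
    (φ : A →ₐ[ℂ] A') (del : ℂ) (E : A) : φ (parB₂ n del E) = parB₂ n del (φ E) := by
  simp [parB₂]

theorem prod_range_two_mul {A : Type*} [CommRing A] (a : A) (m : ℕ) :
    ∏ i ∈ Finset.range (2 * m), (a + i)
      = ∏ i ∈ Finset.range m, ((a + 2 * i) * (a + 2 * i + 1)) := by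
  induction m with
  | zero => simp
  | succ m ih =>
    rw [mul_add, mul_one, Finset.prod_range_succ, Finset.prod_range_succ, Finset.prod_range_succ,
      ih]
    push_cast
    ring

/-- The duplication formula `4ᵐ (B₁)_m (B₂)_m = (A₂)_m (A₂ + m)_m`. -/
theorem rising_parB₁_mul_rising_parB₂ {A : Type*} [CommRing A] [Algebra ℂ A] (del : ℂ) (E : A)
    (m : ℕ) : 4 ^ m * (rising (parB₁ n del E) m * rising (parB₂ n del E) m)
      = rising (parA₂ n del E) m * rising (parA₂ n del E + m) m := by
  have h1 : rising (parA₂ n del E) m * rising (parA₂ n del E + m) m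
      = ∏ i ∈ Finset.range (2 * m), (parA₂ n del E + i) := by
    rw [two_mul, Finset.prod_range_add, rising_eq_prod, rising_eq_prod]
    congr 1
    refine Finset.prod_congr rfl fun i _ => ?_
    push_cast
    ring
  have hB₁ : 2 * parB₁ n del E = parA₂ n del E := by
    rw [parB₁, parA₂, mul_add, ← map_ofNat (algebraMap ℂ A) 2, ← map_mul]
    congr 2
    ring
  have hB₂ : 2 * parB₂ n del E = parA₂ n del E + 1 := by
    rw [parB₂, parA₂, mul_add, ← map_ofNat (algebraMap ℂ A) 2, ← map_mul, add_assoc,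
      ← map_one (algebraMap ℂ A), ← map_add]
    congr 2
    ring
  have h4 : (4 : A) ^ m = ∏ i ∈ Finset.range m, 4 := by simp
  rw [h1, prod_range_two_mul, rising_eq_prod, rising_eq_prod, h4, ← Finset.prod_mul_distrib,
    ← Finset.prod_mul_distrib]
  refine Finset.prod_congr rfl fun i _ => ?_
  rw [← hB₁] at hB₂ ⊢
  linear_combination (2 * parB₁ n del E + 2 * i) * hB₂

theorem quantCoeff_eq (lam del : ℂ) (m e : ℕ) :
    quantCoeff n lam del m e = rising (parA₁ n lam (e : ℂ)) m
      / (rising (parA₂ n del (e : ℂ) + m) m * m.factorial) := by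
  simp only [quantCoeff, rising_eq_eval, parA₁, parA₂, Algebra.algebraMap_self, RingHom.id_apply,
    add_sub_assoc]

theorem rising_parA₂_add_ne_zero {del : ℂ} (hres : ∀ l : ℕ, ((n : ℂ) + 1) * (1 - del) + l ≠ 0)
    (m e : ℕ) : rising (parA₂ n del (e : ℂ) + m) m ≠ 0 := by
  rw [rising_eq_prod]
  refine Finset.prod_ne_zero_iff.mpr fun i hi => ?_
  rw [Finset.mem_range] at hi
  -- A factor of the product exists only for m ≥ 1; then the -1 in A₂ is absorbed and every factor
  -- is nonresonant with a natural number l.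
  obtain ⟨m, rfl⟩ : ∃ m', m = m' + 1 := ⟨m - 1, by omega⟩
  have h := hres (2 * e + m + i)
  have h1 : parA₂ n del (e : ℂ) + ((m + 1 : ℕ) : ℂ) + i
      = ((n : ℂ) + 1) * (1 - del) + ((2 * e + m + i : ℕ) : ℂ) := by
    simp only [parA₂, Algebra.algebraMap_self, RingHom.id_apply]
    push_cast
    ring
  rwa [h1]

theorem rising_parB₂_ne_zero {del : ℂ} (hres : ∀ l : ℕ, ((n : ℂ) + 1) * (1 - del) + l ≠ 0)
    (m e : ℕ) : rising (parB₂ n del (e : ℂ)) m ≠ 0 := by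
  rw [rising_eq_prod]
  refine Finset.prod_ne_zero_iff.mpr fun i _ => ?_
  have h := hres (2 * e + 2 * i)
  have h1 : ((n : ℂ) + 1) * (1 - del) + ((2 * e + 2 * i : ℕ) : ℂ)
      = 2 * (parB₂ n del (e : ℂ) + i) := by
    simp only [parB₂, Algebra.algebraMap_self, RingHom.id_apply]
    push_cast
    ring
  rw [h1] at h
  exact right_ne_zero_of_mul h

/-- Twice a factor is (n+1)(1-δ) + 2e + 2i - 1. Nonresonance covers it unless e = i = 0, and that
factor vanishes only for δ = n/(n+1). -/
theorem rising_parB₁_ne_zero {del : ℂ} (hres : ∀ l : ℕ, ((n : ℂ) + 1) * (1 - del) + l ≠ 0)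
    (hdel : del ≠ (n : ℂ) / ((n : ℂ) + 1)) (m e : ℕ) :
    rising (parB₁ n del (e : ℂ)) m ≠ 0 := by
  have hn : (n : ℂ) + 1 ≠ 0 := by exact_mod_cast n.succ_ne_zero
  rw [rising_eq_prod]
  refine Finset.prod_ne_zero_iff.mpr fun i _ => ?_
  have h1 : parB₁ n del (e : ℂ) + i = (((n : ℂ) + 1) * (1 - del) + (2 * e + 2 * i - 1)) / 2 := by
    simp only [parB₁, Algebra.algebraMap_self, RingHom.id_apply]
    ring
  rw [h1]
  refine div_ne_zero ?_ two_ne_zero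
  rcases Nat.eq_zero_or_pos (e + i) with h0 | h0
  · obtain ⟨rfl, rfl⟩ : e = 0 ∧ i = 0 := by omega
    intro h2
    apply hdel
    rw [eq_div_iff hn]
    push_cast at h2
    linear_combination -h2
  · have h := hres (2 * e + 2 * i - 1)
    rw [Nat.cast_sub (by omega)] at h
    push_cast at h
    exact h

/-- The duplication formula cancels (A₂)_m among rational functions, before evaluation. What remains
has a denominator that is nonzero at every natural number, also for δ = n/(n+1), where B₁ and A₂
both vanish at e = 0. -/
theorem eval_hypCoeff {del : ℂ} (hres : ∀ l : ℕ, ((n : ℂ) + 1) * (1 - del) + l ≠ 0)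
    (lam : ℂ) (m e : ℕ) :
    RatFunc.eval (RingHom.id ℂ) (e : ℂ) (hypCoeff (parA₁ n lam RatFunc.X) (parA₂ n del RatFunc.X)
      (parB₁ n del RatFunc.X) (parB₂ n del RatFunc.X) m) = 4 ^ m * quantCoeff n lam del m e := by
  let φ : Polynomial ℂ →ₐ[ℂ] RatFunc ℂ := IsScalarTower.toAlgHom ℂ (Polynomial ℂ) (RatFunc ℂ)
  have hφ : ∀ p, φ p = algebraMap (Polynomial ℂ) (RatFunc ℂ) p := fun p => rfl
  have hinj : Function.Injective φ := RatFunc.algebraMap_injective ℂ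
  have hX : RatFunc.X = φ Polynomial.X := RatFunc.algebraMap_X.symm
  let ev : Polynomial ℂ →ₐ[ℂ] ℂ := Polynomial.aeval (e : ℂ)
  have hev : ∀ p, ev p = p.eval₂ (RingHom.id ℂ) (e : ℂ) := fun p => by
    simp [ev, Polynomial.coe_aeval_eq_eval, Polynomial.eval₂_eq_eval_map]
  have hevX : ev Polynomial.X = (e : ℂ) := by simp [ev]
  have hf : (m.factorial : ℂ) ≠ 0 := by exact_mod_cast m.factorial_ne_zero
  set p : Polynomial ℂ := 4 ^ m * rising (parA₁ n lam Polynomial.X) m with hp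
  set q : Polynomial ℂ := rising (parA₂ n del Polynomial.X + (m : Polynomial ℂ)) m
    * (m.factorial : Polynomial ℂ) with hq
  have hqe : ev q = rising (parA₂ n del (e : ℂ) + m) m * m.factorial := by
    rw [hq, map_mul, map_rising, map_add, map_parA₂, hevX, map_natCast, map_natCast]
  have hpe : ev p = 4 ^ m * rising (parA₁ n lam (e : ℂ)) m := by
    rw [hp, map_mul, map_rising, map_parA₁, hevX, map_pow, map_ofNat]
  have hq0 : ev q ≠ 0 := by
    rw [hqe]
    exact mul_ne_zero (rising_parA₂_add_ne_zero hres m e) hf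
  -- The cancellation needs a nonzero polynomial: each factor has slope 2, so it cannot vanish at
  -- both 0 and 1.
  have hA₂ : rising (parA₂ n del Polynomial.X) m ≠ (0 : Polynomial ℂ) := by
    rw [rising_eq_prod]
    refine Finset.prod_ne_zero_iff.mpr fun i _ h => ?_
    have h0 := congrArg (Polynomial.eval 0) h
    have h1 := congrArg (Polynomial.eval 1) h
    simp [parA₂] at h0 h1
    exact two_ne_zero (α := ℂ) (by linear_combination h1 - h0)
  have hdup := rising_parB₁_mul_rising_parB₂ (n := n) del (Polynomial.X : Polynomial ℂ) m
  have hB : rising (parB₁ n del Polynomial.X) m * rising (parB₂ n del Polynomial.X) m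
      ≠ (0 : Polynomial ℂ) := by
    intro h
    rw [h, mul_zero, eq_comm, mul_eq_zero] at hdup
    rcases hdup with h | h
    · exact hA₂ h
    · apply hq0
      rw [hq, h, zero_mul, map_zero]
  have hcoeff : hypCoeff (parA₁ n lam RatFunc.X) (parA₂ n del RatFunc.X)
      (parB₁ n del RatFunc.X) (parB₂ n del RatFunc.X) m = φ p / φ q := by
    have hq' : φ q ≠ 0 := fun h => hq0 (by
      rw [← map_zero φ] at h
      rw [hinj h, map_zero])
    have hB' : φ (rising (parB₁ n del Polynomial.X) m * rising (parB₂ n del Polynomial.X) m) ≠ 0 :=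
      fun h => hB (hinj (h.trans (map_zero φ).symm))
    have hf' : φ (m.factorial : Polynomial ℂ) ≠ 0 := by
      rw [map_natCast]
      exact_mod_cast m.factorial_ne_zero
    rw [hypCoeff, hX, ← map_parA₁, ← map_parA₂, ← map_parB₁, ← map_parB₂, ← map_rising,
      ← map_rising,
      ← map_rising, ← map_rising, ← map_natCast φ, ← map_mul, ← map_mul, div_div, ← map_mul,
      div_eq_div_iff (by rw [map_mul]; exact mul_ne_zero hB' hf') hq', ← map_mul, ← map_mul]
    refine congrArg φ ?_
    rw [hp, hq]
    generalize rising (parA₁ n lam (Polynomial.X : Polynomial ℂ)) m = a₁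
    generalize rising (parA₂ n del (Polynomial.X : Polynomial ℂ)) m = a₂ at hdup ⊢
    generalize rising (parB₁ n del (Polynomial.X : Polynomial ℂ)) m = b₁ at hdup ⊢
    generalize rising (parB₂ n del (Polynomial.X : Polynomial ℂ)) m = b₂ at hdup ⊢
    generalize rising (parA₂ n del (Polynomial.X : Polynomial ℂ) + (m : Polynomial ℂ)) m
        = a₃ at hdup ⊢
    linear_combination -(a₁ * (m.factorial : Polynomial ℂ)) * hdup
  rw [hcoeff, quantCoeff_eq, ← mul_div_assoc, ← hpe, ← hqe, eq_div_iff hq0, hφ, hφ]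
  -- The denominator in lowest terms divides q, hence is nonzero at e, and evaluation is compatible
  -- with the product (p/q) · q.
  have h1 : Polynomial.eval₂ (RingHom.id ℂ) (e : ℂ) (RatFunc.denom
      (algebraMap (Polynomial ℂ) (RatFunc ℂ) p / algebraMap (Polynomial ℂ) (RatFunc ℂ) q)) ≠ 0 := by
    obtain ⟨d, hd⟩ := RatFunc.denom_div_dvd p q
    rw [hev, hd, Polynomial.eval₂_mul] at hq0
    exact left_ne_zero_of_mul hq0
  have h2 := RatFunc.eval_mul (f := RingHom.id ℂ) (a := (e : ℂ)) h1
    (y := algebraMap (Polynomial ℂ) (RatFunc ℂ) q) (by simp)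
  have hq'' : algebraMap (Polynomial ℂ) (RatFunc ℂ) q ≠ 0 := fun h => hq0 (by
    rw [hinj (h.trans (map_zero φ).symm), map_zero])
  rw [div_mul_cancel₀ _ hq''] at h2
  rw [hev, hev]
  simpa using h2.symm

theorem ratEuler_eq_diagOp (c : RatFunc ℂ) (P : LocalSymbol n) :
    ratEuler c P = diagOp n (fun e => RatFunc.eval (RingHom.id ℂ) (e : ℂ) c) P := by
  rw [ratEuler, sum_homPart (degLT_totalDegree P)]
  refine Finset.sum_congr rfl fun e _ => congrArg _ ?_
  ext1 s
  rw [coeff_homPart, coeff_homogeneousComponent]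

theorem varZ_pow_apply (ħ : ℝ) (m : ℕ) (P : LocalSymbol n) :
    (varZ n ħ ^ m) P = (-(Complex.I * ħ) / 4) ^ m • (divOp n ^ m) P := by
  rw [varZ, smul_pow, LinearMap.smul_apply]

theorem finsum_diagOp_divOp_pow (lam del c : ℂ) (P : LocalSymbol n) (F : ℕ → LocalSymbol n)
    (hF : ∀ m, F m = c ^ m • diagOp n (quantCoeff n lam del m) ((divOp n ^ m) P)) :
    ∑ᶠ m, F m = quantSymb n lam del c P := by
  rw [quantSymb_eq lam del c (degLT_totalDegree P), quantTrunc_apply,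
    finsum_eq_finsetSum_of_support_subset F (s := Finset.range (P.totalDegree + 1))]
  · exact Finset.sum_congr rfl fun m _ => hF m
  · intro m hm
    by_contra h
    apply hm
    rw [hF, divOp_pow_eq_zero (by simpa using h) (degLT_totalDegree P), map_zero, smul_zero]

theorem hypEuler_eq_quantSymb {lam del : ℂ} (hres : ∀ l : ℕ, ((n : ℂ) + 1) * (1 - del) + l ≠ 0)
    (ħ : ℝ) (P : LocalSymbol n) :
    hypEuler (parA₁ n lam RatFunc.X) (parA₂ n del RatFunc.X) (parB₁ n del RatFunc.X)
      (parB₂ n del RatFunc.X) (varZ n ħ) P = quantSymb n lam del (-(Complex.I * ħ)) P := by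
  refine finsum_diagOp_divOp_pow lam del _ P _ fun m => ?_
  rw [ratEuler_eq_diagOp, varZ_pow_apply, map_smul]
  ext1 s
  rw [coeff_smul, coeff_smul, coeff_diagOp, coeff_diagOp, eval_hypCoeff hres, smul_smul, smul_smul,
    div_pow]
  congr 1
  field_simp

theorem rising_apply (a : ℕ → ℂ) (m e : ℕ) : rising a m e = rising (a e) m :=
  map_rising (Pi.evalAlgHom ℂ (fun _ : ℕ => ℂ) e) a m

theorem eulerOp_eq_diagHom : eulerOp n = diagHom n (fun e => (e : ℂ)) := eulerOp_eq_diagOp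

theorem isUnit_of_forall_ne_zero {φ : ℕ → ℂ} (h : ∀ e, φ e ≠ 0) : IsUnit φ :=
  Pi.isUnit_iff.mpr fun e => (h e).isUnit

theorem isUnit_rising_parB₁ {del : ℂ} (hres : ∀ l : ℕ, ((n : ℂ) + 1) * (1 - del) + l ≠ 0)
    (hdel : del ≠ (n : ℂ) / ((n : ℂ) + 1)) (m : ℕ) :
    IsUnit (rising (parB₁ n del (fun e : ℕ => (e : ℂ))) m) :=
  isUnit_of_forall_ne_zero fun e => by
    rw [rising_apply]
    exact rising_parB₁_ne_zero hres hdel m e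

theorem isUnit_rising_parB₂ {del : ℂ} (hres : ∀ l : ℕ, ((n : ℂ) + 1) * (1 - del) + l ≠ 0)
    (m : ℕ) : IsUnit (rising (parB₂ n del (fun e : ℕ => (e : ℂ))) m) :=
  isUnit_of_forall_ne_zero fun e => by
    rw [rising_apply]
    exact rising_parB₂_ne_zero hres m e

theorem hypOp_eq_quantSymb {del : ℂ} (hres : ∀ l : ℕ, ((n : ℂ) + 1) * (1 - del) + l ≠ 0)
    (lam : ℂ) (hdel : del ≠ (n : ℂ) / ((n : ℂ) + 1)) (ħ : ℝ)
    (P : LocalSymbol n) :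
    hypOp (parA₁ n lam (eulerOp n)) (parA₂ n del (eulerOp n)) (parB₁ n del (eulerOp n))
      (parB₂ n del (eulerOp n)) (varZ n ħ) P = quantSymb n lam del (-(Complex.I * ħ)) P := by
  refine finsum_diagOp_divOp_pow lam del _ P _ fun m => ?_
  -- Functions of 𝓔 are the image of the algebra of sequences, where inverses are pointwise; an
  -- algebra homomorphism carries inverses of units to inverses.
  have hinv : ∀ φ : ℕ → ℂ, IsUnit φ → Ring.inverse (diagHom n φ) = diagHom n (Ring.inverse φ) := by
    rintro _ ⟨φ, rfl⟩
    rw [Ring.inverse_unit]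
    exact Ring.inverse_unit (Units.map (diagHom n : (ℕ → ℂ) →* Module.End ℂ (LocalSymbol n)) φ)
  have hfac : (m.factorial : ℂ) ≠ 0 := by exact_mod_cast m.factorial_ne_zero
  rw [eulerOp_eq_diagHom, ← map_parA₁, ← map_parA₂, ← map_parB₁, ← map_parB₂, ← map_rising,
    ← map_rising, ← map_rising, ← map_rising, hinv _ (isUnit_rising_parB₁ hres hdel m),
    hinv _ (isUnit_rising_parB₂ hres m), ← map_mul, ← map_mul, ← map_mul, LinearMap.smul_apply,
    Module.End.mul_apply, varZ_pow_apply, map_smul, diagHom_apply]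
  ext1 s
  rw [coeff_smul, coeff_smul, coeff_smul, coeff_diagOp, coeff_diagOp, smul_smul, smul_smul,
    smul_smul,
    quantCoeff_eq]
  congr 1
  have hB₁ := rising_parB₁_ne_zero hres hdel m s.degree
  have hB₂ := rising_parB₂_ne_zero hres m s.degree
  have hA := rising_parA₂_add_ne_zero hres m s.degree
  have hdup := rising_parB₁_mul_rising_parB₂ (n := n) del (s.degree : ℂ) m
  have hi : ∀ φ : ℕ → ℂ, IsUnit φ → Ring.inverse φ s.degree = (φ s.degree)⁻¹ := by
    intro φ hφ
    have h1 := congrFun (Ring.mul_inverse_cancel φ hφ) s.degree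
    exact eq_inv_of_mul_eq_one_right h1
  simp only [Pi.mul_apply, hi _ (isUnit_rising_parB₁ hres hdel m), hi _
    (isUnit_rising_parB₂ hres m),
    rising_apply]
  change (m.factorial : ℂ)⁻¹ * (-(Complex.I * ħ) / 4) ^ m
    * (rising (parA₁ n lam (s.degree : ℂ)) m * rising (parA₂ n del (s.degree : ℂ)) m
      * (rising (parB₁ n del (s.degree : ℂ)) m)⁻¹ * (rising (parB₂ n del (s.degree : ℂ)) m)⁻¹) = _
  rw [div_pow]
  field_simp
  linear_combination -((-(Complex.I * ħ)) ^ m * rising (parA₁ n lam (s.degree : ℂ)) m) * hdup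

end ProjQuant

end

/-! ### Assembly of the theorem -/

open ProjQuant in
theorem theorem3p1 (n : ℕ) (hn : 1 ≤ n) (lam mu : ℂ) (ħ : ℝ) (hħ : ħ ≠ 0)
    (hres : ∀ l : ℕ, mu - lam ≠ 1 + (l : ℂ) / ((n : ℂ) + 1)) :
    ∃ Q : Symb n (mu - lam) →ₗ[ℂ] DiffOp n lam mu,
      IsNormalized ħ Q ∧ IsGroupEquivariant Q ∧ IsLieEquivariant Q ∧ Function.Bijective Q ∧
      (∀ Q' : Symb n (mu - lam) →ₗ[ℂ] DiffOp n lam mu,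
        IsNormalized ħ Q' → IsLieEquivariant Q' → Q' = Q) ∧
      (∀ (P : Symb n (mu - lam)) (f : Density n lam) (g : Matrix.SpecialLinearGroup (Fin (n
          + 1)) ℝ),
        ((Q P).1 f).1 g = normalOrder ħ
          (hypEuler (parA₁ n lam RatFunc.X) (parA₂ n (mu - lam) RatFunc.X)
            (parB₁ n (mu - lam) RatFunc.X) (parB₂ n (mu - lam) RatFunc.X)
            (varZ n ħ) (P.1 g)) (f.1 g)) ∧
      (mu - lam ≠ (n : ℂ) / ((n : ℂ) + 1) →
        (∀ m : ℕ, IsUnit (rising (parB₁ n (mu - lam) (eulerOp n)) m) ∧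
          IsUnit (rising (parB₂ n (mu - lam) (eulerOp n)) m)) ∧
        ∀ (P : Symb n (mu - lam)) (f : Density n lam)
          (g : Matrix.SpecialLinearGroup (Fin (n + 1)) ℝ),
          ((Q P).1 f).1 g = normalOrder ħ
            (hypOp (parA₁ n lam (eulerOp n)) (parA₂ n (mu - lam) (eulerOp n))
              (parB₁ n (mu - lam) (eulerOp n)) (parB₂ n (mu - lam) (eulerOp n))
              (varZ n ħ) (P.1 g)) (f.1 g)) := by
  have hn1 : (n : ℂ) + 1 ≠ 0 := by exact_mod_cast n.succ_ne_zero
  have hres' : ∀ l : ℕ, ((n : ℂ) + 1) * (1 - (mu - lam)) + l ≠ 0 := by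
    intro l h
    apply hres l
    field_simp
    linear_combination -h
  have hc : -(Complex.I * (ħ : ℂ)) ≠ 0 := by simp [hħ]
  refine ⟨quantMap hn (-(Complex.I * ħ)) hres', isNormalized_quantMap hn hres' ħ,
    isGroupEquivariant_quantMap hn _ hres', isLieEquivariant_quantMap hn _ hres',
    ⟨quantMap_injective hn hres' hc, quantMap_surjective hn hres' hc⟩,
    fun Q' hN hL => quantMap_unique hn hres' hħ Q' hN hL, fun P f g => ?_,
    fun hdel => ⟨fun m => ⟨?_, ?_⟩, fun P f g => ?_⟩⟩
  · rw [quantMap_apply, normalOrder, hypEuler_eq_quantSymb hres']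
  · rw [eulerOp_eq_diagHom, ← map_parB₁, ← map_rising]
    exact (isUnit_rising_parB₁ hres' hdel m).map (diagHom n)
  · rw [eulerOp_eq_diagHom, ← map_parB₂, ← map_rising]
    exact (isUnit_rising_parB₂ hres' m).map (diagHom n)
  · rw [quantMap_apply, normalOrder, hypOp_eq_quantSymb hres' lam hdel]
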